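/- **Setting.** $M$ players face $K\ge M\ge 1$ arms for $T\ge 1$ rounds. In round $t$ arm $k$ has for player $m$ a random utility $Y^m_{k,t}\in[0,1]$; the families $(Y^m_{k,t})_{m,k}$ are independent over $t$, and for all $m,k$ the law of $Y^m_{k,t}$ does not depend on $t$; let $\mu^m_k$ be its mean. If player $m$ pulls arm $A^m(t)$, her reward $R^m(t)$ is $Y^m_{A^m(t),t}$, or $0$ if another player pulls the same arm in this round (a collision). She observes only her own reward and whether she is in a collision, and her choices depend only on her own past observations and on her own uniform random draws, which are independent of each other, of the draws of the other players and of the utilities. A matching is an injective map $\pi:\{1,\dots,M\}\to\{1,\dots,K\}$. With $U^\star=\max_\pi\sum_m\mu^m_{\pi(m)}$ the regret is $R_T=TU^\star-\mathbb E\big[\sum_{t=1}^T\sum_{m=1}^M R^m(t)\big]$. Write $\ln$ and $\lg$ for the logarithms in base $e$ and $2$. **Algorithm (M-ETC-Elim with $c=1$).** It is given $K$ and $T$; $M$ is not known to the players. All players run the same program. *Initialization.* For $\lceil K\ln(K^2T)\rceil$ rounds a player pulls uniformly random arms until she has no collision for the first time, and from then on she pulls this arm, say $k$ ($k=1$ if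 she always had collisions). She then pulls arm $k$ for $2k-2$ rounds, arms $k+1,\dots,K$ once each, and arm $1$ for $K-k$ rounds. Her rank is $1$ plus the number of her collisions in the first $2k-2$ of these rounds; the number of players is her rank plus the number of her collisions on the arms $k+1,\dots,K$. The player of rank $1$ is the leader, the others are the followers; below, players are indexed by rank. The initial communication arm of a player is her rank. *Communication.* While messages are sent, all players stay on their communication arms, except that the sender of a bit $1$ pulls the communication arm of the receiver, who reads the bits from her collisions. Arms are sent with $\lceil\lg K\rceil$ bits and the size of $\mathcal C$ with $\lceil\lg(MK+1)\rceil$ bits. *Epochs $p=1,2,\dots$.* The leader has a set $\mathcal E$ of candidate edges $(m,k)$, initially all of them, and estimates $\tilde\mu^m_k$, initially $0$. Let $\varepsilon_p=\sqrt{\ln(2M^2KT^2)/2^{1+p}}$. The leader computes a matching $\pi_1$ maximizing $\tilde U(\pi)=\sum_n\tilde\mu^n_{\pi(n)}$, and for every $(m,k)\in\mathcal E$ a matching $\tilde\pi^{m,k}$ maximizing $\tilde U$ among those with $\pi(m)=k$ (ties are broken by an arbitrary measurable rule). She removes from $\mathcal E$ the edges with $\tilde U(\pi_1)-\tilde U(\tilde\pi^{m,k})>4M\varepsilon_p$,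 and $\mathcal C$ is the set of the matchings $\tilde\pi^{m,k}$ of the remaining edges. She sends to each follower in turn the size of $\mathcal C$, and then to each follower $m$ in turn the arms $\pi(m)$, $\pi\in\mathcal C$, and the new communication arms $\pi_1(1)$ and $\pi_1(m)$. If $\mathcal C$ is a singleton $\{\pi\}$, all players pull their arms in $\pi$ for the rest of the game. Otherwise, for each $\pi\in\mathcal C$ in turn, each player $m$ pulls the arm $\pi(m)$ for $2^p$ rounds. The new estimate for $(m,k)$ is the average of the rewards that player $m$ got from arm $k$ during this exploration ($0$ if she did not pull it). Each follower in turn truncates her $K$ estimates to their $\lceil(p+1)/2\rceil$ most significant bits (where $1=0.11\dots1$) and sends them to the leader, from and to the new communication arms. **Theorem 4.** For every $T\ge1$, all $1\le M\le K$ and all distributions of the utilities as above, the regret of M-ETC-Elim with $c=1$ satisfies $$R_T\le 2+MK\ln(e^2K^2T)+3M^2K\,\lg(K)\lg(T)+MK\,\lg^2(T)+\frac{4\sqrt2-2}{3-2\sqrt2}\,M^3K\,\lg(K)\sqrt{\ln(2M^2KT^2)}+\frac{8}{\sqrt2-1}\,K^{1/2}M^{3/2}\sqrt{T\ln(2M^2KT^2)}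 .$$ -/

import Mathlib

open MeasureTheory ProbabilityTheory

noncomputable section

namespace METCElim

/-! ### Programs executed by one player -/

/-- A program of a single player facing `K` arms. In each round the player pulls an arm,
either a prescribed one or one drawn uniformly at random, and then observes her reward and her
collision indicator. The continuation depends on nothing else, so that decisions are functions of
the own past observations and of the own random draws only. `done a` means that the program has
ended with the value `a`. -/
inductive Prog (K : ℕ) (α : Type) : Type where
  | done (a : α) : Prog K α
  | pull (a : Fin K) (next : ℝ × Bool → Prog K α) : Prog K α
  | pullUnif (next : Fin K → ℝ × Bool → Prog K α) : Prog K α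

namespace Prog

variable {K : ℕ} {α β : Type}

/-- Sequential composition of programs. -/
def bind : Prog K α → (α → Prog K β) → Prog K β
  | done a, f => f a
  | pull a next, f => pull a fun o => (next o).bind f
  | pullUnif next, f => pullUnif fun i o => (next i o).bind f

instance : Monad (Prog K) where
  pure := done
  bind := bind

/-- The arm pulled in the current round; `d` is the uniform draw of the player in this round.
A program that has ended pulls the first arm. -/
def arm [NeZero K] : Prog K α → Fin K → Fin K
  | done _, _ => 0
  | pull a _, _ => a
  | pullUnif _, d => d

/-- The program that remains to be executed after the current round, where `d` is the uniform draw
and `o` is the observation (reward, collision indicator) of the player in this round. -/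
def after : Prog K α → Fin K → ℝ × Bool → Prog K α
  | done a, _, _ => done a
  | pull _ next, _, o => next o
  | pullUnif next, d, o => next d o

/-- Execute `f 0`, `f 1`, ..., `f (n - 1)` in this order and collect the results. -/
def seqFin : (n : ℕ) → (Fin n → Prog K α) → Prog K (Fin n → α)
  | 0, _ => done Fin.elim0
  | n + 1, f => do
      let a ← f 0
      let r ← seqFin n fun i => f i.succ
      return Fin.cons a r

/-- Pull the arms of a list one after the other and return the observations in the same order. -/
def pullList : List (Fin K) → Prog K (List (ℝ × Bool))
  | [] => done []
  | a :: as => pull a fun o => do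
      let os ← pullList as
      return o :: os

/-- Pull the arm `a` for `n` rounds and ignore the observations. -/
def stay (a : Fin K) (n : ℕ) : Prog K Unit := do
  let _ ← pullList (List.replicate n a)
  return ()

end Prog

open Prog

/-! ### The initialization procedure -/

section Init

variable (K : ℕ) [NeZero K]

/-- The musical chairs phase, for a given number of rounds. The second argument is the arm that is
already occupied by the player, if there is one. -/
def musicalChairs : ℕ → Option (Fin K) → Prog K (Option (Fin K))
  | 0, k => done k
  | n + 1, none => pullUnif fun i o => musicalChairs n (if o.2 then none else some i)
  | n + 1, some k => pull k fun _ => musicalChairs n (some k)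

/-- The number of collisions in a list of observations. -/
def collisionCount (os : List (ℝ × Bool)) : ℕ := os.countP fun o => o.2

/-- The initialization procedure with failure probability `δ₀`; it returns the pair `(R, M)` of
the rank (starting from `1`) and of the number of players, as computed by the player.
The arm with number `k` in `1, ..., K` is `⟨k - 1, _⟩ : Fin K`. A player who has not occupied any
arm during the musical chairs phase (a failure) continues with the first arm. -/
def initProc (δ₀ : ℝ) : Prog K (ℕ × ℕ) := do
  let occ ← musicalChairs K ⌈(K : ℝ) * Real.log (K / δ₀)⌉₊ none
  let k : Fin K := occ.getD 0
  let wait ← pullList (List.replicate (2 * k.val) k)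
  let R := 1 + collisionCount wait
  let sweep ← pullList ((List.finRange K).filter fun a => k < a)
  let M := R + collisionCount sweep
  stay 0 (K - 1 - k.val)
  return (R, M)

end Init

/-! ### The communication protocol -/

section Comm

variable {K : ℕ}

/-- The `b` binary digits of lowest order of `x`, the lowest one first. -/
def encode (b x : ℕ) : List Bool := (List.range b).map fun i => x.testBit i

/-- The number with the given binary digits, the lowest one first. -/
def decode (l : List Bool) : ℕ := l.foldr (fun d x => d.toNat + 2 * x) 0

/-- Send bits to the player whose communication arm is `target`: for a bit `1` pull `target`, for
a bit `0` pull the own communication arm. -/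
def send (own target : Fin K) (bits : List Bool) : Prog K Unit := do
  let _ ← pullList (bits.map fun d => if d then target else own)
  return ()

/-- Receive a number of `b` bits: stay on the own communication arm and read the collisions. -/
def receive (own : Fin K) (b : ℕ) : Prog K ℕ := do
  let os ← pullList (List.replicate b own)
  return decode (os.map fun o => o.2)

/-- The number of bits used for (the index of) an arm, `⌈lg K⌉`. -/
def armBits (K : ℕ) : ℕ := Nat.clog 2 K

/-- The number of bits used for the size of the list of candidate matchings, which lies between
`0` and `M * K`. -/
def sizeBits (K M : ℕ) : ℕ := Nat.clog 2 (M * K + 1)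

/-- The number `⌈(p ^ c + 1) / 2⌉` of bits used for an estimated mean in epoch `p`. -/
def meanBits (c p : ℕ) : ℕ := (p ^ c + 2) / 2

end Comm

/-! ### The main phases -/

section Main

variable {K : ℕ}

/-- The empirical mean of the rewards of arm `k`, when the arms in the list `as` have been
pulled and the observations in the list `os` have been made; it is `0` if `k` is not in `as`. -/
def empMean (as : List (Fin K)) (os : List (ℝ × Bool)) (k : Fin K) : ℝ :=
  let rs := ((as.zip os).filter fun x => x.1 = k).map fun x => x.2.1
  rs.sum / rs.length

/-- The integer whose `b` binary digits are the `b` most significant binary digits of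
`x ∈ [0, 1]` (where `1 = 0.111...`), i.e. `x` truncated to `b` bits is `truncate b x / 2 ^ b`. -/
def truncate (b : ℕ) (x : ℝ) : ℕ := min ⌊2 ^ b * x⌋₊ (2 ^ b - 1)

/-- `δ = 1 / (M² K T²)`. -/
def delta (K M T : ℕ) : ℝ := 1 / ((M : ℝ) ^ 2 * K * (T : ℝ) ^ 2)

/-- `ε_p = √(ln (2 / δ) / 2 ^ (1 + p ^ c))`. -/
def eps (K M T c p : ℕ) : ℝ := √(Real.log (2 / delta K M T) / 2 ^ (1 + p ^ c))

/-- The finite set of all matchings of `n` players (indexed by their ranks) with `K` arms. -/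
def matchings (K n : ℕ) : Finset (Fin n → Fin K) :=
  Finset.univ.filter fun π => Function.Injective π

/-- The finite set of all matchings that contain the edge `e`. -/
def matchingsThrough {n : ℕ} (e : Fin n × Fin K) : Finset (Fin n → Fin K) :=
  (matchings K n).filter fun π => π e.1 = e.2

/-- The weight of `π` for the edge weights `w`. -/
def weight {n : ℕ} (w : Fin n → Fin K → ℝ) (π : Fin n → Fin K) : ℝ := ∑ m, w m (π m)

/-- A rule to compute an `argmax` of the weight over a non-empty set of matchings; ties
are broken arbitrarily (in a measurable way). -/
structure ArgmaxRule (K : ℕ) where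
  /-- the selected matching, for edge weights `w` -/
  sel : (n : ℕ) → Finset (Fin n → Fin K) → (Fin n → Fin K → ℝ) → (Fin n → Fin K)
  sel_mem : ∀ n S w, S.Nonempty → sel n S w ∈ S
  weight_le : ∀ n S w, ∀ π ∈ S, weight w π ≤ weight w (sel n S w)
  measurable_sel : ∀ n S, Measurable (sel n S)

variable (rule : ArgmaxRule K) (T c : ℕ)

/-- The epochs `p, p + 1, ...` of the leader, at most `fuel` many. There are `n` followers; the
players are indexed by `Fin (n + 1)` according to their ranks, the leader being `0`.
`E` lists the candidate edges, `w` holds the estimated utilities, and `κ` the communication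
arms. -/
def leaderLoop (n : ℕ) : (fuel p : ℕ) → (E : List (Fin (n + 1) × Fin K)) →
    (w : Fin (n + 1) → Fin K → ℝ) → (κ : Fin (n + 1) → Fin K) → Prog K Unit
  | 0, _, _, _, _ => done ()
  | fuel + 1, p, E, w, κ => do
      let π₁ := rule.sel (n + 1) (matchings K (n + 1)) w
      let assoc := fun e => rule.sel (n + 1) (matchingsThrough e) w
      -- candidate edges that are kept, and the associated matchings, without repetitions
      let Enew := E.filter fun e =>
        ∑ m, (w m (π₁ m) - w m (assoc e m)) ≤ 4 * ((n + 1 : ℕ) : ℝ) * eps K (n + 1) T c p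
      let C := (Enew.map assoc).dedup
      -- communication: the size of the list to each follower, then the remaining messages
      let _ ← seqFin n fun j =>
        send (κ 0) (κ j.succ) (encode (sizeBits K (n + 1)) C.length)
      let _ ← seqFin n fun j => do
        send (κ 0) (κ j.succ) (C.flatMap fun π => encode (armBits K) (π j.succ).val)
        send (κ 0) (κ j.succ) (encode (armBits K) (π₁ 0).val)
        send (κ 0) (κ j.succ) (encode (armBits K) (π₁ j.succ).val)
      match C with
      | [π] =>
        -- exploitation for the rest of the game
        stay (π 0) T
      | _ =>
        -- exploration
        let as := C.flatMap fun π => List.replicate (2 ^ p ^ c) (π 0)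
        let os ← pullList as
        -- communication: the estimates of the followers
        let x ← seqFin n fun _ => seqFin K fun _ => receive (π₁ 0) (meanBits c p)
        let wnew : Fin (n + 1) → Fin K → ℝ :=
          Fin.cons (empMean as os) fun j k => (x j k : ℝ) / 2 ^ meanBits c p
        leaderLoop n fuel (p + 1) Enew wnew π₁

variable (K) in
/-- The epochs `p, p + 1, ...` of the follower of rank `R` among `M` players, at most `fuel`
many. Her current communication arm is `κ`, and she stays on it while the leader communicates
with other followers. -/
def followerLoop [NeZero K] (R M : ℕ) : (fuel p : ℕ) → (κ : Fin K) → Prog K Unit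
  | 0, _, _ => done ()
  | fuel + 1, p, κ => do
      -- the size of the list of candidate matchings
      stay κ ((R - 2) * sizeBits K M)
      let size ← receive κ (sizeBits K M)
      stay κ ((M - R) * sizeBits K M)
      -- the own arms in the candidate matchings, and the new communication arms
      stay κ ((R - 2) * ((size + 2) * armBits K))
      let x ← seqFin size fun _ => receive κ (armBits K)
      let y₁ ← receive κ (armBits K)
      let y ← receive κ (armBits K)
      stay κ ((M - R) * ((size + 2) * armBits K))
      let arms : List (Fin K) := List.ofFn fun i => Fin.ofNat K (x i)
      let κ₁ : Fin K := Fin.ofNat K y₁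
      let κnew : Fin K := Fin.ofNat K y
      match arms with
      | [a] =>
        -- exploitation for the rest of the game
        stay a T
      | _ =>
        -- exploration
        let as := arms.flatMap fun a => List.replicate (2 ^ p ^ c) a
        let os ← pullList as
        -- communication: the truncated estimates
        stay κnew ((R - 2) * (K * meanBits c p))
        let _ ← seqFin K fun k =>
          send κnew κ₁ (encode (meanBits c p) (truncate (meanBits c p) (empMean as os k)))
        stay κnew ((M - R) * (K * meanBits c p))
        followerLoop R M fuel (p + 1) κnew

/-- The algorithm M-ETC-Elim with parameter `c` for the horizon `T`, as executed by each player.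
Initially every player uses the arm numbered by her rank as communication arm. As every epoch
takes at least one round, `T` epochs are enough to last until the horizon. -/
def metcElim [NeZero K] : Prog K Unit := do
  let RM ← initProc K (1 / ((K : ℝ) * T))
  if RM.1 = 1 then
    let n := RM.2 - 1
    leaderLoop rule T c n T 1 (List.finRange (n + 1) ×ˢ List.finRange K) (fun _ _ => 0)
      (fun i => Fin.ofNat K i.val)
  else
    followerLoop K T c RM.1 RM.2 T 1 (Fin.ofNat K (RM.1 - 1))

end Main

/-! ### The game -/

section Game

variable {K M : ℕ}

/-- Whether player `m` is involved in a collision when the players pull the arms `A`. -/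
def collides (A : Fin M → Fin K) (m : Fin M) : Bool := decide (∃ n, n ≠ m ∧ A n = A m)

/-- The reward of player `m` when the players pull the arms `A` and `y m k` is the utility of
arm `k` for player `m` in this round. -/
def gain (y : Fin M → Fin K → ℝ) (A : Fin M → Fin K) (m : Fin M) : ℝ :=
  if collides A m then 0 else y m (A m)

variable [NeZero K]

/-- The programs that remain to be executed by the players before round `t` (rounds are numbered
from `0`) when all players execute `prog`, the utilities are `y t m k`, and the uniform draws of
the players are `d t m`. -/
def progAt (prog : Prog K Unit) (y : ℕ → Fin M → Fin K → ℝ) (d : ℕ → Fin M → Fin K) :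
    ℕ → Fin M → Prog K Unit
  | 0, _ => prog
  | t + 1, m =>
      let S := progAt prog y d t
      let A : Fin M → Fin K := fun n => (S n).arm (d t n)
      (S m).after (d t m) (gain (y t) A m, collides A m)

/-- The arm pulled by player `m` in round `t`. -/
def armAt (prog : Prog K Unit) (y : ℕ → Fin M → Fin K → ℝ) (d : ℕ → Fin M → Fin K)
    (t : ℕ) (m : Fin M) : Fin K :=
  (progAt prog y d t m).arm (d t m)

/-- The reward of player `m` in round `t`. -/
def rewardAt (prog : Prog K Unit) (y : ℕ → Fin M → Fin K → ℝ) (d : ℕ → Fin M → Fin K)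
    (t : ℕ) (m : Fin M) : ℝ :=
  gain (y t) (armAt prog y d t) m

variable {Ω : Type*} [MeasurableSpace Ω]

/-- The stochastic model: `Y t ω m k` is the utility of arm `k` for player `m` in round `t`, and
`D t ω m` is the random arm that player `m` can use in round `t` for her randomization. -/
structure IsBanditModel (P : Measure Ω) (Y : ℕ → Ω → Fin M → Fin K → ℝ)
    (D : ℕ → Ω → Fin M → Fin K) : Prop where
  measurable_Y : ∀ t, Measurable (Y t)
  /-- utilities lie in `[0, 1]` -/
  mem_Icc : ∀ t ω m k, Y t ω m k ∈ Set.Icc (0 : ℝ) 1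
  /-- utilities in different rounds are independent -/
  indep_Y : iIndepFun Y P
  /-- the utilities of an arm for a player have the same law in all rounds -/
  ident_Y : ∀ m k t, IdentDistrib (fun ω => Y t ω m k) (fun ω => Y 0 ω m k) P P
  measurable_D : ∀ t, Measurable (D t)
  /-- the draws of the players are uniformly distributed on the arms -/
  unif_D : ∀ t m a, P {ω | D t ω m = a} = (K : ENNReal)⁻¹
  /-- the draws of different players or in different rounds are independent -/
  indep_D : iIndepFun (fun (i : ℕ × Fin M) ω => D i.1 ω i.2) P
  /-- the draws are independent of the utilities -/
  indep_YD : IndepFun (fun ω t => Y t ω) (fun ω t => D t ω) P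

/-- The mean utility `μ` of arm `k` for player `m`. -/
def meanUtility (P : Measure Ω) (Y : ℕ → Ω → Fin M → Fin K → ℝ) (m : Fin M) (k : Fin K) : ℝ :=
  ∫ ω, Y 0 ω m k ∂P

/-- The maximum utility of a matching of the players with the arms, for the mean utilities `μ`. -/
def maxUtility (μ : Fin M → Fin K → ℝ) : ℝ := ⨆ π : Fin M ↪ Fin K, ∑ m, μ m (π m)

/-- The expected regret up to the horizon `T` when all players execute `prog`. -/
def regret (P : Measure Ω) (Y : ℕ → Ω → Fin M → Fin K → ℝ) (D : ℕ → Ω → Fin M → Fin K)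
    (prog : Prog K Unit) (T : ℕ) : ℝ :=
  T * maxUtility (meanUtility P Y) -
    ∫ ω, ∑ t ∈ Finset.range T, ∑ m,
      rewardAt prog (fun s => Y s ω) (fun s => D s ω) t m ∂P

end Game

end METCElim

end

/-! Write L = ln(2M²KT²). The arms pulled in round t are a function of the draws and of the earlier
utilities, hence independent of the utilities of round t. So the regret is the expectation of a sum
of `roundRegret`, the loss of a round computed with the mean utilities
(`IsBanditModel.indepFun_armAt`, `IsBanditModel.regret_eq`). It remains to bound this sum along
every trajectory outside a bad event.

The bad event has two sources. A player may end musical chairs without an arm; in each round she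
succeeds with conditional probability at least 1/K, so some player fails with probability at most
M/(K²T) (`measure_exists_occ_none_le`). Or an empirical mean of epoch p misses the true mean by more
than ε_p. The explored matchings are random, but they and the rounds of their exploration are
determined by the utilities before the epoch. For a fixed plan the samples are therefore independent
of the event that this plan is used, and Hoeffding's inequality applies (`measure_deviationSet_le`).
A union bound over T epochs and MK edges gives 1/(MT). Players are indexed by rank in this argument;
the ranks depend on the draws only, which are independent of the utilities
(`IsBanditModel.measure_deviation_le`). As a trajectory costs at most TM, the bad event contributes
at most (M/K)² + 1 ≤ 2.

On a good trajectory the communication is free of errors: the communication arms are distinct, so a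
receiver collides exactly when a bit 1 is sent (`play_broadcast`, `play_collect`). The joint play is
then described by `epochData`, a function of the utilities alone. Accuracy of the estimates
(`IsAccurate`) passes from epoch to epoch and ensures that the edges of an optimal matching are
never removed, that the best estimated matching is 4Mε_p-optimal, that the explored matchings are
8Mε_p-optimal, and that a lone candidate is optimal.

A communication round costs at most 2 more than the suboptimality of the communication arms.
Explorations at least double from epoch to epoch, so only epochs p < ⌊lg T⌋ start before the
horizon, and the geometric decay of ε_p bounds the communication (`sum_commRegret_le`). If x rounds
of exploration have been made up to epoch p, then x ≤ MK·2^(p+1), so an exploration round costs at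
most 8Mε_p ≤ 8M√(MKL/x); summing over x gives 16M√(MKLT) (`explore_regret_le`, `tailSum_epochs_le`).

Programs carry no σ-algebra. That the arms are measurable is obtained from the predicate `MeasProg`,
which is closed under measurable branching over countably many cases. -/

namespace METCElim

open Prog

/-! ### Programs as a monad -/

namespace Prog

variable {K : ℕ} {α β γ : Type}

theorem bind_eq (p : Prog K α) (f : α → Prog K β) : p >>= f = p.bind f := rfl

theorem pure_eq (a : α) : (pure a : Prog K α) = done a := rfl

@[simp] theorem done_bind (a : α) (f : α → Prog K β) : (done a).bind f = f a := rfl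

@[simp] theorem pull_bind (a : Fin K) (g : ℝ × Bool → Prog K α) (f : α → Prog K β) :
    (pull a g).bind f = pull a fun o => (g o).bind f := rfl

@[simp] theorem pullUnif_bind (g : Fin K → ℝ × Bool → Prog K α) (f : α → Prog K β) :
    (pullUnif g).bind f = pullUnif fun i o => (g i o).bind f := rfl

theorem bind_assoc (p : Prog K α) (f : α → Prog K β) (g : β → Prog K γ) :
    (p.bind f).bind g = p.bind fun a => (f a).bind g := by
  induction p with
  | done a => rfl
  | pull a next ih => simp only [pull_bind, ih]
  | pullUnif next ih => simp only [pullUnif_bind, ih]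

@[simp] theorem bind_done (p : Prog K α) : p.bind done = p := by
  induction p with
  | done a => rfl
  | pull a next ih => simp only [pull_bind, ih]
  | pullUnif next ih => simp only [pullUnif_bind, ih]

end Prog

/-! ### Runs of a single program -/

section Run

variable {K : ℕ} {α β : Type}

/-- `Run d a o t t' p v`: if the draws, the pulled arms and the observations in round `s` are
`d s`, `a s` and `o s`, then the program `p`, started in round `t`, pulls these arms and ends
before round `t'` with the value `v`. -/
inductive Run (d a : ℕ → Fin K) (o : ℕ → ℝ × Bool) : {α : Type} → ℕ → ℕ → Prog K α → α → Prop
  | done {α : Type} (t : ℕ) (v : α) : Run d a o t t (Prog.done v) v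
  | pull {α : Type} {t t' : ℕ} {x : Fin K} {next : ℝ × Bool → Prog K α} {v : α}
      (h : a t = x) (hr : Run d a o (t + 1) t' (next (o t)) v) :
      Run d a o t t' (Prog.pull x next) v
  | pullUnif {α : Type} {t t' : ℕ} {next : Fin K → ℝ × Bool → Prog K α} {v : α}
      (h : a t = d t) (hr : Run d a o (t + 1) t' (next (a t) (o t)) v) :
      Run d a o t t' (Prog.pullUnif next) v

variable {d a : ℕ → Fin K} {o : ℕ → ℝ × Bool}

theorem Run.bind {t t' t'' : ℕ} {p : Prog K α} {v : α} {f : α → Prog K β} {w : β}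
    (h : Run d a o t t' p v) (h' : Run d a o t' t'' (f v) w) :
    Run d a o t t'' (p.bind f) w := by
  induction h with
  | done t v => exact h'
  | pull h hr ih => exact Run.pull h (ih h')
  | pullUnif h hr ih => exact Run.pullUnif h (ih h')

theorem Run.le {t t' : ℕ} {p : Prog K α} {v : α} (h : Run d a o t t' p v) : t ≤ t' := by
  induction h <;> omega

theorem run_pullList (as : List (Fin K)) (t : ℕ)
    (ha : ∀ i (h : i < as.length), a (t + i) = as[i]) :
    Run d a o t (t + as.length) (pullList as) ((List.range as.length).map fun i => o (t + i)) := by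
  induction as generalizing t with
  | nil => exact Run.done t []
  | cons x as ih =>
    have h0 := ha 0 (by simp)
    refine Run.pull (by simpa using h0) ?_
    have h1 := ih (t + 1) (fun i hi => by
      have := ha (i + 1) (by simpa using hi)
      simpa [add_assoc, add_comm 1 i] using this)
    have h2 : Run d a o (t + 1 + as.length) (t + 1 + as.length)
        (Prog.done (o t :: (List.range as.length).map fun i => o (t + 1 + i)) : Prog K _) _ :=
      Run.done _ _
    have h3 := h1.bind (f := fun os => Prog.done (o t :: os)) h2
    have e : (List.range (x :: as).length).map (fun i => o (t + i))
        = o t :: (List.range as.length).map fun i => o (t + 1 + i) := by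
      simp [List.range_succ_eq_map, Function.comp_def, add_assoc, add_comm 1]
    have e2 : t + (x :: as).length = t + 1 + as.length := by simp; omega
    rw [e, e2]
    exact h3

theorem run_stay (x : Fin K) (n t : ℕ) (ha : ∀ i < n, a (t + i) = x) :
    Run d a o t (t + n) (stay x n) () := by
  have h := run_pullList (d := d) (a := a) (o := o) (List.replicate n x) t
    (fun i h => by simpa using ha i (by simpa using h))
  simp only [List.length_replicate] at h
  exact h.bind (f := fun _ => Prog.done ()) (Run.done _ _)

theorem run_seqFin (n L : ℕ) (f : Fin n → Prog K α) (v : Fin n → α) (t : ℕ)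
    (h : ∀ i : Fin n, Run d a o (t + i * L) (t + i * L + L) (f i) (v i)) :
    Run d a o t (t + n * L) (seqFin n f) v := by
  induction n generalizing t with
  | zero =>
    have : v = Fin.elim0 := by funext i; exact i.elim0
    subst this
    rw [zero_mul, add_zero]
    exact Run.done t (Fin.elim0 : Fin 0 → α)
  | succ n ih =>
    have h0 := h 0
    simp only [Fin.val_zero, zero_mul, add_zero] at h0
    have h1 := ih (fun i => f i.succ) (fun i => v i.succ) (t + L) (fun i => by
      have := h i.succ
      have e : t + (i.succ : Fin (n + 1)).val * L = t + L + i * L := by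
        simp only [Fin.val_succ]; ring
      rwa [e] at this)
    have e : t + (n + 1) * L = t + L + n * L := by ring
    have hv : v = Fin.cons (v 0) (fun i => v i.succ) := by
      funext i; refine Fin.cases ?_ (fun j => ?_) i <;> simp
    rw [e]
    refine h0.bind (h1.bind ?_)
    conv => arg 7; rw [hv]
    exact Run.done _ _

/-- `Steps d a o n t P R`: if the draws, the pulled arms and the observations in round `s` are
`d s`, `a s` and `o s`, then `n` rounds, starting with round `t`, turn the program `P` into `R`. -/
def Steps (d a : ℕ → Fin K) (o : ℕ → ℝ × Bool) [NeZero K] :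
    ℕ → ℕ → Prog K α → Prog K α → Prop
  | 0, _, P, R => P = R
  | n + 1, t, P, R => a t = P.arm (d t) ∧ Steps d a o n (t + 1) (P.after (d t) (o t)) R

variable [NeZero K]

theorem Steps.trans {n n' t : ℕ} {P Q R : Prog K α} (h : Steps d a o n t P Q)
    (h' : Steps d a o n' (t + n) Q R) : Steps d a o (n + n') t P R := by
  induction n generalizing t P with
  | zero =>
    have : P = Q := h
    subst this
    simpa using h'
  | succ n ih =>
    rw [Nat.add_right_comm]
    exact ⟨h.1, ih h.2 (by rwa [add_assoc, add_comm 1 n])⟩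

/-- Subprograms with values are analysed by `Run`, which composes along `bind`; the joint execution
only sees residual programs, which is what `Steps` records. This is the passage from one to the
other. -/
theorem Run.steps {t t' : ℕ} {p : Prog K α} {v : α} (h : Run d a o t t' p v)
    (f : α → Prog K β) : ∀ n, t' = t + n → Steps d a o n t (p.bind f) (f v) := by
  induction h with
  | done t v =>
    intro n hn
    obtain rfl : n = 0 := by omega
    rfl
  | pull h hr ih =>
    intro n hn
    have := hr.le
    obtain ⟨n, rfl⟩ : ∃ k, n = k + 1 := ⟨n - 1, by omega⟩
    exact ⟨h, ih n (by omega)⟩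
  | pullUnif h hr ih =>
    intro n hn
    have := hr.le
    obtain ⟨n, rfl⟩ : ∃ k, n = k + 1 := ⟨n - 1, by omega⟩
    refine ⟨h, ?_⟩
    have := ih n (by omega)
    rw [h] at this
    exact this

end Run

/-! ### Joint execution -/

section Play

variable {K M : ℕ} [NeZero K]

/-- The arms pulled by the players in round `t`. -/
def armsOf (d : ℕ → Fin M → Fin K) (S : ℕ → Fin M → Prog K Unit) (t : ℕ) : Fin M → Fin K :=
  fun n => (S t n).arm (d t n)

/-- `S t m` is the program that remains to be executed by player `m` before round `t`. -/
def IsPlay (y : ℕ → Fin M → Fin K → ℝ) (d : ℕ → Fin M → Fin K)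
    (S : ℕ → Fin M → Prog K Unit) : Prop :=
  ∀ t m, S (t + 1) m = (S t m).after (d t m)
    (gain (y t) (armsOf d S t) m, collides (armsOf d S t) m)

variable {y : ℕ → Fin M → Fin K → ℝ} {d : ℕ → Fin M → Fin K} {S : ℕ → Fin M → Prog K Unit}

theorem isPlay_progAt (prog : Prog K Unit) (y : ℕ → Fin M → Fin K → ℝ)
    (d : ℕ → Fin M → Fin K) : IsPlay y d (progAt prog y d) := fun _ _ => rfl

/-- The observations when the players pull the arms `a s` in round `s`. -/
def obsOf (y : ℕ → Fin M → Fin K → ℝ) (a : ℕ → Fin M → Fin K) (m : Fin M) (s : ℕ) : ℝ × Bool :=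
  (gain (y s) (a s) m, collides (a s) m)

/-- The observations of a player depend on the arms of all players, so the players cannot be run one
at a time. The way out is to guess the whole sequence `a` of joint arms: if each player, fed with
the observations that `a` would produce, pulls what `a` predicts, then induction over the rounds
shows that `a` is the actual play. -/
theorem play_of_steps (hS : IsPlay y d S) (a : ℕ → Fin M → Fin K) {n t : ℕ}
    {R : Fin M → Prog K Unit}
    (h : ∀ m, Steps (fun s => d s m) (fun s => a s m) (obsOf y a m) n t (S t m) (R m)) :
    (∀ m, S (t + n) m = R m) ∧ ∀ s, t ≤ s → s < t + n → armsOf d S s = a s := by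
  induction n generalizing t with
  | zero => exact ⟨fun m => h m, fun s h1 h2 => by omega⟩
  | succ n ih =>
    have harm : armsOf d S t = a t := funext fun m => (h m).1.symm
    have h1 : ∀ m, Steps (fun s => d s m) (fun s => a s m) (obsOf y a m) n (t + 1)
        (S (t + 1) m) (R m) := by
      intro m
      rw [hS t m, harm]
      exact (h m).2
    have e : t + (n + 1) = t + 1 + n := by ring
    rw [e]
    obtain ⟨r1, r2⟩ := ih h1
    refine ⟨r1, fun s hs1 hs2 => ?_⟩
    rcases Nat.eq_or_lt_of_le hs1 with rfl | h
    · exact harm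
    · exact r2 s h hs2

end Play

/-! ### Reading and sending bits -/

section Bits

variable {K : ℕ} {α β : Type}

theorem decode_encode (b x : ℕ) (hx : x < 2 ^ b) : decode (encode b x) = x := by
  induction b generalizing x with
  | zero => simp at hx; subst hx; rfl
  | succ b ih =>
    have h1 : encode (b + 1) x = x.testBit 0 :: encode b (x / 2) := by
      simp only [encode, List.range_succ_eq_map, List.map_cons, List.map_map]
      congr 1
      apply List.map_congr_left
      intro i _
      simp [Nat.testBit_succ]
    have h2 := ih (x / 2) (by rw [pow_succ] at hx; omega)
    have h3 : decode (x.testBit 0 :: encode b (x / 2))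
        = (x.testBit 0).toNat + 2 * decode (encode b (x / 2)) := rfl
    rw [h1, h3, h2, Nat.testBit_zero]
    rcases Nat.mod_two_eq_zero_or_one x with h | h <;> simp [h] <;> omega

@[simp] theorem length_encode (b x : ℕ) : (encode b x).length = b := by simp [encode]

/-- A player executing `X` on the arm `own` reads the bits `bits` and obtains the value `v`. -/
def Reads (X : Prog K α) (own : Fin K) (bits : List Bool) (v : α) : Prop :=
  ∀ (d a : ℕ → Fin K) (o : ℕ → ℝ × Bool) (t : ℕ), (∀ i < bits.length, a (t + i) = own) →
    (∀ i (h : i < bits.length), (o (t + i)).2 = bits[i]) → Run d a o t (t + bits.length) X v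

/-- A player executing `X` on the arm `own` sends the bits `bits` to the arm `tgt`. -/
def Sends (X : Prog K α) (own tgt : Fin K) (bits : List Bool) (v : α) : Prop :=
  ∀ (d a : ℕ → Fin K) (o : ℕ → ℝ × Bool) (t : ℕ),
    (∀ i (h : i < bits.length), a (t + i) = if bits[i] then tgt else own) →
      Run d a o t (t + bits.length) X v

theorem reads_done (own : Fin K) (v : α) : Reads (done v) own [] v :=
  fun _ _ _ t _ _ => Run.done t v

theorem sends_done (own tgt : Fin K) (v : α) : Sends (done v) own tgt [] v :=
  fun _ _ _ t _ => Run.done t v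

theorem Reads.bind {X : Prog K α} {own : Fin K} {b b' : List Bool} {v : α}
    {f : α → Prog K β} {w : β} (h : Reads X own b v) (h' : Reads (f v) own b' w) :
    Reads (X.bind f) own (b ++ b') w := by
  intro d a o t ha ho
  rw [List.length_append, ← add_assoc]
  rw [List.length_append] at ha
  refine (h d a o t (fun i hi => ha i (by omega)) (fun i hi => ?_)).bind
    (h' d a o _ (fun i hi => ?_) (fun i hi => ?_))
  · rw [ho i (by simp; omega), List.getElem_append_left hi]
  · rw [add_assoc]; exact ha _ (by omega)
  · rw [add_assoc, ho _ (by simp; omega), List.getElem_append_right (by omega)]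
    simp

theorem Sends.bind {X : Prog K α} {own tgt : Fin K} {b b' : List Bool} {v : α}
    {f : α → Prog K β} {w : β} (h : Sends X own tgt b v) (h' : Sends (f v) own tgt b' w) :
    Sends (X.bind f) own tgt (b ++ b') w := by
  intro d a o t ha
  rw [List.length_append, ← add_assoc]
  refine (h d a o t (fun i hi => ?_)).bind (h' d a o _ (fun i hi => ?_))
  · rw [ha i (by simp; omega), List.getElem_append_left hi]
  · rw [add_assoc, ha _ (by simp; omega), List.getElem_append_right (by omega)]
    simp

theorem reads_receive (own : Fin K) (bits : List Bool) :
    Reads (receive own bits.length) own bits (decode bits) := by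
  intro d a o t ha ho
  have h := run_pullList (d := d) (a := a) (o := o) (List.replicate bits.length own) t
    (fun i h => by simpa using ha i (by simpa using h))
  simp only [List.length_replicate] at h
  refine h.bind ?_
  have e : bits = ((List.range bits.length).map fun i => o (t + i)).map fun o => o.2 := by
    apply List.ext_getElem
    · simp
    · intro i h1 h2
      simp [ho i h1]
  conv => arg 7; rw [e]
  exact Run.done _ _

theorem reads_receive_encode (own : Fin K) (b x : ℕ) (hx : x < 2 ^ b) :
    Reads (receive own b) own (encode b x) x := by
  have := reads_receive own (encode b x)
  rwa [length_encode, decode_encode b x hx] at this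

theorem sends_send (own tgt : Fin K) (bits : List Bool) :
    Sends (send own tgt bits) own tgt bits () := by
  intro d a o t ha
  have h := run_pullList (d := d) (a := a) (o := o)
    (bits.map fun d => if d then tgt else own) t
    (fun i h => by simpa using ha i (by simpa using h))
  simp only [List.length_map] at h
  exact h.bind (f := fun _ => done ()) (Run.done _ _)

theorem reads_seqFin (own : Fin K) (n : ℕ) (f : Fin n → Prog K α) (v : Fin n → α)
    (bits : Fin n → List Bool) (h : ∀ i, Reads (f i) own (bits i) (v i)) :
    Reads (seqFin n f) own (List.ofFn bits).flatten v := by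
  induction n with
  | zero =>
    have : v = Fin.elim0 := by funext i; exact i.elim0
    subst this
    exact reads_done own _
  | succ n ih =>
    have h1 := ih (fun i => f i.succ) (fun i => v i.succ) (fun i => bits i.succ)
      fun i => h i.succ
    have hv : v = Fin.cons (v 0) (fun i => v i.succ) := by
      funext i; refine Fin.cases ?_ (fun j => ?_) i <;> simp
    rw [List.ofFn_succ, List.flatten_cons]
    refine (h 0).bind ?_
    rw [← List.append_nil (List.ofFn fun i => bits i.succ).flatten]
    refine h1.bind ?_
    conv => arg 4; rw [hv]
    exact reads_done own _

theorem sends_seqFin (own tgt : Fin K) (n : ℕ) (f : Fin n → Prog K α) (v : Fin n → α)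
    (bits : Fin n → List Bool) (h : ∀ i, Sends (f i) own tgt (bits i) (v i)) :
    Sends (seqFin n f) own tgt (List.ofFn bits).flatten v := by
  induction n with
  | zero =>
    have : v = Fin.elim0 := by funext i; exact i.elim0
    subst this
    exact sends_done own tgt _
  | succ n ih =>
    have h1 := ih (fun i => f i.succ) (fun i => v i.succ) (fun i => bits i.succ)
      fun i => h i.succ
    have hv : v = Fin.cons (v 0) (fun i => v i.succ) := by
      funext i; refine Fin.cases ?_ (fun j => ?_) i <;> simp
    rw [List.ofFn_succ, List.flatten_cons]
    refine (h 0).bind ?_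
    rw [← List.append_nil (List.ofFn fun i => bits i.succ).flatten]
    refine h1.bind ?_
    conv => arg 5; rw [hv]
    exact sends_done own tgt _

theorem length_flatten_ofFn_encode (n b : ℕ) (x : Fin n → ℕ) :
    (List.ofFn fun i => encode b (x i)).flatten.length = n * b := by
  simp [List.length_flatten, List.map_ofFn, Function.comp_def]

end Bits

/-! ### Rounds of communication -/

section Communication

variable {K n : ℕ}

theorem collides_of_injective {M : ℕ} {κ : Fin M → Fin K} (hκ : Function.Injective κ)
    (m : Fin M) : collides κ m = false := by
  simp only [collides, decide_eq_false_iff_not, not_exists, not_and]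
  exact fun n hn h => hn (hκ h)

theorem collides_update {M : ℕ} {κ : Fin M → Fin K} {i j : Fin M} (hij : i ≠ j) :
    collides (Function.update κ i (κ j)) j = true := by
  simp only [collides, decide_eq_true_eq]
  exact ⟨i, hij, by simp [Function.update_of_ne hij.symm]⟩

/-- The slot of length `L` containing `r`, provided that the bit sent at `r` is `1`. -/
def activeSlot (L : ℕ) (bits : Fin n → List Bool) (r : ℕ) : Option (Fin n) :=
  if h : r / L < n then (if (bits ⟨r / L, h⟩).getD (r % L) false then some ⟨r / L, h⟩ else none)
  else none

theorem activeSlot_eq (L : ℕ) (bits : Fin n → List Bool) (j : Fin n) (i : ℕ) (hi : i < L) :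
    activeSlot L bits (j * L + i) = if (bits j).getD i false then some j else none := by
  have h1 : (j * L + i) / L = j := by
    rw [mul_comm, Nat.mul_add_div (by omega), Nat.div_eq_of_lt hi, add_zero]
  have h2 : (j * L + i) % L = i := by
    rw [mul_comm, Nat.mul_add_mod, Nat.mod_eq_of_lt hi]
  unfold activeSlot
  rw [dif_pos (by rw [h1]; exact j.2)]
  simp only [h1, h2]

theorem activeSlot_some {L : ℕ} {bits : Fin n → List Bool} {j : Fin n} {r : ℕ}
    (h : activeSlot L bits r = some j) : r / L = j := by
  unfold activeSlot at h
  split_ifs at h with h1 h2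
  simp only [Option.some.injEq] at h
  rw [← h]

/-- Arms pulled while the player `snd j` sends bits to the player `rcv j` in the `j`-th slot. -/
def commArms {M : ℕ} (κ : Fin M → Fin K) (snd rcv : Fin n → Fin M) (L : ℕ)
    (bits : Fin n → List Bool) (t s : ℕ) : Fin M → Fin K :=
  match activeSlot L bits (s - t) with
  | none => κ
  | some j => Function.update κ (snd j) (κ (rcv j))

/-- `A` is the assignment `κ`, up to one player who sends a bit to another one. -/
def IsCommRound {M : ℕ} (κ A : Fin M → Fin K) : Prop :=
  A = κ ∨ ∃ i j, i ≠ j ∧ A = Function.update κ i (κ j)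

theorem commArms_isCommRound {M : ℕ} (κ : Fin M → Fin K) (snd rcv : Fin n → Fin M) (L : ℕ)
    (bits : Fin n → List Bool) (t s : ℕ) (h : ∀ j, snd j ≠ rcv j) :
    IsCommRound κ (commArms κ snd rcv L bits t s) := by
  unfold commArms
  split
  · exact Or.inl rfl
  · exact Or.inr ⟨_, _, h _, rfl⟩

theorem commArms_slot {M : ℕ} (κ : Fin M → Fin K) (snd rcv : Fin n → Fin M) (L : ℕ)
    (bits : Fin n → List Bool) (t : ℕ) (j : Fin n) (i : ℕ) (hi : i < L) :
    commArms κ snd rcv L bits t (t + j * L + i) =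
      if (bits j).getD i false then Function.update κ (snd j) (κ (rcv j)) else κ := by
  unfold commArms
  rw [show t + j * L + i - t = j * L + i by omega, activeSlot_eq L bits j i hi]
  split_ifs <;> rfl

variable [NeZero K] {y : ℕ → Fin (n + 1) → Fin K → ℝ} {d : ℕ → Fin (n + 1) → Fin K}
  {S : ℕ → Fin (n + 1) → Prog K Unit}

/-- The guess for `play_of_steps` is `commArms`: in slot j only the leader moves, to the arm of
follower j, at the bits 1. Since `κ` is injective, follower j collides exactly at the bits 1 of her
own slot. For her the n slots split into j idle ones, her own, and the remaining idle ones. -/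
theorem play_broadcast {β : Fin n → Type} (hS : IsPlay y d S)
    {κ : Fin (n + 1) → Fin K} (hκ : Function.Injective κ) (L : ℕ) (bits : Fin n → List Bool)
    (hL : ∀ j, (bits j).length = L) (t : ℕ) (Z : Fin n → Prog K Unit)
    (hZ : ∀ j, Sends (Z j) (κ 0) (κ j.succ) (bits j) ())
    (f₀ : (Fin n → Unit) → Prog K Unit) (X : ∀ j, Prog K (β j)) (v : ∀ j, β j)
    (hX : ∀ j, Reads (X j) (κ j.succ) (bits j) (v j)) (f : ∀ j, β j → Prog K Unit)
    (h₀ : S t 0 = (seqFin n Z).bind f₀)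
    (h₁ : ∀ j : Fin n, S t j.succ = (stay (κ j.succ) (j * L)).bind fun _ =>
      (X j).bind fun x => (stay (κ j.succ) ((n - 1 - j) * L)).bind fun _ => f j x) :
    S (t + n * L) 0 = f₀ (fun _ => ()) ∧ (∀ j : Fin n, S (t + n * L) j.succ = f j (v j)) ∧
      ∀ s, t ≤ s → s < t + n * L → IsCommRound κ (armsOf d S s) := by
  set a := commArms κ (fun _ : Fin n => (0 : Fin (n + 1))) Fin.succ L bits t with ha
  have hne : ∀ j : Fin n, (0 : Fin (n + 1)) ≠ j.succ := fun j => (Fin.succ_ne_zero j).symm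
  have ha_succ : ∀ s (j : Fin n), a s j.succ = κ j.succ := by
    intro s j
    rw [ha]
    unfold commArms
    rcases activeSlot L bits (s - t) with _ | j'
    · rfl
    · simp
  have key := play_of_steps hS a (n := n * L) (t := t)
    (R := Fin.cons (f₀ fun _ => ()) fun j => f j (v j)) ?_
  · obtain ⟨h1, h2⟩ := key
    refine ⟨h1 0, fun j => by simpa using h1 j.succ, fun s hs1 hs2 => ?_⟩
    rw [h2 s hs1 hs2]
    exact commArms_isCommRound _ _ _ _ _ _ _ hne
  · intro m
    refine Fin.cases ?_ (fun j => ?_) m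
    · rw [h₀]
      refine (run_seqFin n L Z (fun _ => ()) t fun i => ?_).steps f₀ _ rfl
      have := hZ i (fun s => d s 0) (fun s => a s 0) (obsOf y a 0) (t + i * L) (fun k hk => by
        rw [hL] at hk
        rw [ha, commArms_slot _ _ _ _ _ _ _ _ hk, List.getD_eq_getElem _ _ (by rw [hL]; exact hk)]
        split_ifs <;> simp)
      rwa [hL] at this
    · rw [h₁ j]
      simp only [Fin.cons_succ]
      have e : n * L = j * L + (L + (n - 1 - j) * L) := by
        have : n = j + (1 + (n - 1 - j)) := by omega
        conv_lhs => rw [this]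
        ring
      rw [e]
      refine Steps.trans ((run_stay _ _ t fun i _ => ha_succ _ j).steps _ _ rfl) ?_
      refine Steps.trans (Run.steps (v := v j) ?_ _ _ rfl) ?_
      · rw [← hL j]
        refine hX j _ _ _ _ (fun i _ => ha_succ _ j) (fun i hi => ?_)
        have hi' := hi
        rw [hL] at hi
        rw [obsOf, hL, ha, commArms_slot _ _ _ _ _ _ _ _ hi, List.getD_eq_getElem _ _ hi']
        cases (bits j)[i] with
        | true => exact collides_update (hne j)
        | false => exact collides_of_injective hκ _
      · exact (run_stay _ _ _ fun i _ => ha_succ _ j).steps _ _ rfl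

/-- The mirror image of `play_broadcast`: the leader stays on her arm throughout and reads slot
after slot, and a follower leaves her arm only in her own slot. -/
theorem play_collect {β : Type} (hS : IsPlay y d S)
    {κ : Fin (n + 1) → Fin K} (hκ : Function.Injective κ) (L : ℕ) (bits : Fin n → List Bool)
    (hL : ∀ j, (bits j).length = L) (t : ℕ) (X : Fin n → Prog K β) (v : Fin n → β)
    (hX : ∀ j, Reads (X j) (κ 0) (bits j) (v j))
    (f₀ : (Fin n → β) → Prog K Unit) {γ : Type} (Z : ∀ _ : Fin n, Prog K γ) (w : γ)
    (hZ : ∀ j, Sends (Z j) (κ j.succ) (κ 0) (bits j) w) (f : Fin n → Prog K Unit)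
    (h₀ : S t 0 = (seqFin n X).bind f₀)
    (h₁ : ∀ j : Fin n, S t j.succ = (stay (κ j.succ) (j * L)).bind fun _ =>
      (Z j).bind fun _ => (stay (κ j.succ) ((n - 1 - j) * L)).bind fun _ => f j) :
    S (t + n * L) 0 = f₀ v ∧ (∀ j : Fin n, S (t + n * L) j.succ = f j) ∧
      ∀ s, t ≤ s → s < t + n * L → IsCommRound κ (armsOf d S s) := by
  set a := commArms κ Fin.succ (fun _ : Fin n => (0 : Fin (n + 1))) L bits t with ha
  have hne : ∀ j : Fin n, j.succ ≠ (0 : Fin (n + 1)) := fun j => Fin.succ_ne_zero j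
  have ha_zero : ∀ s, a s 0 = κ 0 := by
    intro s
    rw [ha]
    unfold commArms
    rcases activeSlot L bits (s - t) with _ | j'
    · rfl
    · exact Function.update_of_ne (hne _).symm _ _
  have ha_succ : ∀ r (j : Fin n), r / L ≠ j → a (t + r) j.succ = κ j.succ := by
    intro r j hr
    rw [ha]
    unfold commArms
    rw [Nat.add_sub_cancel_left]
    rcases h : activeSlot L bits r with _ | j'
    · rfl
    · have : j' ≠ j := by
        rintro rfl
        exact hr (activeSlot_some h)
      exact Function.update_of_ne (fun h => this (Fin.succ_injective _ h).symm) _ _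
  have key := play_of_steps hS a (n := n * L) (t := t) (R := Fin.cons (f₀ v) fun j => f j) ?_
  · obtain ⟨h1, h2⟩ := key
    refine ⟨h1 0, fun j => by simpa using h1 j.succ, fun s hs1 hs2 => ?_⟩
    rw [h2 s hs1 hs2]
    exact commArms_isCommRound _ _ _ _ _ _ _ hne
  · intro m
    refine Fin.cases ?_ (fun j => ?_) m
    · rw [h₀]
      refine (run_seqFin n L X v t fun i => ?_).steps f₀ _ rfl
      rw [← hL i]
      refine hX i _ _ _ _ (fun k _ => ha_zero _) (fun k hk => ?_)
      have hk' := hk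
      rw [hL] at hk
      rw [obsOf, hL, ha, commArms_slot _ _ _ _ _ _ _ _ hk, List.getD_eq_getElem _ _ hk']
      cases (bits i)[k] with
      | true => exact collides_update (hne i)
      | false => exact collides_of_injective hκ _
    · rw [h₁ j]
      simp only [Fin.cons_succ]
      have e : n * L = j * L + (L + (n - 1 - j) * L) := by
        have : n = j + (1 + (n - 1 - j)) := by omega
        conv_lhs => rw [this]
        ring
      rw [e]
      refine Steps.trans ((run_stay _ _ t fun i hi => ha_succ _ j ?_).steps _ _ rfl) ?_
      · have : i / L < j := Nat.div_lt_of_lt_mul (by rwa [mul_comm])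
        omega
      refine Steps.trans (Run.steps (v := w) ?_ _ _ rfl) ?_
      · rw [← hL j]
        refine hZ j _ _ _ _ (fun i hi => ?_)
        have hi' := hi
        rw [hL] at hi
        rw [hL, ha, commArms_slot _ _ _ _ _ _ _ _ hi, List.getD_eq_getElem _ _ hi']
        split_ifs <;> simp
      · refine (run_stay _ _ _ fun i hi => ?_).steps _ _ rfl
        rw [add_assoc, add_assoc]
        refine ha_succ _ j ?_
        have hL0 : 0 < L := by
          rcases Nat.eq_zero_or_pos L with h | h
          · subst h; simp at hi
          · exact h
        -- After her slot the current slot number is at least j + 1, so follower j is never the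
        -- sender.
        have : (j : ℕ) + 1 ≤ (j * L + (L + i)) / L := by
          rw [Nat.le_div_iff_mul_le hL0]
          nlinarith
        omega

end Communication

noncomputable section

/-! ### The data of the leader as a function of the utilities -/

section Data

variable {K n : ℕ} (rule : ArgmaxRule K) (T c : ℕ)

/-- The matching that is optimal for the estimates `w`. -/
def bestMatching (w : Fin (n + 1) → Fin K → ℝ) : Fin (n + 1) → Fin K :=
  rule.sel (n + 1) (matchings K (n + 1)) w

/-- The best matching through the edge `e` for the estimates `w`. -/
def assocMatching (w : Fin (n + 1) → Fin K → ℝ) (e : Fin (n + 1) × Fin K) : Fin (n + 1) → Fin K :=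
  rule.sel (n + 1) (matchingsThrough e) w

open scoped Classical in
/-- The edges that remain candidates in epoch `p`. -/
def keptEdges (p : ℕ) (E : List (Fin (n + 1) × Fin K)) (w : Fin (n + 1) → Fin K → ℝ) :
    List (Fin (n + 1) × Fin K) :=
  E.filter fun e => ∑ m, (w m (bestMatching rule w m) - w m (assocMatching rule w e m)) ≤
    4 * ((n + 1 : ℕ) : ℝ) * eps K (n + 1) T c p

/-- The matchings explored in epoch `p`. -/
def candidates (p : ℕ) (E : List (Fin (n + 1) × Fin K)) (w : Fin (n + 1) → Fin K → ℝ) :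
    List (Fin (n + 1) → Fin K) :=
  ((keptEdges rule T c p E w).map (assocMatching rule w)).dedup

/-- The matchings in the successive rounds of the exploration of epoch `p`. -/
def slots (p : ℕ) (C : List (Fin (n + 1) → Fin K)) : List (Fin (n + 1) → Fin K) :=
  C.flatMap fun π => List.replicate (2 ^ p ^ c) π

/-- The observations of player `m` who pulls her arms in the matchings `l` without collisions,
starting in round `u`. -/
def exploreObs (y : ℕ → Fin (n + 1) → Fin K → ℝ) (u : ℕ) (l : List (Fin (n + 1) → Fin K))
    (m : Fin (n + 1)) : List (ℝ × Bool) :=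
  l.zipIdx.map fun x => (y (u + x.2) m (x.1 m), false)

/-- The average utilities observed while the matchings `l` are explored. -/
def exploreMean (y : ℕ → Fin (n + 1) → Fin K → ℝ) (u : ℕ) (l : List (Fin (n + 1) → Fin K))
    (m : Fin (n + 1)) : Fin K → ℝ :=
  empMean (l.map fun π => π m) (exploreObs y u l m)

/-- The estimates of the leader after the exploration of the matchings `l` in epoch `p`. -/
def nextEstimates (y : ℕ → Fin (n + 1) → Fin K → ℝ) (u p : ℕ)
    (l : List (Fin (n + 1) → Fin K)) : Fin (n + 1) → Fin K → ℝ :=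
  Fin.cons (exploreMean y u l 0) fun j k =>
    (truncate (meanBits c p) (exploreMean y u l j.succ k) : ℝ) / 2 ^ meanBits c p

/-- The number of rounds used for the messages of the leader about a list of `len` matchings. -/
def commLength (K n len : ℕ) : ℕ := n * sizeBits K (n + 1) + n * ((len + 2) * armBits K)

/-- The data at the beginning of an epoch. -/
structure EpochState (K n : ℕ) where
  /-- the first round of the epoch -/
  t : ℕ
  /-- the candidate edges -/
  E : List (Fin (n + 1) × Fin K)
  /-- the estimates -/
  w : Fin (n + 1) → Fin K → ℝ
  /-- the communication arms -/
  κ : Fin (n + 1) → Fin K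

namespace EpochState

variable (p : ℕ) (st : EpochState K n)

/-- The explored matchings. -/
def cands : List (Fin (n + 1) → Fin K) := candidates rule T c p st.E st.w

/-- The first round of the exploration. -/
def u : ℕ := st.t + commLength K n (st.cands rule T c p).length

/-- The first round after the exploration. -/
def v : ℕ := st.u rule T c p + (slots c p (st.cands rule T c p)).length

/-- The data at the beginning of the next epoch. -/
def next (y : ℕ → Fin (n + 1) → Fin K → ℝ) : EpochState K n where
  t := st.v rule T c p + n * (K * meanBits c p)
  E := keptEdges rule T c p st.E st.w
  w := nextEstimates c y (st.u rule T c p) p (slots c p (st.cands rule T c p))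
  κ := bestMatching rule st.w

end EpochState

theorem matchings_nonempty (hn : n + 1 ≤ K) : (matchings K (n + 1)).Nonempty :=
  ⟨Fin.castLE hn, by simp [matchings, Fin.castLE_injective]⟩

theorem matchingsThrough_nonempty (hn : n + 1 ≤ K) (e : Fin (n + 1) × Fin K) :
    (matchingsThrough e).Nonempty := by
  -- The standard inclusion, followed by the transposition that moves the arm of `e.1` to `e.2`.
  refine ⟨fun m => Equiv.swap (Fin.castLE hn e.1) e.2 (Fin.castLE hn m), ?_⟩
  simp only [matchingsThrough, matchings, Finset.mem_filter, Finset.mem_univ, true_and,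
    Equiv.swap_apply_left, and_true]
  exact (Equiv.injective _).comp (Fin.castLE_injective hn)

theorem bestMatching_injective (hn : n + 1 ≤ K) (w : Fin (n + 1) → Fin K → ℝ) :
    Function.Injective (bestMatching rule w) := by
  have : bestMatching rule w ∈ matchings K (n + 1) :=
    rule.sel_mem (n + 1) _ w (matchings_nonempty hn)
  simpa [matchings] using this

theorem assocMatching_mem (hn : n + 1 ≤ K) (w : Fin (n + 1) → Fin K → ℝ)
    (e : Fin (n + 1) × Fin K) :
    Function.Injective (assocMatching rule w e) ∧ assocMatching rule w e e.1 = e.2 := by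
  have : assocMatching rule w e ∈ matchingsThrough e :=
    rule.sel_mem (n + 1) _ w (matchingsThrough_nonempty hn e)
  simpa [matchingsThrough, matchings] using this

theorem injective_of_mem_candidates (hn : n + 1 ≤ K) {p : ℕ} {E : List (Fin (n + 1) × Fin K)}
    {w : Fin (n + 1) → Fin K → ℝ} {π : Fin (n + 1) → Fin K}
    (h : π ∈ candidates rule T c p E w) : Function.Injective π := by
  simp only [candidates, List.mem_dedup, List.mem_map] at h
  obtain ⟨e, _, rfl⟩ := h
  exact (assocMatching_mem rule hn w e).1

theorem length_candidates_le (p : ℕ) (E : List (Fin (n + 1) × Fin K))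
    (w : Fin (n + 1) → Fin K → ℝ) : (candidates rule T c p E w).length ≤ E.length := by
  refine (List.dedup_sublist _).length_le.trans ?_
  rw [List.length_map]
  exact List.length_filter_le _ _

theorem length_keptEdges_le (p : ℕ) (E : List (Fin (n + 1) × Fin K))
    (w : Fin (n + 1) → Fin K → ℝ) : (keptEdges rule T c p E w).length ≤ E.length :=
  List.length_filter_le _ _

theorem length_slots (p : ℕ) (C : List (Fin (n + 1) → Fin K)) :
    (slots c p C).length = C.length * 2 ^ p ^ c := by
  simp [slots, List.length_flatMap]

theorem slots_map (p : ℕ) (C : List (Fin (n + 1) → Fin K)) (m : Fin (n + 1)) :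
    (slots c p C).map (fun π => π m) = (C.map fun π => π m).flatMap
      fun a => List.replicate (2 ^ p ^ c) a := by
  simp [slots, List.map_flatMap, List.flatMap_map]

theorem mem_slots {p : ℕ} {C : List (Fin (n + 1) → Fin K)} {π : Fin (n + 1) → Fin K} :
    π ∈ slots c p C ↔ π ∈ C := by
  simp only [slots, List.mem_flatMap, List.mem_replicate]
  constructor
  · rintro ⟨π', h, _, rfl⟩; exact h
  · intro h; exact ⟨π, h, by positivity, rfl⟩

end Data

/-! ### One epoch of the joint execution -/

section Epoch

variable {K n : ℕ} (rule : ArgmaxRule K) (T c : ℕ)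

/-- What the leader does in epoch `p` after her messages. -/
def leaderRest (n fuel p : ℕ) (Enew : List (Fin (n + 1) × Fin K)) (π₁ : Fin (n + 1) → Fin K)
    (C : List (Fin (n + 1) → Fin K)) : Prog K Unit :=
  match C with
  | [π] => stay (π 0) T
  | _ =>
    (pullList (C.flatMap fun π => List.replicate (2 ^ p ^ c) (π 0))).bind fun os =>
      (seqFin n fun _ => seqFin K fun _ => receive (π₁ 0) (meanBits c p)).bind fun x =>
        leaderLoop rule T c n fuel (p + 1) Enew
          (Fin.cons (empMean (C.flatMap fun π => List.replicate (2 ^ p ^ c) (π 0)) os)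
            fun j k => (x j k : ℝ) / 2 ^ meanBits c p) π₁

/-- What a follower does in epoch `p` after the messages of the leader. -/
def followerRest [NeZero K] (R M fuel p : ℕ) (arms : List (Fin K)) (κ₁ κnew : Fin K) : Prog K Unit :=
  match arms with
  | [a] => stay a T
  | _ =>
    (pullList (arms.flatMap fun a => List.replicate (2 ^ p ^ c) a)).bind fun os =>
      (stay κnew ((R - 2) * (K * meanBits c p))).bind fun _ =>
        (seqFin K fun k => send κnew κ₁ (encode (meanBits c p) (truncate (meanBits c p)
          (empMean (arms.flatMap fun a => List.replicate (2 ^ p ^ c) a) os k)))).bind fun _ =>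
          (stay κnew ((M - R) * (K * meanBits c p))).bind fun _ =>
            followerLoop K T c R M fuel (p + 1) κnew

theorem leaderLoop_succ (fuel p : ℕ) (E : List (Fin (n + 1) × Fin K))
    (w : Fin (n + 1) → Fin K → ℝ) (κ : Fin (n + 1) → Fin K) :
    leaderLoop rule T c n (fuel + 1) p E w κ =
      (seqFin n fun j => send (κ 0) (κ j.succ)
        (encode (sizeBits K (n + 1)) (candidates rule T c p E w).length)).bind fun _ =>
      (seqFin n fun j =>
        (send (κ 0) (κ j.succ) ((candidates rule T c p E w).flatMap
          fun π => encode (armBits K) (π j.succ).val)).bind fun _ =>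
        (send (κ 0) (κ j.succ) (encode (armBits K) (bestMatching rule w 0).val)).bind fun _ =>
        send (κ 0) (κ j.succ) (encode (armBits K) (bestMatching rule w j.succ).val)).bind fun _ =>
      leaderRest rule T c n fuel p (keptEdges rule T c p E w) (bestMatching rule w)
        (candidates rule T c p E w) := by
  rw [leaderLoop]
  rfl

/-- The three messages read in the second slot are grouped into one program with value `z`, so that
this slot has the form required by `play_broadcast`. -/
theorem followerLoop_succ [NeZero K] (R M fuel p : ℕ) (κ : Fin K) :
    followerLoop K T c R M (fuel + 1) p κ =
      (stay κ ((R - 2) * sizeBits K M)).bind fun _ =>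
      (receive κ (sizeBits K M)).bind fun size =>
      (stay κ ((M - R) * sizeBits K M)).bind fun _ =>
      (stay κ ((R - 2) * ((size + 2) * armBits K))).bind fun _ =>
      ((seqFin size fun _ => receive κ (armBits K)).bind fun x =>
        (receive κ (armBits K)).bind fun y₁ =>
        (receive κ (armBits K)).bind fun y => done (x, y₁, y)).bind fun z =>
      (stay κ ((M - R) * ((size + 2) * armBits K))).bind fun _ =>
      followerRest T c R M fuel p (List.ofFn fun i => Fin.ofNat K (z.1 i)) (Fin.ofNat K z.2.1)
        (Fin.ofNat K z.2.2) := by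
  rw [followerLoop]
  simp only [Prog.bind_assoc, done_bind]
  rfl

end Epoch

/-! ### Correctness of the messages and of the exploration in one epoch. -/

section Epoch

variable {K n : ℕ} (rule : ArgmaxRule K) (T c : ℕ)

theorem gain_of_injective {M : ℕ} {κ : Fin M → Fin K} (hκ : Function.Injective κ)
    (y : Fin M → Fin K → ℝ) (m : Fin M) : gain y κ m = y m (κ m) := by
  simp [gain, collides_of_injective hκ]

theorem val_lt_two_pow_armBits (k : Fin K) : k.val < 2 ^ armBits K :=
  k.2.trans_le (Nat.le_pow_clog (by norm_num) _)

theorem truncate_lt (b : ℕ) (x : ℝ) : truncate b x < 2 ^ b := by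
  have : 0 < 2 ^ b := by positivity
  unfold truncate
  omega

variable [NeZero K] {y : ℕ → Fin (n + 1) → Fin K → ℝ} {d : ℕ → Fin (n + 1) → Fin K}
  {S : ℕ → Fin (n + 1) → Prog K Unit}

theorem ofNat_val (k : Fin K) : Fin.ofNat K k.val = k := by
  apply Fin.ext
  simp [Fin.ofNat, Nat.mod_eq_of_lt k.2]

/-- Injective assignments produce no collisions, so the guess that the matchings of `l` are pulled
one after the other is consistent, and every player observes her true utilities. -/
theorem play_explore (hS : IsPlay y d S) (l : List (Fin (n + 1) → Fin K))
    (hl : ∀ π ∈ l, Function.Injective π) (u : ℕ)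
    (f : Fin (n + 1) → List (ℝ × Bool) → Prog K Unit)
    (h : ∀ m, S u m = (pullList (l.map fun π => π m)).bind (f m)) :
    (∀ m, S (u + l.length) m = f m (exploreObs y u l m)) ∧
      ∀ s, u ≤ s → s < u + l.length → armsOf d S s ∈ l := by
  -- The default assignment is never used: only `l.length` rounds from `u` on matter.
  set a : ℕ → Fin (n + 1) → Fin K := fun s => l.getD (s - u) (fun _ => 0) with ha
  have hmem : ∀ i (hi : i < l.length), a (u + i) = l[i] := by
    intro i hi
    simp [ha, List.getElem?_eq_getElem hi]
  obtain ⟨h1, h2⟩ := play_of_steps hS a (n := l.length) (t := u)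
    (R := fun m => f m (exploreObs y u l m)) (fun m => by
      rw [h m]
      have := (run_pullList (d := fun s => d s m) (a := fun s => a s m) (o := obsOf y a m)
        (l.map fun π => π m) u (fun i hi => by
          have hi' : i < l.length := by simpa using hi
          simp [hmem i hi'])).steps (f m) l.length (by simp)
      convert this using 2
      apply List.ext_getElem
      · simp [exploreObs]
      · intro i h1 h2
        have hi : i < l.length := by simpa [exploreObs] using h1
        have hinj := hl _ (List.getElem_mem hi)
        simp [exploreObs, obsOf, hmem i hi, gain_of_injective hinj, collides_of_injective hinj])
  refine ⟨h1, fun s hs1 hs2 => ?_⟩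
  obtain ⟨i, rfl⟩ := Nat.exists_eq_add_of_le hs1
  rw [h2 _ hs1 hs2, hmem i (by omega)]
  exact List.getElem_mem _

/-- The players are at the beginning of epoch `p`, with the data `st`. -/
structure AtEpoch (S : ℕ → Fin (n + 1) → Prog K Unit) (fuel p : ℕ) (st : EpochState K n) :
    Prop where
  leader : S st.t 0 = leaderLoop rule T c n fuel p st.E st.w st.κ
  follower : ∀ j : Fin n, S st.t j.succ =
    followerLoop K T c (j + 2) (n + 1) fuel p (st.κ j.succ)
  inj : Function.Injective st.κ
  length_le : st.E.length ≤ (n + 1) * K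

variable {rule T c}

/-- Two broadcasts. The second has slots whose length depends on the number of candidates, which all
followers know from the first; this number fits into `sizeBits` bits because there are at most MK
candidate edges. -/
theorem AtEpoch.messages (hS : IsPlay y d S) {fuel p : ℕ}
    {st : EpochState K n} (h : AtEpoch rule T c S (fuel + 1) p st) :
    S (st.u rule T c p) 0 = leaderRest rule T c n fuel p (keptEdges rule T c p st.E st.w)
        (bestMatching rule st.w) (st.cands rule T c p) ∧
      (∀ j : Fin n, S (st.u rule T c p) j.succ = followerRest T c (j + 2) (n + 1) fuel p
        ((st.cands rule T c p).map fun π => π j.succ)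
        (bestMatching rule st.w 0) (bestMatching rule st.w j.succ)) ∧
      ∀ s, st.t ≤ s → s < st.u rule T c p → IsCommRound st.κ (armsOf d S s) := by
  set C := candidates rule T c p st.E st.w with hC
  have hCu : st.cands rule T c p = C := rfl
  have hlen : C.length < 2 ^ sizeBits K (n + 1) := by
    have h1 : C.length ≤ (n + 1) * K := (length_candidates_le rule T c p st.E st.w).trans h.length_le
    have h3 : (n + 1) * K + 1 ≤ 2 ^ sizeBits K (n + 1) := Nat.le_pow_clog (by norm_num) _
    exact lt_of_lt_of_le (Nat.lt_succ_of_le h1) h3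
  -- Follower `j.succ` has rank R = j + 2, so she waits R - 2 = j slots before her own and M - R = n
  -- - 1 - j slots after it.
  have hR : ∀ j : Fin n, (j : ℕ) + 2 - 2 = j ∧ n + 1 - (j + 2) = n - 1 - j := fun j => by omega
  obtain ⟨a1, a2, a3⟩ := play_broadcast hS h.inj (sizeBits K (n + 1))
    (fun _ => encode (sizeBits K (n + 1)) C.length) (by simp) st.t _
    (fun j => sends_send (st.κ 0) (st.κ j.succ) _) _
    (fun j => receive (st.κ j.succ) (sizeBits K (n + 1))) (fun _ => C.length)
    (fun j => reads_receive_encode _ _ _ hlen) _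
    (by rw [h.leader, leaderLoop_succ]) (fun j => by
      rw [h.follower j, followerLoop_succ, (hR j).1, (hR j).2])
  obtain ⟨b1, b2, b3⟩ := play_broadcast hS h.inj ((C.length + 2) * armBits K)
    (fun j => (C.flatMap fun π => encode (armBits K) (π j.succ).val) ++
      (encode (armBits K) (bestMatching rule st.w 0).val ++
      encode (armBits K) (bestMatching rule st.w j.succ).val))
    (by intro j; simp [List.length_flatMap]; ring) (st.t + n * sizeBits K (n + 1)) _
    (fun j => (sends_send (st.κ 0) (st.κ j.succ) _).bind
      ((sends_send (st.κ 0) (st.κ j.succ) _).bind (sends_send (st.κ 0) (st.κ j.succ) _))) _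
    (fun j => (seqFin C.length fun _ => receive (st.κ j.succ) (armBits K)).bind fun x =>
        (receive (st.κ j.succ) (armBits K)).bind fun y₁ =>
        (receive (st.κ j.succ) (armBits K)).bind fun y => done (x, y₁, y))
    (fun j => ((fun i => (C[i] j.succ).val : Fin C.length → ℕ),
      (bestMatching rule st.w 0).val, (bestMatching rule st.w j.succ).val))
    (fun j => by
      have e : (C.flatMap fun π => encode (armBits K) (π j.succ).val) =
          (List.ofFn fun i : Fin C.length => encode (armBits K) (C[i] j.succ).val).flatten := by
        have : (List.ofFn fun i : Fin C.length => encode (armBits K) (C[i] j.succ).val) =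
            C.map fun π => encode (armBits K) (π j.succ).val := by
          apply List.ext_getElem <;> simp
        rw [this, List.flatMap_def]
      have r1 := reads_seqFin (st.κ j.succ) C.length
        (fun _ => receive (st.κ j.succ) (armBits K)) (fun i => (C[i] j.succ).val)
        (fun i => encode (armBits K) (C[i] j.succ).val)
        (fun i => reads_receive_encode _ _ _ (val_lt_two_pow_armBits _))
      rw [← e] at r1
      refine r1.bind ((reads_receive_encode _ _ _ (val_lt_two_pow_armBits _)).bind ?_)
      rw [← List.append_nil (encode (armBits K) (bestMatching rule st.w j.succ).val)]
      exact (reads_receive_encode _ _ _ (val_lt_two_pow_armBits _)).bind (reads_done _ _)) _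
    a1 a2
  have hu : st.u rule T c p = st.t + n * sizeBits K (n + 1) + n * ((C.length + 2) * armBits K) := by
    rw [EpochState.u, commLength, hCu]; ring
  refine ⟨?_, fun j => ?_, fun s hs1 hs2 => ?_⟩
  · rw [hu, b1, hCu]
  · rw [hu, b2 j, hCu]
    simp only [ofNat_val]
    congr 1
    apply List.ext_getElem <;> simp
  · rcases lt_or_ge s (st.t + n * sizeBits K (n + 1)) with h' | h'
    · exact a3 s hs1 h'
    · exact b3 s h' (by omega)

theorem AtEpoch.exploit (hS : IsPlay y d S) {fuel p : ℕ} {st : EpochState K n}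
    (h : AtEpoch rule T c S (fuel + 1) p st) {π : Fin (n + 1) → Fin K}
    (hπ : st.cands rule T c p = [π]) :
    ∀ s, st.u rule T c p ≤ s → s < st.u rule T c p + T → armsOf d S s = π := by
  obtain ⟨h1, h2, -⟩ := h.messages hS
  rw [hπ] at h1 h2
  refine (play_of_steps hS (fun _ => π) (n := T) (t := st.u rule T c p)
    (R := fun _ => done ()) fun m => ?_).2
  have : S (st.u rule T c p) m = (stay (π m) T).bind done := by
    rw [bind_done]
    exact Fin.cases h1 h2 m
  rw [this]
  exact (run_stay _ _ _ fun _ _ => rfl).steps _ _ rfl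

/-- After the messages all players hold consistent data, so exploration and transmission of the
estimates are synchronous. The resulting state `st.next` is computed from the utilities alone,
without reference to the draws. -/
theorem AtEpoch.explore (hS : IsPlay y d S) (hn : n + 1 ≤ K) {fuel p : ℕ} {st : EpochState K n}
    (h : AtEpoch rule T c S (fuel + 1) p st) (hne : ∀ π, st.cands rule T c p ≠ [π]) :
    AtEpoch rule T c S fuel (p + 1) (st.next rule T c p y) ∧
      (∀ s, st.u rule T c p ≤ s → s < st.v rule T c p →
        armsOf d S s ∈ st.cands rule T c p) ∧
      ∀ s, st.v rule T c p ≤ s → s < (st.next rule T c p y).t →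
        IsCommRound (bestMatching rule st.w) (armsOf d S s) := by
  obtain ⟨h1, h2, -⟩ := h.messages hS
  set C := st.cands rule T c p with hC
  set u := st.u rule T c p with hu
  have hv : st.v rule T c p = u + (slots c p C).length := rfl
  have e1 : leaderRest rule T c n fuel p (keptEdges rule T c p st.E st.w)
      (bestMatching rule st.w) C = (pullList ((slots c p C).map fun π => π 0)).bind fun os =>
      (seqFin n fun _ => seqFin K fun _ => receive (bestMatching rule st.w 0) (meanBits c p)).bind
        fun x => leaderLoop rule T c n fuel (p + 1) (keptEdges rule T c p st.E st.w)
          (Fin.cons (empMean ((slots c p C).map fun π => π 0) os)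
            fun j k => (x j k : ℝ) / 2 ^ meanBits c p) (bestMatching rule st.w) := by
    rw [slots_map, List.flatMap_map]
    -- The exploration branch also covers an empty list; only a list with one entry is excluded by
    -- `hne`.
    rcases hc : C with _ | ⟨π, _ | _⟩
    · rfl
    · exact absurd hc (hne π)
    · rfl
  have e2 : ∀ j : Fin n, followerRest T c (j + 2) (n + 1) fuel p (C.map fun π => π j.succ)
      (bestMatching rule st.w 0) (bestMatching rule st.w j.succ) =
      (pullList ((slots c p C).map fun π => π j.succ)).bind fun os =>
      (stay (bestMatching rule st.w j.succ) (j * (K * meanBits c p))).bind fun _ =>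
        (seqFin K fun k => send (bestMatching rule st.w j.succ) (bestMatching rule st.w 0)
          (encode (meanBits c p) (truncate (meanBits c p)
          (empMean ((slots c p C).map fun π => π j.succ) os k)))).bind fun _ =>
          (stay (bestMatching rule st.w j.succ) ((n - 1 - j) * (K * meanBits c p))).bind fun _ =>
            followerLoop K T c (j + 2) (n + 1) fuel (p + 1) (bestMatching rule st.w j.succ) := by
    intro j
    have hR : (j : ℕ) + 2 - 2 = j ∧ n + 1 - (j + 2) = n - 1 - j := by omega
    rw [slots_map, ← hR.2]
    rcases hc : C with _ | ⟨π, _ | _⟩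
    · rfl
    · exact absurd hc (hne π)
    · rfl
  have hinj : ∀ π ∈ slots c p C, Function.Injective π := fun π hπ =>
    injective_of_mem_candidates rule T c hn ((mem_slots c).1 hπ)
  obtain ⟨a1, a2⟩ := play_explore hS (slots c p C) hinj u
    (fun m => Fin.cases (motive := fun _ => List (ℝ × Bool) → Prog K Unit)
      (fun os => (seqFin n fun _ => seqFin K fun _ =>
        receive (bestMatching rule st.w 0) (meanBits c p)).bind
        fun x => leaderLoop rule T c n fuel (p + 1) (keptEdges rule T c p st.E st.w)
          (Fin.cons (empMean ((slots c p C).map fun π => π 0) os)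
            fun j k => (x j k : ℝ) / 2 ^ meanBits c p) (bestMatching rule st.w))
      (fun j os => (stay (bestMatching rule st.w j.succ) (j * (K * meanBits c p))).bind fun _ =>
        (seqFin K fun k => send (bestMatching rule st.w j.succ) (bestMatching rule st.w 0)
          (encode (meanBits c p) (truncate (meanBits c p)
          (empMean ((slots c p C).map fun π => π j.succ) os k)))).bind fun _ =>
          (stay (bestMatching rule st.w j.succ) ((n - 1 - j) * (K * meanBits c p))).bind fun _ =>
            followerLoop K T c (j + 2) (n + 1) fuel (p + 1) (bestMatching rule st.w j.succ)) m)
    (fun m => by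
      refine Fin.cases ?_ (fun j => ?_) m
      · rw [h1, e1]; rfl
      · rw [h2 j, e2 j]; rfl)
  have hb := bestMatching_injective rule hn st.w
  obtain ⟨b1, b2, b3⟩ := play_collect hS hb (K * meanBits c p)
    (fun j => (List.ofFn fun k => encode (meanBits c p) (truncate (meanBits c p)
      (exploreMean y u (slots c p C) j.succ k))).flatten)
    (fun j => length_flatten_ofFn_encode _ _ _) (u + (slots c p C).length) _
    (fun j k => truncate (meanBits c p) (exploreMean y u (slots c p C) j.succ k))
    (fun j => reads_seqFin _ K (fun _ => receive (bestMatching rule st.w 0) (meanBits c p)) _ _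
      fun k => reads_receive_encode _ _ _ (truncate_lt _ _)) _ _ (fun _ => ())
    (fun j => sends_seqFin (bestMatching rule st.w j.succ) (bestMatching rule st.w 0) K _ _ _
      fun k => sends_send _ _ _) _ (a1 0) (fun j => a1 j.succ)
  refine ⟨⟨b1, b2, hb, (length_keptEdges_le ..).trans h.length_le⟩, fun s hs1 hs2 =>
    (mem_slots c).1 (a2 s hs1 hs2), b3⟩

end Epoch

/-! ### Musical chairs -/

section Chairs

variable {K M : ℕ}

/-- The arms occupied by the players before round `t` of the musical chairs phase. -/
def occ (d : ℕ → Fin M → Fin K) : ℕ → Fin M → Option (Fin K)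
  | 0, _ => none
  | t + 1, m =>
    match occ d t m with
    | some k => some k
    | none => if collides (fun n => (occ d t n).getD (d t n)) m then none else some (d t m)

/-- The arms pulled in round `t` of the musical chairs phase. -/
def chairs (d : ℕ → Fin M → Fin K) (t : ℕ) (m : Fin M) : Fin K := (occ d t m).getD (d t m)

theorem occ_succ_of_some {d : ℕ → Fin M → Fin K} {t : ℕ} {m : Fin M} {k : Fin K}
    (h : occ d t m = some k) : occ d (t + 1) m = some k := by
  rw [occ, h]

theorem occ_succ_of_none {d : ℕ → Fin M → Fin K} {t : ℕ} {m : Fin M}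
    (h : occ d t m = none) :
    occ d (t + 1) m = if collides (chairs d t) m then none else some (d t m) := by
  rw [occ, h]
  rfl

/-- An arm is newly occupied only in a round without collision, and earlier occupants keep pulling
their arms, so it cannot belong to anybody else. The claim `key` treats a step in which the first of
the two players obtains her arm; the second case follows by symmetry. -/
theorem occ_injective (d : ℕ → Fin M → Fin K) (t : ℕ) {m m' : Fin M} {k : Fin K}
    (h : occ d t m = some k) (h' : occ d t m' = some k) : m = m' := by
  have key : ∀ t (m m' : Fin M) (k : Fin K), (∀ m m' k, occ d t m = some k →
      occ d t m' = some k → m = m') → occ d t m = none → occ d (t + 1) m = some k →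
      occ d (t + 1) m' = some k → m = m' := by
    intro t m m' k ih hm h1 h2
    rw [occ_succ_of_none hm] at h1
    by_contra hne
    split_ifs at h1 with hc
    have hk : d t m = k := by simpa using h1
    apply hc
    simp only [collides, decide_eq_true_eq]
    refine ⟨m', Ne.symm hne, ?_⟩
    have e1 : chairs d t m = k := by simp [chairs, hm, hk]
    rw [e1]
    rcases hm' : occ d t m' with _ | k'
    · rw [occ_succ_of_none hm'] at h2
      split_ifs at h2 with hc'
      have : d t m' = k := by simpa using h2
      simp [chairs, hm', this]
    · rw [occ_succ_of_some hm'] at h2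
      have : k' = k := by simpa using h2
      simp [chairs, hm', this]
  induction t generalizing m m' k with
  | zero => simp [occ] at h
  | succ t ih =>
    rcases hm : occ d t m with _ | a
    · exact key t m m' k (fun _ _ _ => ih) hm h h'
    · rcases hm' : occ d t m' with _ | b
      · exact (key t m' m k (fun _ _ _ => ih) hm' h' h).symm
      · rw [occ_succ_of_some hm] at h
        rw [occ_succ_of_some hm'] at h'
        rw [h] at hm
        rw [h'] at hm'
        exact ih hm hm'

theorem run_musicalChairs [NeZero K] (y : ℕ → Fin M → Fin K → ℝ) (d : ℕ → Fin M → Fin K) (m : Fin M)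
    (n t : ℕ) :
    Run (fun s => d s m) (fun s => chairs d s m) (obsOf y (chairs d) m) t (t + n)
      (musicalChairs K n (occ d t m)) (occ d (t + n) m) := by
  induction n generalizing t with
  | zero => exact Run.done _ _
  | succ n ih =>
    have e : t + (n + 1) = t + 1 + n := by ring
    rw [e]
    rcases hm : occ d t m with _ | k
    · refine Run.pullUnif (by simp [chairs, hm]) ?_
      have := ih (t + 1)
      rw [occ_succ_of_none hm] at this
      have hd : chairs d t m = d t m := by simp [chairs, hm]
      simp only [hd]
      exact this
    · refine Run.pull (by simp [chairs, hm]) ?_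
      have := ih (t + 1)
      rwa [occ_succ_of_some hm] at this

end Chairs

/-! ### Ranks -/

section Rank

variable {K M : ℕ}

/-- The arm pulled in round `r` of the ranking phase by a player who occupies the arm `k`. -/
def rankArm [NeZero K] (k : Fin K) (r : ℕ) : Fin K :=
  if r < 2 * k.val then k else if r < K - 1 + k.val then Fin.ofNat K (r + 1 - k.val) else 0

/-- The number of players whose arm precedes the arm of player `m`. -/
def rankIndex (k : Fin M → Fin K) (m : Fin M) : ℕ :=
  (Finset.univ.filter fun m' => k m' < k m).card

theorem rankIndex_lt (k : Fin M → Fin K) (m : Fin M) : rankIndex k m < M := by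
  have : (Finset.univ.filter fun m' => k m' < k m) ⊂ Finset.univ := by
    rw [Finset.filter_ssubset]
    exact ⟨m, by simp⟩
  simpa [rankIndex] using Finset.card_lt_card this

theorem rankIndex_injective {k : Fin M → Fin K} (hk : Function.Injective k) :
    Function.Injective (rankIndex k) := by
  have key : ∀ m m', k m < k m' → rankIndex k m < rankIndex k m' := by
    intro m m' h
    apply Finset.card_lt_card
    rw [Finset.ssubset_iff_of_subset]
    · exact ⟨m, by simpa using h, by simp⟩
    · intro a ha
      simp only [Finset.mem_filter, Finset.mem_univ, true_and] at ha ⊢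
      exact ha.trans h
  intro m m' h
  rcases lt_trichotomy (k m) (k m') with h1 | h1 | h1
  · exact absurd h (key _ _ h1).ne
  · exact hk h1
  · exact absurd h (key _ _ h1).ne'

/-- The ranks as a permutation of the players. -/
def rankEquiv (k : Fin M → Fin K) (hk : Function.Injective k) : Fin M ≃ Fin M :=
  Equiv.ofBijective (fun m => ⟨rankIndex k m, rankIndex_lt k m⟩)
    (Finite.injective_iff_bijective.1 fun m m' h =>
      rankIndex_injective hk (by simpa using h))

theorem rankArm_val [NeZero K] (k : Fin K) (r : ℕ) : (rankArm k r).val =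
    if r < 2 * k.val then k.val else if r < K - 1 + k.val then r + 1 - k.val else 0 := by
  unfold rankArm
  have := k.2
  split_ifs with h1 h2
  · rfl
  · simp only [Fin.ofNat]
    exact Nat.mod_eq_of_lt (by omega)
  · rfl

/-- With arms numbered from 0, a player of a lower arm k' stops waiting after 2k' rounds and then
pulls arm r + 1 - k' in round r; she meets the waiting player of arm k exactly once, in round k' + k
- 1 < 2k. Players of higher arms are still waiting on their own arms. Hence the collisions count the
lower arms. -/
theorem collides_wait [NeZero K] {k : Fin M → Fin K} (hk : Function.Injective k) (m : Fin M) {r : ℕ}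
    (hr : r < 2 * (k m).val) : collides (fun n => rankArm (k n) r) m = true ↔
      ∃ m', k m' < k m ∧ (k m').val + (k m).val - 1 = r := by
  simp only [collides, decide_eq_true_eq]
  refine exists_congr fun m' => ?_
  have h1 := (k m').2
  have h2 := (k m).2
  rw [Fin.ext_iff, rankArm_val, rankArm_val, if_pos hr, Fin.lt_def]
  constructor
  · rintro ⟨hne, h⟩
    have hne' : (k m').val ≠ (k m).val := fun h => hne (hk (Fin.ext h))
    split_ifs at h <;> omega
  · rintro ⟨hlt, rfl⟩
    refine ⟨fun h => ?_, ?_⟩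
    · subst h; omega
    · rw [if_neg (by omega), if_pos (by omega)]; omega

/-- A player of a higher arm k' is still waiting when the sweep from k reaches k', in round k + k' -
1 < 2k'. Two sweeping players are on different arms since their positions are shifted against each
other, and those who have finished sit on arm 0, which the sweep does not visit. -/
theorem collides_sweep [NeZero K] {k : Fin M → Fin K} (hk : Function.Injective k) (m : Fin M) {i : ℕ}
    (hi : i < K - 1 - (k m).val) :
    collides (fun n => rankArm (k n) (2 * (k m).val + i)) m = true ↔
      ∃ m', k m < k m' ∧ (k m').val - (k m).val - 1 = i := by
  simp only [collides, decide_eq_true_eq]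
  refine exists_congr fun m' => ?_
  have h1 := (k m').2
  have h2 := (k m).2
  rw [Fin.ext_iff, rankArm_val, rankArm_val, if_neg (by omega : ¬ (2 * (k m).val + i < 2 * (k m).val)),
    if_pos (by omega : 2 * (k m).val + i < K - 1 + (k m).val), Fin.lt_def]
  constructor
  · rintro ⟨hne, h⟩
    split_ifs at h
    · omega
    · exact absurd (hk (Fin.ext (by omega))) hne
    · omega
  · rintro ⟨hlt, rfl⟩
    refine ⟨fun h => ?_, ?_⟩
    · subst h; omega
    · rw [if_pos (by omega)]; omega

theorem countP_range_map {β : Type} (N : ℕ) (f : ℕ → β) (q : β → Bool) :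
    ((List.range N).map f).countP q = ((Finset.range N).filter fun i => q (f i) = true).card := by
  rw [List.countP_map, List.countP_eq_length_filter]
  simp only [Function.comp_def]
  induction N with
  | zero => simp
  | succ N ih =>
    rw [List.range_succ, List.filter_append, List.length_append, ih, Finset.range_add_one,
      Finset.filter_insert]
    by_cases h : q (f N) = true <;> simp [h]

theorem count_wait [NeZero K] (y : ℕ → Fin M → Fin K → ℝ) {k : Fin M → Fin K} (hk : Function.Injective k)
    (a : ℕ → Fin M → Fin K) (t : ℕ) (m : Fin M)
    (ha : ∀ r < 2 * (k m).val, a (t + r) = fun n => rankArm (k n) r) :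
    collisionCount ((List.range (2 * (k m).val)).map fun i => obsOf y a m (t + i)) =
      rankIndex k m := by
  rw [collisionCount, countP_range_map, rankIndex]
  symm
  refine Finset.card_bij (fun m' _ => (k m').val + (k m).val - 1) ?_ ?_ ?_
  · intro m' hm'
    simp only [Finset.mem_filter, Finset.mem_univ, true_and, Fin.lt_def] at hm'
    have hr : (k m').val + (k m).val - 1 < 2 * (k m).val := by omega
    simp only [Finset.mem_filter, Finset.mem_range]
    refine ⟨hr, ?_⟩
    simp only [obsOf, ha _ hr]
    exact (collides_wait hk m hr).2 ⟨m', hm', rfl⟩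
  · intro m₁ h₁ m₂ h₂ h
    simp only [Finset.mem_filter, Finset.mem_univ, true_and, Fin.lt_def] at h₁ h₂
    exact hk (Fin.ext (by omega))
  · intro r hr
    simp only [Finset.mem_filter, Finset.mem_range] at hr
    obtain ⟨hr, hc⟩ := hr
    simp only [obsOf, ha _ hr] at hc
    obtain ⟨m', h1, h2⟩ := (collides_wait hk m hr).1 hc
    exact ⟨m', by simpa using h1, h2⟩

theorem count_sweep [NeZero K] (y : ℕ → Fin M → Fin K → ℝ) {k : Fin M → Fin K} (hk : Function.Injective k)
    (a : ℕ → Fin M → Fin K) (t : ℕ) (m : Fin M)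
    (ha : ∀ i < K - 1 - (k m).val,
      a (t + i) = fun n => rankArm (k n) (2 * (k m).val + i)) :
    collisionCount ((List.range (K - 1 - (k m).val)).map fun i => obsOf y a m (t + i)) =
      (Finset.univ.filter fun m' => k m < k m').card := by
  rw [collisionCount, countP_range_map]
  symm
  refine Finset.card_bij (fun m' _ => (k m').val - (k m).val - 1) ?_ ?_ ?_
  · intro m' hm'
    simp only [Finset.mem_filter, Finset.mem_univ, true_and, Fin.lt_def] at hm'
    have := (k m').2
    have hr : (k m').val - (k m).val - 1 < K - 1 - (k m).val := by omega
    simp only [Finset.mem_filter, Finset.mem_range]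
    refine ⟨hr, ?_⟩
    simp only [obsOf, ha _ hr]
    exact (collides_sweep hk m hr).2 ⟨m', hm', rfl⟩
  · intro m₁ h₁ m₂ h₂ h
    simp only [Finset.mem_filter, Finset.mem_univ, true_and, Fin.lt_def] at h₁ h₂
    exact hk (Fin.ext (by omega))
  · intro r hr
    simp only [Finset.mem_filter, Finset.mem_range] at hr
    obtain ⟨hr, hc⟩ := hr
    simp only [obsOf, ha _ hr] at hc
    obtain ⟨m', h1, h2⟩ := (collides_sweep hk m hr).1 hc
    exact ⟨m', by simpa using h1, h2⟩

theorem rankIndex_add (k : Fin M → Fin K) (hk : Function.Injective k) (m : Fin M) :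
    1 + rankIndex k m + (Finset.univ.filter fun m' => k m < k m').card = M := by
  have h1 : (Finset.univ.filter fun m' => k m' < k m).card +
      (Finset.univ.filter fun m' => ¬ k m' < k m).card = M := by
    simpa using Finset.card_filter_add_card_filter_not (s := (Finset.univ : Finset (Fin M)))
      (fun m' => k m' < k m)
  have h2 : (Finset.univ.filter fun m' => ¬ k m' < k m) =
      insert m (Finset.univ.filter fun m' => k m < k m') := by
    ext m'
    simp only [Finset.mem_filter, Finset.mem_univ, true_and, Finset.mem_insert, not_lt]
    rw [le_iff_eq_or_lt]
    exact or_congr ⟨fun h => (hk h).symm, fun h => by rw [h]⟩ Iff.rfl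
  rw [h2, Finset.card_insert_of_notMem (by simp)] at h1
  unfold rankIndex
  omega

theorem filter_finRange_lt [NeZero K] (k : Fin K) : (List.finRange K).filter (fun a => k < a) =
    (List.range (K - 1 - k.val)).map fun i => Fin.ofNat K (k.val + 1 + i) := by
  have hinj : Function.Injective (List.map (Fin.val : Fin K → ℕ)) :=
    List.map_injective_iff.2 Fin.val_injective
  apply hinj
  have h1 : ((List.finRange K).filter (fun a => k < a)).map Fin.val =
      (List.range K).filter (fun a => k.val < a) := by
    rw [← List.map_coe_finRange_eq_range, List.filter_map]
    rfl
  have hk := k.2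
  have h2 : List.range K = List.range (k.val + 1) ++ List.range' (k.val + 1) (K - 1 - k.val) := by
    rw [List.range_eq_range', List.range_eq_range']
    have := List.range'_append (s := 0) (m := k.val + 1) (n := K - 1 - k.val) (step := 1)
    simp only [one_mul, zero_add] at this
    rw [this]
    congr 1
    omega
  rw [h1, h2, List.filter_append, List.filter_eq_nil_iff.2, List.nil_append,
    List.filter_eq_self.2, List.range'_eq_map_range, List.map_map]
  · apply List.map_congr_left
    intro i hi
    rw [List.mem_range] at hi
    simp only [Function.comp_apply, Fin.ofNat]
    exact (Nat.mod_eq_of_lt (by omega)).symm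
  · intro a ha
    rw [List.mem_range'_1] at ha
    simp; omega
  · intro a ha
    rw [List.mem_range] at ha
    simp; omega

theorem initProc_eq [NeZero K] (δ₀ : ℝ) : initProc K δ₀ =
    (musicalChairs K ⌈(K : ℝ) * Real.log (K / δ₀)⌉₊ none).bind fun o =>
      (pullList (List.replicate (2 * (o.getD 0).val) (o.getD 0))).bind fun wait =>
      (pullList ((List.finRange K).filter fun a => o.getD 0 < a)).bind fun sweep =>
      (stay 0 (K - 1 - (o.getD 0).val)).bind fun _ =>
      done (1 + collisionCount wait, 1 + collisionCount wait + collisionCount sweep) := rfl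

/-- If all players have occupied an arm in the musical chairs phase, then they know their ranks
and the number of players after the initialization. -/
theorem play_init [NeZero K] {y : ℕ → Fin M → Fin K → ℝ} {d : ℕ → Fin M → Fin K}
    {S : ℕ → Fin M → Prog K Unit} (hS : IsPlay y d S) (δ₀ : ℝ) (F : ℕ × ℕ → Prog K Unit)
    (h0 : ∀ m, S 0 m = (initProc K δ₀).bind F) {N : ℕ}
    (hN : N = ⌈(K : ℝ) * Real.log (K / δ₀)⌉₊) {k : Fin M → Fin K}
    (hk : ∀ m, occ d N m = some (k m)) (m : Fin M) :
    S (N + (2 * K - 2)) m = F (1 + rankIndex k m, M) := by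
  have hinj : Function.Injective k := fun m m' h =>
    occ_injective d N (hk m) (by rw [hk m', h])
  obtain ⟨h1, -⟩ := play_of_steps hS (chairs d) (n := N) (t := 0)
    (R := fun m => (pullList (List.replicate (2 * (k m).val) (k m))).bind fun wait =>
      (pullList ((List.finRange K).filter fun a => k m < a)).bind fun sweep =>
      (stay 0 (K - 1 - (k m).val)).bind fun _ =>
      F (1 + collisionCount wait, 1 + collisionCount wait + collisionCount sweep)) (fun m => by
    have := (run_musicalChairs y d m N 0).steps (fun o =>
      (pullList (List.replicate (2 * (o.getD 0).val) (o.getD 0))).bind fun wait =>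
      (pullList ((List.finRange K).filter fun a => o.getD 0 < a)).bind fun sweep =>
      (stay 0 (K - 1 - (o.getD 0).val)).bind fun _ =>
      F (1 + collisionCount wait, 1 + collisionCount wait + collisionCount sweep)) N rfl
    rw [zero_add, hk m] at this
    rw [h0 m, initProc_eq, ← hN]
    simp only [Prog.bind_assoc, done_bind]
    exact this)
  rw [zero_add] at h1
  set a : ℕ → Fin M → Fin K := fun s n => rankArm (k n) (s - N) with ha
  have haN : ∀ r, a (N + r) = fun n => rankArm (k n) r := fun r => by
    simp [ha]
  refine (play_of_steps hS a (n := 2 * K - 2) (t := N)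
    (R := fun m => F (1 + rankIndex k m, M)) (fun m => ?_)).1 m
  rw [h1 m]
  have hkm := (k m).2
  -- Waiting, sweeping and the final stay add up to the same number of rounds for every arm, so all
  -- players enter the first epoch together.
  have e : 2 * K - 2 = 2 * (k m).val + (K - 1 - (k m).val + (K - 1 - (k m).val)) := by omega
  have hR : (1 + rankIndex k m, M) = (1 + rankIndex k m,
      1 + rankIndex k m + (Finset.univ.filter fun m' => k m < k m').card) := by
    rw [rankIndex_add k hinj m]
  rw [e, hR]
  have r1 := run_pullList (d := fun s => d s m) (a := fun s => a s m) (o := obsOf y a m)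
    (List.replicate (2 * (k m).val) (k m)) N (fun i hi => by
      have hi' : i < 2 * (k m).val := by simpa using hi
      simp only [haN, List.getElem_replicate]
      rw [rankArm, if_pos hi'])
  simp only [List.length_replicate] at r1
  have r2 := run_pullList (d := fun s => d s m) (a := fun s => a s m) (o := obsOf y a m)
    ((List.finRange K).filter fun a => k m < a) (N + 2 * (k m).val) (fun i hi => by
      have hi' : i < K - 1 - (k m).val := by
        rw [filter_finRange_lt] at hi
        simpa using hi
      simp only [add_assoc, haN, filter_finRange_lt, List.getElem_map, List.getElem_range]
      rw [rankArm, if_neg (by omega), if_pos (by omega)]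
      congr 1
      omega)
  have hlen : ((List.finRange K).filter fun a => k m < a).length = K - 1 - (k m).val := by
    rw [filter_finRange_lt]; simp
  rw [hlen] at r2
  refine Steps.trans (r1.steps _ _ rfl) (Steps.trans (r2.steps _ _ rfl) ?_)
  rw [count_wait y hinj a N m fun r _ => haN r,
    count_sweep y hinj a (N + 2 * (k m).val) m fun i _ => by rw [add_assoc, haN]]
  refine (run_stay _ _ _ fun i hi => ?_).steps (fun _ => F _) _ rfl
  simp only [add_assoc, haN]
  rw [rankArm, if_neg (by omega), if_neg (by omega)]

end Rank

/-! ### The beginning of the first epoch -/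

section Start

variable {K n : ℕ}

theorem collides_comp_perm {M : ℕ} (A : Fin M → Fin K) (σ : Equiv.Perm (Fin M)) (m : Fin M) :
    collides (fun m => A (σ m)) m = collides A (σ m) := by
  simp only [collides]
  congr 1
  rw [eq_iff_iff]
  constructor
  · rintro ⟨n, h1, h2⟩
    exact ⟨σ n, fun h => h1 (σ.injective h), h2⟩
  · rintro ⟨n, h1, h2⟩
    refine ⟨σ.symm n, fun h => h1 (by rw [← h]; simp), by simpa using h2⟩

/-- The rules of the game are symmetric in the players. This permits indexing the players by rank,
as the analysis of the epochs requires the leader to be player 0. -/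
theorem IsPlay.relabel {M : ℕ} [NeZero K] {y : ℕ → Fin M → Fin K → ℝ} {d : ℕ → Fin M → Fin K}
    {S : ℕ → Fin M → Prog K Unit} (hS : IsPlay y d S) (σ : Equiv.Perm (Fin M)) :
    IsPlay (fun t m => y t (σ m)) (fun t m => d t (σ m)) fun t m => S t (σ m) := by
  intro t m
  have hc : collides (armsOf (fun t m => d t (σ m)) (fun t m => S t (σ m)) t) m =
      collides (armsOf d S t) (σ m) := collides_comp_perm (armsOf d S t) σ m
  have hg : gain (fun m => y t (σ m)) (armsOf (fun t m => d t (σ m)) (fun t m => S t (σ m)) t) m =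
      gain (y t) (armsOf d S t) (σ m) := by
    simp only [gain, hc]
    rfl
  rw [hc]
  exact (hS t (σ m)).trans (by rw [← hg])

/-- The data at the beginning of the first epoch, which starts in round `t`. -/
def EpochState.init [NeZero K] (n t : ℕ) : EpochState K n where
  t := t
  E := List.finRange (n + 1) ×ˢ List.finRange K
  w := fun _ _ => 0
  κ := fun i => Fin.ofNat K i.val

/-- The number of rounds of the musical chairs phase. -/
def chairsLength (K T : ℕ) : ℕ := ⌈(K : ℝ) * Real.log (K / (1 / ((K : ℝ) * T)))⌉₊

/-- The number of rounds of the initialization. -/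
def initLength (K T : ℕ) : ℕ := chairsLength K T + (2 * K - 2)

theorem atEpoch_init [NeZero K] (hn : n + 1 ≤ K) (rule : ArgmaxRule K) (T c : ℕ)
    (y : ℕ → Fin (n + 1) → Fin K → ℝ) (d : ℕ → Fin (n + 1) → Fin K)
    {k : Fin (n + 1) → Fin K} (hk : ∀ m, occ d (chairsLength K T) m = some (k m))
    (hinj : Function.Injective k) :
    AtEpoch rule T c (fun t m => progAt (metcElim rule T c) y d t ((rankEquiv k hinj).symm m))
      T 1 (EpochState.init n (initLength K T)) := by
  have h := play_init (isPlay_progAt (metcElim rule T c) y d) (1 / ((K : ℝ) * T)) _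
    (fun _ => rfl) (rfl : chairsLength K T = _) hk
  have hr : ∀ m : Fin (n + 1), rankIndex k ((rankEquiv k hinj).symm m) = m.val := by
    intro m
    have := (rankEquiv k hinj).apply_symm_apply m
    exact congrArg Fin.val this
  constructor
  · refine (h _).trans ?_
    simp only [hr]
    rfl
  · intro j
    refine (h _).trans ?_
    simp only [hr, Fin.val_succ]
    rw [if_neg (by omega)]
    have e1 : 1 + (j.val + 1) = j.val + 2 := by ring
    have e2 : 1 + (j.val + 1) - 1 = j.val + 1 := by omega
    rw [e2, e1]
    rfl
  · intro i j h
    have := congrArg Fin.val h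
    simp only [EpochState.init, Fin.ofNat] at this
    rw [Nat.mod_eq_of_lt (i.2.trans_le hn), Nat.mod_eq_of_lt (j.2.trans_le hn)] at this
    exact Fin.ext this
  · simp [EpochState.init, List.length_product]

end Start

/-! ### The regret of a round -/

section Instant

variable {K M : ℕ}

/-- The expected regret of a round in which the players pull the arms `A`. -/
def roundRegret (μ : Fin M → Fin K → ℝ) (A : Fin M → Fin K) : ℝ :=
  maxUtility μ - ∑ m, if collides A m then 0 else μ m (A m)

variable {μ : Fin M → Fin K → ℝ}

theorem weight_le_maxUtility (μ : Fin M → Fin K → ℝ) {π : Fin M → Fin K}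
    (hπ : Function.Injective π) : weight μ π ≤ maxUtility μ :=
  le_ciSup (f := fun π : Fin M ↪ Fin K => ∑ m, μ m (π m)) (Set.finite_range _).bddAbove ⟨π, hπ⟩

theorem exists_weight_eq_maxUtility (hMK : M ≤ K) (μ : Fin M → Fin K → ℝ) :
    ∃ π : Fin M → Fin K, Function.Injective π ∧ weight μ π = maxUtility μ := by
  have : Nonempty (Fin M ↪ Fin K) := ⟨⟨Fin.castLE hMK, Fin.castLE_injective hMK⟩⟩
  obtain ⟨π, hπ⟩ := exists_eq_ciSup_of_finite (f := fun π : Fin M ↪ Fin K => ∑ m, μ m (π m))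
  exact ⟨π, π.injective, hπ⟩

theorem maxUtility_le (hMK : M ≤ K) (hμ : ∀ m k, μ m k ≤ 1) : maxUtility μ ≤ M := by
  obtain ⟨π, -, h⟩ := exists_weight_eq_maxUtility hMK μ
  rw [← h, weight]
  calc ∑ m, μ m (π m) ≤ ∑ _m : Fin M, (1 : ℝ) := Finset.sum_le_sum fun m _ => hμ m _
    _ = M := by simp

theorem roundRegret_le (hMK : M ≤ K) (h0 : ∀ m k, 0 ≤ μ m k) (h1 : ∀ m k, μ m k ≤ 1)
    (A : Fin M → Fin K) : roundRegret μ A ≤ M := by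
  have : 0 ≤ ∑ m, if collides A m then 0 else μ m (A m) :=
    Finset.sum_nonneg fun m _ => by split_ifs <;> simp [h0]
  have := maxUtility_le hMK h1
  unfold roundRegret
  linarith

theorem roundRegret_of_injective {A : Fin M → Fin K} (hA : Function.Injective A) :
    roundRegret μ A = maxUtility μ - weight μ A := by
  simp [roundRegret, collides_of_injective hA, weight]

/-- Sending a bit makes only the sender and the receiver collide, and each of them loses at most 1;
all other players earn what they would earn under `κ`. -/
theorem roundRegret_le_of_isCommRound (h1 : ∀ m k, μ m k ≤ 1)
    {κ A : Fin M → Fin K} (hκ : Function.Injective κ) (hA : IsCommRound κ A) :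
    roundRegret μ A ≤ 2 + (maxUtility μ - weight μ κ) := by
  rcases hA with rfl | ⟨i, j, hij, rfl⟩
  · rw [roundRegret_of_injective hκ]
    linarith
  · set A := Function.update κ i (κ j) with hA
    have key : ∀ m, μ m (κ m) - (if collides A m then 0 else μ m (A m)) ≤
        (if m = i then 1 else 0) + if m = j then 1 else 0 := by
      intro m
      by_cases hi : m = i
      · subst hi
        have : collides A m = true := by
          simp only [collides, decide_eq_true_eq]
          exact ⟨j, hij.symm, by simp [hA, Function.update_of_ne hij.symm]⟩
        simp only [this, if_true, hij, if_false]
        linarith [h1 m (κ m)]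
      by_cases hj : m = j
      · subst hj
        have : collides A m = true := collides_update hij
        simp only [this, if_true, hi, if_false]
        linarith [h1 m (κ m)]
      · have hm : A m = κ m := by simp [hA, Function.update_of_ne hi]
        have : collides A m = false := by
          simp only [collides, decide_eq_false_iff_not, not_exists, not_and]
          intro n hn h
          rw [hm] at h
          by_cases hni : n = i
          · subst hni
            rw [hA, Function.update_self] at h
            exact hj (hκ h).symm
          · rw [hA, Function.update_of_ne hni] at h
            exact hn (hκ h)
        simp [this, hi, hj, hm]
    have := Finset.sum_le_sum fun m (_ : m ∈ Finset.univ) => key m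
    rw [Finset.sum_sub_distrib, Finset.sum_add_distrib] at this
    simp only [Finset.sum_ite_eq', Finset.mem_univ, if_true] at this
    unfold roundRegret weight
    linarith

end Instant

/-! ### Empirical means -/

section Means

variable {K n : ℕ}

/-- The rounds in which player `m` pulls arm `k` while the matchings `l` are explored. -/
def slotSet (l : List (Fin (n + 1) → Fin K)) (m : Fin (n + 1)) (k : Fin K) : Finset ℕ :=
  (Finset.range l.length).filter fun i => ∃ h : i < l.length, l[i] m = k

/-- Turns the average over filtered lists into an average over a set of rounds, the form to which
Hoeffding's inequality applies. The induction appends on the right since the last entry belongs to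
the last round. -/
theorem exploreMean_eq (y : ℕ → Fin (n + 1) → Fin K → ℝ) (u : ℕ)
    (l : List (Fin (n + 1) → Fin K)) (m : Fin (n + 1)) (k : Fin K) :
    exploreMean y u l m k =
      (∑ i ∈ slotSet l m k, y (u + i) m k) / (slotSet l m k).card := by
  have key : ∀ (l : List (Fin (n + 1) → Fin K)) (u : ℕ),
      (((((l.map fun π => π m).zip (exploreObs y u l m)).filter fun x => x.1 = k).map
        fun x => x.2.1).sum = ∑ i ∈ slotSet l m k, y (u + i) m k) ∧
      ((((l.map fun π => π m).zip (exploreObs y u l m)).filter fun x => x.1 = k).map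
        fun x => x.2.1).length = (slotSet l m k).card := by
    intro l
    induction l using List.reverseRecOn with
    | nil => intro u; simp [slotSet]
    | append_singleton l π ih =>
      intro u
      obtain ⟨h1, h2⟩ := ih u
      have e1 : exploreObs y u (l ++ [π]) m =
          exploreObs y u l m ++ [(y (u + l.length) m (π m), false)] := by
        simp [exploreObs, List.zipIdx_append]
      have e2 : slotSet (l ++ [π]) m k =
          if π m = k then insert l.length (slotSet l m k) else slotSet l m k := by
        ext i
        have : i ∈ (if π m = k then insert l.length (slotSet l m k) else slotSet l m k) ↔
            (π m = k ∧ i = l.length) ∨ i ∈ slotSet l m k := by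
          split_ifs with h <;> simp [h]
        rw [this]
        simp only [slotSet, Finset.mem_filter, Finset.mem_range, List.length_append,
          List.length_singleton]
        rcases lt_trichotomy i l.length with h | h | h
        · have hA : (l ++ [π])[i]'(by simp; omega) = l[i] := List.getElem_append_left h
          constructor
          · rintro ⟨_, h', h''⟩
            exact Or.inr ⟨h, h, by rw [← hA]; exact h''⟩
          · rintro (⟨_, h'⟩ | ⟨_, _, h''⟩)
            · omega
            · exact ⟨by omega, by omega, by rw [hA]; exact h''⟩
        · subst h
          simp
        · constructor
          · rintro ⟨h', _⟩; omega
          · rintro (⟨_, h'⟩ | ⟨h', _⟩) <;> omega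
      have hnot : l.length ∉ slotSet l m k := by simp [slotSet]
      have hz : ((l ++ [π]).map fun π => π m).zip (exploreObs y u (l ++ [π]) m) =
          ((l.map fun π => π m).zip (exploreObs y u l m)) ++
            [(π m, (y (u + l.length) m (π m), false))] := by
        rw [e1, List.map_append, List.zip_append (by simp [exploreObs])]
        rfl
      rw [hz, List.filter_append, List.map_append, List.sum_append, List.length_append, h1, h2, e2]
      by_cases hk : π m = k
      · simp [hk, Finset.sum_insert hnot, Finset.card_insert_of_notMem hnot, add_comm]
      · simp [hk]
  obtain ⟨h1, h2⟩ := key l u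
  simp only [exploreMean, empMean]
  rw [h1, h2]

theorem exploreMean_mem_Icc {y : ℕ → Fin (n + 1) → Fin K → ℝ}
    (hy : ∀ t m k, y t m k ∈ Set.Icc (0 : ℝ) 1) (u : ℕ)
    (l : List (Fin (n + 1) → Fin K)) (m : Fin (n + 1)) (k : Fin K) :
    exploreMean y u l m k ∈ Set.Icc (0 : ℝ) 1 := by
  rw [exploreMean_eq]
  have h0 : 0 ≤ ∑ i ∈ slotSet l m k, y (u + i) m k := Finset.sum_nonneg fun i _ => (hy _ _ _).1
  have h1 : ∑ i ∈ slotSet l m k, y (u + i) m k ≤ (slotSet l m k).card := by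
    calc _ ≤ ∑ i ∈ slotSet l m k, (1 : ℝ) := Finset.sum_le_sum fun i _ => (hy _ _ _).2
      _ = _ := by simp
  exact ⟨by positivity, div_le_one_of_le₀ h1 (by positivity)⟩

/-- Division of 0 by 0 yields the prescribed estimate 0, which never overestimates a mean utility.
-/
theorem exploreMean_of_forall_ne (y : ℕ → Fin (n + 1) → Fin K → ℝ) (u : ℕ)
    {l : List (Fin (n + 1) → Fin K)} {m : Fin (n + 1)} {k : Fin K}
    (h : ∀ π ∈ l, π m ≠ k) : exploreMean y u l m k = 0 := by
  have : slotSet l m k = ∅ := by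
    rw [slotSet, Finset.filter_eq_empty_iff]
    rintro i hi ⟨h', h''⟩
    exact h _ (List.getElem_mem h') h''
  rw [exploreMean_eq, this]
  simp

/-- The matching `π` contributes a whole block of rounds; further candidates through the same edge
can only add to it. -/
theorem two_pow_le_card_slotSet (c p : ℕ) {C : List (Fin (n + 1) → Fin K)} {m : Fin (n + 1)}
    {k : Fin K} {π : Fin (n + 1) → Fin K} (hπ : π ∈ C) (hk : π m = k) :
    2 ^ p ^ c ≤ (slotSet (slots c p C) m k).card := by
  have key : ∀ l : List (Fin (n + 1) → Fin K),
      (slotSet l m k).card = l.countP fun π => π m = k := by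
    intro l
    have h1 : l.countP (fun π => π m = k) =
        ((List.range l.length).map fun i => l[i]?.getD π).countP (fun π => π m = k) := by
      congr 1
      apply List.ext_getElem
      · simp
      · intro i h1 h2
        simp [List.getElem?_eq_getElem h1]
    rw [h1, countP_range_map]
    congr 1
    ext i
    simp only [slotSet, Finset.mem_filter, Finset.mem_range]
    constructor
    · rintro ⟨h, _, h'⟩
      exact ⟨h, by simpa [List.getElem?_eq_getElem h] using h'⟩
    · rintro ⟨h, h'⟩
      exact ⟨h, h, by simpa [List.getElem?_eq_getElem h] using h'⟩
  rw [key]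
  obtain ⟨C₁, C₂, rfl⟩ := List.append_of_mem hπ
  simp only [slots, List.flatMap_append, List.flatMap_cons, List.countP_append,
    List.countP_replicate, hk]
  simp
  omega

theorem truncate_div_le {b : ℕ} {x : ℝ} (hx : 0 ≤ x) : (truncate b x : ℝ) / 2 ^ b ≤ x := by
  rw [div_le_iff₀ (by positivity)]
  have h1 : (truncate b x : ℝ) ≤ (⌊2 ^ b * x⌋₊ : ℝ) := Nat.cast_le.2 (min_le_left _ _)
  have h2 := Nat.floor_le (a := 2 ^ b * x) (by positivity)
  linarith

/-- Rounding down loses less than one unit of the last bit. If the cap 2^b - 1 is attained, the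
right side equals 1, which covers the value x = 1. -/
theorem le_truncate_div_add {b : ℕ} {x : ℝ} (hx : x ≤ 1) :
    x ≤ (truncate b x : ℝ) / 2 ^ b + 1 / 2 ^ b := by
  rw [← add_div, le_div_iff₀ (by positivity)]
  have h1 : ((2 ^ b - 1 : ℕ) : ℝ) = 2 ^ b - 1 := by
    rw [Nat.cast_sub Nat.one_le_two_pow]; simp
  have h2 := (Nat.lt_floor_add_one (2 ^ b * x)).le
  have hb : (0 : ℝ) < 2 ^ b := by positivity
  unfold truncate
  rcases min_choice ⌊2 ^ b * x⌋₊ (2 ^ b - 1) with h | h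
  · rw [h]; linarith
  · rw [h, h1]; nlinarith

end Means

/-! ### The confidence radii -/

section Eps

variable {K M T : ℕ}

theorem eps_nonneg (K M T c p : ℕ) : 0 ≤ eps K M T c p := Real.sqrt_nonneg _

theorem eps_sq (hL : 0 ≤ Real.log (2 / delta K M T)) (p : ℕ) :
    eps K M T 1 p ^ 2 = Real.log (2 / delta K M T) / 2 ^ (1 + p) := by
  rw [eps, Real.sq_sqrt (by positivity), pow_one]

/-- At least (p+1)/2 bits are sent, so the squared truncation error is at most 2^(-(p+1)), while
ε_p² = L/2^(p+1). This is one place where L ≥ 4 is needed. -/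
theorem one_div_two_pow_meanBits_le (hL : 4 ≤ Real.log (2 / delta K M T)) (p : ℕ) :
    1 / 2 ^ meanBits 1 p ≤ eps K M T 1 p / 2 := by
  refine le_of_sq_le_sq ?_ (by have := eps_nonneg K M T 1 p; positivity)
  rw [div_pow, div_pow, eps_sq (by linarith), ← pow_mul, div_div, one_pow,
    div_le_div_iff₀ (by positivity) (by positivity)]
  have h1 : (2 : ℝ) ^ (1 + p) ≤ 2 ^ (meanBits 1 p * 2) :=
    pow_le_pow_right₀ (by norm_num) (by simp only [meanBits, pow_one]; omega)
  have h2 : (0 : ℝ) < 2 ^ (1 + p) := by positivity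
  nlinarith

theorem eps_succ_sq (hL : 0 ≤ Real.log (2 / delta K M T)) (p : ℕ) :
    2 * eps K M T 1 (p + 1) ^ 2 = eps K M T 1 p ^ 2 := by
  rw [eps_sq hL, eps_sq hL, ← add_assoc, pow_succ]
  field_simp

/-- The left side is at most (5/2)ε_p = (5/2)√2 ε_(p+1), and 25/2 ≤ 16. -/
theorem confidence_width_le (hL : 4 ≤ Real.log (2 / delta K M T)) (p : ℕ) :
    eps K M T 1 p + (eps K M T 1 p + 1 / 2 ^ meanBits 1 p) ≤ 4 * eps K M T 1 (p + 1) := by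
  have h1 := one_div_two_pow_meanBits_le hL p
  have h2 := eps_succ_sq (by linarith : 0 ≤ Real.log (2 / delta K M T)) p
  have h3 := eps_nonneg K M T 1 p
  have h4 := eps_nonneg K M T 1 (p + 1)
  have : 5 / 2 * eps K M T 1 p ≤ 4 * eps K M T 1 (p + 1) := by
    refine le_of_sq_le_sq ?_ (by positivity)
    rw [mul_pow, mul_pow, ← h2]
    nlinarith [sq_nonneg (eps K M T 1 (p + 1))]
  linarith

/-- Makes the initial estimates 0, whose error is at most 1, accurate enough for the first epoch. -/
theorem one_le_four_mul_eps_one (hL : 4 ≤ Real.log (2 / delta K M T)) :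
    1 ≤ 4 * eps K M T 1 1 := by
  refine le_of_sq_le_sq ?_ (by have := eps_nonneg K M T 1 1; positivity)
  rw [mul_pow, eps_sq (by linarith)]
  norm_num
  linarith

end Eps

/-! ### The quality of the explored matchings -/

section Elimination

variable {K n : ℕ} {rule : ArgmaxRule K} {T : ℕ} {μ : Fin (n + 1) → Fin K → ℝ}
  {πs : Fin (n + 1) → Fin K} {p : ℕ} {st : EpochState K n}

/-- The estimates in `st` are accurate enough for epoch `p`, `πs` being an optimal matching. -/
structure IsAccurate (T : ℕ) (μ : Fin (n + 1) → Fin K → ℝ) (πs : Fin (n + 1) → Fin K) (p : ℕ)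
    (st : EpochState K n) : Prop where
  edge_mem : ∀ m, (m, πs m) ∈ st.E
  width : ∃ a b : ℝ, a + b ≤ 4 * eps K (n + 1) T 1 p ∧ (∀ m k, st.w m k ≤ μ m k + a) ∧
    ∀ m, μ m (πs m) ≤ st.w m (πs m) + b

/-- The upper error a is applied to `π` and the lower error b to `πs` only, each M times. Because
lower bounds are needed only on the optimal edges, the estimates 0 of edges that were not explored
do no harm. -/
theorem IsAccurate.regret_add_le (h : IsAccurate T μ πs p st) (π : Fin (n + 1) → Fin K) :
    weight μ πs - weight μ π ≤
      weight st.w πs - weight st.w π + 4 * ((n + 1 : ℕ) : ℝ) * eps K (n + 1) T 1 p := by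
  obtain ⟨a, b, hab, h1, h2⟩ := h.width
  have e1 : weight μ πs ≤ weight st.w πs + ((n + 1 : ℕ) : ℝ) * b := by
    unfold weight
    have := Finset.sum_le_sum fun m (_ : m ∈ Finset.univ) => h2 m
    rw [Finset.sum_add_distrib] at this
    simpa using this
  have e2 : weight st.w π ≤ weight μ π + ((n + 1 : ℕ) : ℝ) * a := by
    unfold weight
    have := Finset.sum_le_sum fun m (_ : m ∈ Finset.univ) => h1 m (π m)
    rw [Finset.sum_add_distrib] at this
    simpa using this
  have hM : (0 : ℝ) ≤ ((n + 1 : ℕ) : ℝ) := by positivity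
  nlinarith

theorem weight_le_bestMatching (w : Fin (n + 1) → Fin K → ℝ) {π : Fin (n + 1) → Fin K}
    (hπ : Function.Injective π) : weight w π ≤ weight w (bestMatching rule w) :=
  rule.weight_le _ _ _ _ (by simpa [matchings] using hπ)

theorem weight_le_assocMatching (w : Fin (n + 1) → Fin K → ℝ) {π : Fin (n + 1) → Fin K}
    (hπ : Function.Injective π) (m : Fin (n + 1)) :
    weight w π ≤ weight w (assocMatching rule w (m, π m)) :=
  rule.weight_le _ _ _ _ (by simpa [matchings, matchingsThrough] using hπ)

theorem mem_keptEdges {c : ℕ} {E : List (Fin (n + 1) × Fin K)} {w : Fin (n + 1) → Fin K → ℝ}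
    {e : Fin (n + 1) × Fin K} : e ∈ keptEdges rule T c p E w ↔ e ∈ E ∧
      weight w (bestMatching rule w) - weight w (assocMatching rule w e) ≤
        4 * ((n + 1 : ℕ) : ℝ) * eps K (n + 1) T c p := by
  simp [keptEdges, weight, Finset.sum_sub_distrib]

theorem IsAccurate.bestMatching_le (h : IsAccurate T μ πs p st) (hπs : Function.Injective πs) :
    weight μ πs - weight μ (bestMatching rule st.w) ≤
      4 * ((n + 1 : ℕ) : ℝ) * eps K (n + 1) T 1 p := by
  have h1 := h.regret_add_le (bestMatching rule st.w)
  have h2 := weight_le_bestMatching (rule := rule) st.w hπs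
  linarith

/-- One half of the bound is the elimination threshold, the other half the error of the estimates.
-/
theorem IsAccurate.candidate_le (h : IsAccurate T μ πs p st) (hπs : Function.Injective πs)
    {π : Fin (n + 1) → Fin K} (hπ : π ∈ st.cands rule T 1 p) :
    weight μ πs - weight μ π ≤ 8 * ((n + 1 : ℕ) : ℝ) * eps K (n + 1) T 1 p := by
  simp only [EpochState.cands, candidates, List.mem_dedup, List.mem_map] at hπ
  obtain ⟨e, he, rfl⟩ := hπ
  have h0 := (mem_keptEdges.1 he).2
  have h1 := h.regret_add_le (assocMatching rule st.w e)
  have h2 := weight_le_bestMatching (rule := rule) st.w hπs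
  linarith

/-- The best matching through an optimal edge has at least the estimate of `πs`, and the estimated
optimum has at most the true utility of `πs`. So the estimated gap is pure estimation error, which
stays below the threshold. -/
theorem IsAccurate.mem_keptEdges_optimal (h : IsAccurate T μ πs p st) (hn : n + 1 ≤ K)
    (hπs : Function.Injective πs) (hopt : ∀ π, Function.Injective π → weight μ π ≤ weight μ πs)
    (m : Fin (n + 1)) : (m, πs m) ∈ keptEdges rule T 1 p st.E st.w := by
  refine mem_keptEdges.2 ⟨h.edge_mem m, ?_⟩
  have h1 := h.regret_add_le (bestMatching rule st.w)
  have h2 := weight_le_assocMatching (rule := rule) st.w hπs m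
  have h3 := hopt _ (bestMatching_injective rule hn st.w)
  linarith

theorem assocMatching_mem_cands {c : ℕ} {e : Fin (n + 1) × Fin K}
    (h : e ∈ keptEdges rule T c p st.E st.w) :
    assocMatching rule st.w e ∈ st.cands rule T c p := by
  simp only [EpochState.cands, candidates, List.mem_dedup, List.mem_map]
  exact ⟨e, h, rfl⟩

/-- Each edge of `πs` is kept and has an associated matching through it among the candidates; a lone
candidate contains all these edges. -/
theorem IsAccurate.eq_of_singleton (h : IsAccurate T μ πs p st) (hn : n + 1 ≤ K)
    (hπs : Function.Injective πs) (hopt : ∀ π, Function.Injective π → weight μ π ≤ weight μ πs)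
    {π : Fin (n + 1) → Fin K} (hC : st.cands rule T 1 p = [π]) : π = πs := by
  funext m
  have h1 := assocMatching_mem_cands (h.mem_keptEdges_optimal (rule := rule) hn hπs hopt m)
  rw [hC, List.mem_singleton] at h1
  rw [← h1]
  exact (assocMatching_mem rule hn _ _).2

/-- Excludes the empty list, so that an exploration in epoch p lasts at least 2·2^p rounds. -/
theorem IsAccurate.two_le_length (h : IsAccurate T μ πs p st) (hn : n + 1 ≤ K)
    (hπs : Function.Injective πs) (hopt : ∀ π, Function.Injective π → weight μ π ≤ weight μ πs)
    (hC : ∀ π, st.cands rule T 1 p ≠ [π]) : 2 ≤ (st.cands rule T 1 p).length := by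
  have h1 := assocMatching_mem_cands (h.mem_keptEdges_optimal (rule := rule) hn hπs hopt 0)
  rcases hc : st.cands rule T 1 p with _ | ⟨π, _ | ⟨π', l⟩⟩
  · rw [hc] at h1; simp at h1
  · exact absurd hc (hC π)
  · simp

/-- The utilities observed in the exploration of epoch `p` are close to the means. -/
def Concentrates (rule : ArgmaxRule K) (T : ℕ) (μ : Fin (n + 1) → Fin K → ℝ)
    (y : ℕ → Fin (n + 1) → Fin K → ℝ) (p : ℕ) (st : EpochState K n) : Prop :=
  ∀ m k, (∃ π ∈ st.cands rule T 1 p, π m = k) →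
    |exploreMean y (st.u rule T 1 p) (slots 1 p (st.cands rule T 1 p)) m k - μ m k| ≤
      eps K (n + 1) T 1 p

/-- Truncation only lowers an estimate, so the upper error is ε_p and the lower one ε_p plus one
unit of the last bit. Edges that were not explored have estimate 0 and satisfy the upper bound
trivially; the edges of `πs` are kept and hence explored, which gives the lower bound. -/
theorem IsAccurate.next (hL : 4 ≤ Real.log (2 / delta K (n + 1) T))
    (h : IsAccurate T μ πs p st) (hn : n + 1 ≤ K) (hπs : Function.Injective πs)
    (hopt : ∀ π, Function.Injective π → weight μ π ≤ weight μ πs)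
    (h0 : ∀ m k, 0 ≤ μ m k)
    {y : ℕ → Fin (n + 1) → Fin K → ℝ} (hy : ∀ t m k, y t m k ∈ Set.Icc (0 : ℝ) 1)
    (hc : Concentrates rule T μ y p st) :
    IsAccurate T μ πs (p + 1) (st.next rule T 1 p y) := by
  refine ⟨fun m => h.mem_keptEdges_optimal hn hπs hopt m, eps K (n + 1) T 1 p,
    eps K (n + 1) T 1 p + 1 / 2 ^ meanBits 1 p, confidence_width_le hL p, ?_, ?_⟩
  · have hmean : ∀ m k, exploreMean y (st.u rule T 1 p) (slots 1 p (st.cands rule T 1 p)) m k ≤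
        μ m k + eps K (n + 1) T 1 p := by
      intro m k
      by_cases hk : ∃ π ∈ st.cands rule T 1 p, π m = k
      · have := (abs_le.1 (hc m k hk)).2
        linarith
      · push Not at hk
        rw [exploreMean_of_forall_ne]
        · linarith [h0 m k, eps_nonneg K (n + 1) T 1 p]
        · exact fun π hπ => hk π ((mem_slots 1).1 hπ)
    intro m k
    refine Fin.cases ?_ (fun j => ?_) m
    · exact hmean 0 k
    · exact (truncate_div_le (exploreMean_mem_Icc hy _ _ _ _).1).trans (hmean j.succ k)
  · have hmean : ∀ m, μ m (πs m) ≤ exploreMean y (st.u rule T 1 p)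
        (slots 1 p (st.cands rule T 1 p)) m (πs m) + eps K (n + 1) T 1 p := by
      intro m
      have := (abs_le.1 (hc m (πs m) ⟨_, assocMatching_mem_cands
        (h.mem_keptEdges_optimal hn hπs hopt m), (assocMatching_mem rule hn _ _).2⟩)).1
      linarith
    intro m
    refine Fin.cases ?_ (fun j => ?_) m
    · have : (0 : ℝ) ≤ 1 / 2 ^ meanBits 1 p := by positivity
      exact (hmean 0).trans (by
        change _ ≤ exploreMean y (st.u rule T 1 p) (slots 1 p (st.cands rule T 1 p)) 0 (πs 0) + _
        linarith)
    · have h1 := le_truncate_div_add (b := meanBits 1 p) (exploreMean_mem_Icc hy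
        (st.u rule T 1 p) (slots 1 p (st.cands rule T 1 p)) j.succ (πs j.succ)).2
      refine (hmean j.succ).trans ?_
      change _ ≤ (truncate (meanBits 1 p) (exploreMean y (st.u rule T 1 p)
        (slots 1 p (st.cands rule T 1 p)) j.succ (πs j.succ)) : ℝ) / 2 ^ meanBits 1 p + _
      linarith

theorem isAccurate_init [NeZero K] (hL : 4 ≤ Real.log (2 / delta K (n + 1) T)) (t : ℕ)
    (h0 : ∀ m k, 0 ≤ μ m k) (h1 : ∀ m k, μ m k ≤ 1) :
    IsAccurate T μ πs 1 (EpochState.init n t) := by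
  refine ⟨fun m => by simp [EpochState.init], 0, 1, ?_, fun m k => ?_, fun m => ?_⟩
  · rw [zero_add]; exact one_le_four_mul_eps_one hL
  · simpa [EpochState.init] using h0 m k
  · simpa [EpochState.init] using h1 m _

end Elimination

/-! ### The regret after the initialization -/

section Tail

/-- The sum of `ρ` over the rounds `t, ..., T - 1`. -/
def tailSum (ρ : ℕ → ℝ) (T t : ℕ) : ℝ := ∑ s ∈ Finset.Ico t T, ρ s

theorem tailSum_of_le (ρ : ℕ → ℝ) {T t : ℕ} (h : T ≤ t) : tailSum ρ T t = 0 := by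
  rw [tailSum, Finset.Ico_eq_empty (by omega), Finset.sum_empty]

theorem tailSum_le_of_le {ρ : ℕ → ℝ} {T t t' : ℕ} {b : ℝ} (htt : t ≤ t') (hT : t' ≤ T)
    (h : ∀ s, t ≤ s → s < t' → ρ s ≤ b) :
    tailSum ρ T t ≤ ((t' : ℝ) - t) * b + tailSum ρ T t' := by
  unfold tailSum
  rw [← Finset.sum_Ico_consecutive ρ htt hT]
  have : ∑ s ∈ Finset.Ico t t', ρ s ≤ (Finset.Ico t t').card • b :=
    Finset.sum_le_card_nsmul _ _ _ fun s hs => by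
      rw [Finset.mem_Ico] at hs; exact h s hs.1 hs.2
  rw [Nat.card_Ico, nsmul_eq_mul, Nat.cast_sub htt] at this
  linarith

/-- The block may extend beyond the horizon T; since b ≥ 0, charging for the missing rounds only
increases the bound. -/
theorem tailSum_le {ρ : ℕ → ℝ} {T t t' : ℕ} {b : ℝ} (hb : 0 ≤ b) (htt : t ≤ t')
    (h : ∀ s, t ≤ s → s < t' → ρ s ≤ b) :
    tailSum ρ T t ≤ ((t' : ℝ) - t) * b + tailSum ρ T t' := by
  have h0 : (0 : ℝ) ≤ ((t' : ℝ) - t) * b :=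
    mul_nonneg (by rw [sub_nonneg]; exact_mod_cast htt) hb
  rcases le_total t' T with hT | hT
  · exact tailSum_le_of_le htt hT h
  · rw [tailSum_of_le ρ hT]
    rcases le_total t T with hT' | hT'
    · have h1 := tailSum_le_of_le (T := T) hT' le_rfl (b := b)
        fun s h1 h2 => h s h1 (by omega)
      rw [tailSum_of_le ρ le_rfl] at h1
      have : ((T : ℝ) - t) * b ≤ ((t' : ℝ) - t) * b := by
        have : (T : ℝ) ≤ t' := by exact_mod_cast hT
        gcongr
      linarith
    · rw [tailSum_of_le ρ hT']; linarith

end Tail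

/-! ### The regret accumulated over the successive epochs. -/

section Epochs

variable {K n : ℕ}

/-- The data at the beginning of epoch `q + 1`, the first epoch starting in round `t`. -/
def epochData [NeZero K] (rule : ArgmaxRule K) (T : ℕ) (y : ℕ → Fin (n + 1) → Fin K → ℝ) (t : ℕ) :
    ℕ → EpochState K n
  | 0 => EpochState.init n t
  | q + 1 => (epochData rule T y t q).next rule T 1 (q + 1) y

/-- A bound on the suboptimality of the communication arms that are fixed in epoch `p`. -/
def commGap (K n T p : ℕ) : ℝ :=
  if p = 0 then ((n + 1 : ℕ) : ℝ) else 4 * ((n + 1 : ℕ) : ℝ) * eps K (n + 1) T 1 p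

/-- A bound on the regret caused by the communication in epoch `p`. -/
def commRegret (K n T p : ℕ) : ℝ :=
  commLength K n ((n + 1) * K) * (2 + commGap K n T (p - 1)) +
    (n * (K * meanBits 1 p) : ℕ) * (2 + commGap K n T p)

/-- The factor of the square root of the number of explorations in the regret. -/
def exploreFactor (K n T : ℕ) : ℝ :=
  16 * ((n + 1 : ℕ) : ℝ) * √(Real.log (2 / delta K (n + 1) T) * ((n + 1) * K : ℕ))

theorem commGap_nonneg (K n T p : ℕ) : 0 ≤ commGap K n T p := by
  unfold commGap
  have := eps_nonneg K (n + 1) T 1 p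
  split_ifs <;> positivity

theorem commRegret_nonneg (K n T p : ℕ) : 0 ≤ commRegret K n T p := by
  have h1 := commGap_nonneg K n T p
  have h2 := commGap_nonneg K n T (p - 1)
  unfold commRegret
  positivity

theorem exploreFactor_nonneg (K n T : ℕ) : 0 ≤ exploreFactor K n T := by
  unfold exploreFactor; positivity

theorem commLength_mono {a b : ℕ} (h : a ≤ b) : commLength K n a ≤ commLength K n b := by
  unfold commLength
  gcongr

/-- The regret of a further exploration in epoch `p`, when at most `B (2 ^ (p + 1))` rounds of
exploration have been made at the end of it. -/
theorem explore_regret_le {T p : ℕ} (hL : 0 ≤ Real.log (2 / delta K (n + 1) T)) {x x' : ℝ}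
    (hx : 0 ≤ x) (hxx : x ≤ x') (hx' : x' ≤ ((n + 1) * K : ℕ) * 2 ^ (p + 1)) :
    (x' - x) * (8 * ((n + 1 : ℕ) : ℝ) * eps K (n + 1) T 1 p) ≤
      exploreFactor K n T * (√x' - √x) := by
  -- Since ε_p² = L/2^(p+1) and x' ≤ MK·2^(p+1), the power of two cancels.
  have h1 : eps K (n + 1) T 1 p * √x' ≤
      √(Real.log (2 / delta K (n + 1) T) * ((n + 1) * K : ℕ)) := by
    refine Real.le_sqrt_of_sq_le ?_
    rw [mul_pow, eps_sq hL, Real.sq_sqrt (hx.trans hxx), add_comm 1 p, div_mul_eq_mul_div,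
      div_le_iff₀ (by positivity), mul_assoc]
    gcongr
  -- Bounding the factor √x' + √x by 2√x' turns the factor 8 into 16 and leaves a telescoping
  -- difference.
  have h2 : x' - x = (√x' - √x) * (√x' + √x) := by
    have e1 := Real.mul_self_sqrt hx
    have e2 := Real.mul_self_sqrt (hx.trans hxx)
    nlinarith
  have h3 : √x ≤ √x' := Real.sqrt_le_sqrt hxx
  have h4 := eps_nonneg K (n + 1) T 1 p
  rw [h2, exploreFactor]
  calc (√x' - √x) * (√x' + √x) * (8 * ((n + 1 : ℕ) : ℝ) * eps K (n + 1) T 1 p)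
      ≤ (√x' - √x) * (√x' + √x') * (8 * ((n + 1 : ℕ) : ℝ) * eps K (n + 1) T 1 p) := by
        have := sub_nonneg.2 h3
        gcongr
    _ = 16 * ((n + 1 : ℕ) : ℝ) * (√x' - √x) * (eps K (n + 1) T 1 p * √x') := by ring
    _ ≤ 16 * ((n + 1 : ℕ) : ℝ) * (√x' - √x) *
        √(Real.log (2 / delta K (n + 1) T) * ((n + 1) * K : ℕ)) := by
        have := sub_nonneg.2 h3
        gcongr
    _ = _ := by ring

variable [NeZero K] {rule : ArgmaxRule K} {T : ℕ} {μ : Fin (n + 1) → Fin K → ℝ}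
  {y : ℕ → Fin (n + 1) → Fin K → ℝ} {d : ℕ → Fin (n + 1) → Fin K}
  {S : ℕ → Fin (n + 1) → Prog K Unit}

/-- Induction over the remaining fuel f, after q completed epochs with x rounds of exploration in
total. `hx1` holds since completed epochs explored at least two matchings each; `hx2` says that the
epoch starts at least 4 rounds later than the explorations alone would require; `hx3` sums the
lengths of explorations of at most MK matchings. The potential √T - √x pays for the explorations and
telescopes. It is cut off at 0 since the epoch may start after the horizon. -/
theorem tailSum_epochs_le (hS : IsPlay y d S) (hn : n + 1 ≤ K)
    (hL : 4 ≤ Real.log (2 / delta K (n + 1) T))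
    (h0 : ∀ m k, 0 ≤ μ m k) (hy : ∀ t m k, y t m k ∈ Set.Icc (0 : ℝ) 1)
    (h1 : ∀ m k, μ m k ≤ 1) {πs : Fin (n + 1) → Fin K} (hπs : Function.Injective πs)
    (hmax : weight μ πs = maxUtility μ) {t₁ : ℕ}
    (hgood : ∀ q < T, Concentrates rule T μ y (q + 1) (epochData rule T y t₁ q))
    (f q x : ℕ) (hfq : q + f = T) (hat : AtEpoch rule T 1 S f (q + 1) (epochData rule T y t₁ q))
    (hacc : IsAccurate T μ πs (q + 1) (epochData rule T y t₁ q))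
    (hκ : maxUtility μ - weight μ (epochData rule T y t₁ q).κ ≤ commGap K n T q)
    (hx1 : 2 ^ (q + 2) ≤ x + 4) (hx2 : x + 4 ≤ (epochData rule T y t₁ q).t)
    (hx3 : x + 2 * ((n + 1) * K) ≤ ((n + 1) * K) * 2 ^ (q + 1)) :
    tailSum (fun s => roundRegret μ (armsOf d S s)) T (epochData rule T y t₁ q).t ≤
      ∑ p ∈ Finset.Ico (q + 1) (Nat.log 2 T), commRegret K n T p +
        exploreFactor K n T * max 0 (√T - √x) := by
  induction f generalizing q x with
  | zero =>
    -- With the fuel used up, q = T and the epoch starts no earlier than round 2^(T+2) > T, so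
    -- nothing is left to bound.
    have h2 : T < 2 ^ T := Nat.lt_two_pow_self
    have h3 : 2 ^ T ≤ 2 ^ (q + 2) := Nat.pow_le_pow_right (by norm_num) (by omega)
    rw [tailSum_of_le _ (by omega)]
    have := exploreFactor_nonneg K n T
    have := Finset.sum_nonneg fun p (_ : p ∈ Finset.Ico (q + 1) (Nat.log 2 T)) =>
      commRegret_nonneg K n T p
    positivity
  | succ f ih =>
    set st := epochData rule T y t₁ q with hst
    set ρ := fun s => roundRegret μ (armsOf d S s) with hρ
    have hG := exploreFactor_nonneg K n T
    have hcomm : ∀ a, 0 ≤ ∑ p ∈ Finset.Ico a (Nat.log 2 T), commRegret K n T p := fun a =>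
      Finset.sum_nonneg fun p _ => commRegret_nonneg K n T p
    have hΦ : ∀ z : ℝ, 0 ≤ exploreFactor K n T * max 0 z := fun z => by positivity
    rcases le_or_gt T st.t with hT | hT
    · rw [tailSum_of_le _ hT]
      linarith [hcomm (q + 1), hΦ (√T - √x)]
    -- 2^(q+2) ≤ x + 4 ≤ `st.t` < T: an epoch that starts before the horizon is among those in the
    -- sum.
    have hq : q + 1 < Nat.log 2 T := by
      have : 2 ^ (q + 2) ≤ T := by omega
      have := Nat.le_log_of_pow_le (by norm_num) this
      omega
    rw [Finset.sum_eq_sum_Ico_succ_bot hq]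
    set p := q + 1 with hp
    have hopt : ∀ π, Function.Injective π → weight μ π ≤ weight μ πs := fun π hπ => by
      rw [hmax]; exact weight_le_maxUtility μ hπ
    obtain ⟨-, -, hmsg⟩ := hat.messages hS
    have hlen : (st.cands rule T 1 p).length ≤ (n + 1) * K :=
      (length_candidates_le ..).trans hat.length_le
    have htu : st.t ≤ st.u rule T 1 p := Nat.le_add_right _ _
    have hgap := commGap_nonneg K n T q
    have hgap' := commGap_nonneg K n T p
    -- the messages of the leader
    have r1 : tailSum ρ T st.t ≤ commLength K n ((n + 1) * K) * (2 + commGap K n T q) +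
        tailSum ρ T (st.u rule T 1 p) := by
      have e := tailSum_le (ρ := ρ) (T := T) (b := 2 + commGap K n T q) (by linarith) htu
        (fun s hs1 hs2 => by
          have := roundRegret_le_of_isCommRound h1 hat.inj (hmsg s hs1 hs2)
          simp only [hρ]
          linarith)
      have e2 : ((st.u rule T 1 p : ℕ) : ℝ) - st.t ≤ commLength K n ((n + 1) * K) := by
        have := commLength_mono (K := K) (n := n) hlen
        rw [EpochState.u, Nat.cast_add, add_sub_cancel_left]
        exact_mod_cast this
      have : (((st.u rule T 1 p : ℕ) : ℝ) - st.t) * (2 + commGap K n T q) ≤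
        commLength K n ((n + 1) * K) * (2 + commGap K n T q) := by gcongr
      linarith
    have hcR : commRegret K n T p = commLength K n ((n + 1) * K) * (2 + commGap K n T q) +
        (n * (K * meanBits 1 p) : ℕ) * (2 + commGap K n T p) := rfl
    have hcR2 : 0 ≤ (n * (K * meanBits 1 p) : ℕ) * (2 + commGap K n T p) := by positivity
    by_cases hsing : ∃ π, st.cands rule T 1 p = [π]
    · -- exploitation
      obtain ⟨π, hπ⟩ := hsing
      have hex := hat.exploit hS hπ
      have hππ := hacc.eq_of_singleton hn hπs hopt hπ
      subst hππ
      -- Exploitation is programmed for T rounds, which reaches the horizon, and it uses an optimal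
      -- matching.
      have r2 := tailSum_le (ρ := ρ) (T := T) (b := 0) le_rfl
        (Nat.le_add_right (st.u rule T 1 p) T) (fun s hs1 hs2 => by
          simp only [hρ]
          rw [hex s hs1 hs2, roundRegret_of_injective hπs, hmax]
          simp)
      rw [tailSum_of_le ρ (Nat.le_add_left _ _)] at r2
      linarith [hcomm (p + 1), hΦ (√T - √x)]
    · -- exploration
      have hne : ∀ π, st.cands rule T 1 p ≠ [π] := fun π h => hsing ⟨π, h⟩
      obtain ⟨hat', hexp, hcol⟩ := hat.explore hS hn hne
      have hlen2 := hacc.two_le_length (rule := rule) hn hπs hopt hne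
      set N := (slots 1 p (st.cands rule T 1 p)).length with hN
      have hNlen : N = (st.cands rule T 1 p).length * 2 ^ p := by
        rw [hN, length_slots, pow_one]
      have hv : st.v rule T 1 p = st.u rule T 1 p + N := rfl
      have hρexp : ∀ s, st.u rule T 1 p ≤ s → s < st.v rule T 1 p →
          ρ s ≤ 8 * ((n + 1 : ℕ) : ℝ) * eps K (n + 1) T 1 p := by
        intro s hs1 hs2
        have hmem := hexp s hs1 hs2
        simp only [hρ]
        rw [roundRegret_of_injective (injective_of_mem_candidates rule T 1 hn hmem), ← hmax]
        exact hacc.candidate_le hπs hmem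
      have hB : x + N ≤ (n + 1) * K * 2 ^ (p + 1) := by
        have h2 : N ≤ (n + 1) * K * 2 ^ p := by rw [hNlen]; gcongr
        have h3 : (n + 1) * K * 2 ^ (p + 1) = (n + 1) * K * 2 ^ p + (n + 1) * K * 2 ^ p := by ring
        omega
      have heps := eps_nonneg K (n + 1) T 1 p
      have hL0 : 0 ≤ Real.log (2 / delta K (n + 1) T) := by linarith
      rcases le_or_gt T (st.v rule T 1 p) with hvT | hvT
      · rcases le_or_gt T (st.u rule T 1 p) with huT | huT
        · rw [tailSum_of_le ρ huT] at r1
          linarith [hcomm (p + 1), hΦ (√T - √x)]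
        -- The horizon falls into the exploration, of which only T - u rounds are played; the
        -- potential is used with x' = x + (T - u) ≤ T.
        · have r2 := tailSum_le_of_le (ρ := ρ) (T := T) huT.le le_rfl
            (fun s hs1 hs2 => hρexp s hs1 (by omega))
          rw [tailSum_of_le ρ le_rfl] at r2
          have huT' : ((st.u rule T 1 p : ℕ) : ℝ) ≤ T := by exact_mod_cast huT.le
          have hvT' : (T : ℝ) ≤ st.u rule T 1 p + N := by
            rw [hv] at hvT; exact_mod_cast hvT
          have hB' : ((x : ℝ) + N) ≤ ((n + 1) * K : ℕ) * 2 ^ (p + 1) := by exact_mod_cast hB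
          have r3 := explore_regret_le (K := K) (n := n) (T := T) (p := p) hL0 (x := x)
            (x' := x + (T - st.u rule T 1 p)) (by positivity) (by linarith) (by linarith)
          have hxu : (x : ℝ) ≤ st.u rule T 1 p := by
            have : x ≤ st.u rule T 1 p := by omega
            exact_mod_cast this
          have r4 : √(x + (T - st.u rule T 1 p)) ≤ √T := Real.sqrt_le_sqrt (by linarith)
          have r5 : exploreFactor K n T * (√(x + (T - st.u rule T 1 p)) - √x) ≤
              exploreFactor K n T * max 0 (√T - √x) := by
            refine mul_le_mul_of_nonneg_left (le_trans ?_ (le_max_right _ _)) hG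
            linarith
          rw [add_sub_cancel_left] at r3
          linarith [hcomm (p + 1)]
      · have r2 := tailSum_le_of_le (ρ := ρ) (T := T) (Nat.le_add_right _ N) hvT.le hρexp
        have ht' : (st.next rule T 1 p y).t = st.v rule T 1 p + n * (K * meanBits 1 p) := rfl
        have hbest := hacc.bestMatching_le (rule := rule) hπs
        have hgp : commGap K n T p = 4 * ((n + 1 : ℕ) : ℝ) * eps K (n + 1) T 1 p := by
          rw [commGap, if_neg (by omega)]
        rw [hmax, ← hgp] at hbest
        have r3 := tailSum_le (ρ := ρ) (T := T) (t := st.v rule T 1 p)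
          (t' := (st.next rule T 1 p y).t) (b := 2 + commGap K n T p)
          (by linarith) (by omega) (fun s hs1 hs2 => by
            have := roundRegret_le_of_isCommRound h1 (bestMatching_injective rule hn st.w)
              (hcol s hs1 hs2)
            simp only [hρ]
            linarith)
        rw [ht', Nat.cast_add (st.v rule T 1 p), add_sub_cancel_left, ← ht'] at r3
        have r4 := ih (q + 1) (x + N) (by omega) hat'
          (hacc.next hL hn hπs hopt h0 hy (hgood q (by omega))) hbest
          (by
            -- At least two candidates are explored, which keeps pace with the doubling in `hx1`.
            have : 2 * 2 ^ p ≤ N := by rw [hNlen]; gcongr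
            have e : 2 ^ (q + 1 + 2) = 2 ^ (q + 2) + 2 * 2 ^ p := by rw [hp]; ring
            omega)
          (by
            change x + N + 4 ≤ st.v rule T 1 p + n * (K * meanBits 1 p)
            omega)
          (by
            have h2 : N ≤ (n + 1) * K * 2 ^ p := by rw [hNlen]; gcongr
            have e : (n + 1) * K * 2 ^ (q + 1 + 1) =
              (n + 1) * K * 2 ^ p + (n + 1) * K * 2 ^ p := by rw [hp]; ring
            omega)
        have hB' : ((x : ℝ) + N) ≤ ((n + 1) * K : ℕ) * 2 ^ (p + 1) := by exact_mod_cast hB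
        have r5 := explore_regret_le (K := K) (n := n) (T := T) (p := p) hL0 (x := x)
            (x' := x + N) (by positivity) (by linarith [(Nat.cast_nonneg N : (0 : ℝ) ≤ N)]) hB'
        rw [add_sub_cancel_left] at r5
        have r6 : √((x : ℝ) + N) ≤ √T := by
          refine Real.sqrt_le_sqrt ?_
          have : x + N ≤ T := by omega
          exact_mod_cast this
        have r7 : √(x : ℝ) ≤ √((x : ℝ) + N) :=
          Real.sqrt_le_sqrt (by linarith [(Nat.cast_nonneg N : (0 : ℝ) ≤ N)])
        rw [Nat.cast_add x, max_eq_right (by linarith)] at r4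
        rw [max_eq_right (by linarith)]
        have r2' : (((st.u rule T 1 p + N : ℕ) : ℝ) - st.u rule T 1 p) *
            (8 * ((n + 1 : ℕ) : ℝ) * eps K (n + 1) T 1 p) =
            N * (8 * ((n + 1 : ℕ) : ℝ) * eps K (n + 1) T 1 p) := by
          rw [Nat.cast_add, add_sub_cancel_left]
        rw [r2', ← hv] at r2
        have r4' : tailSum ρ T (st.next rule T 1 p y).t ≤
            ∑ p ∈ Finset.Ico (p + 1) (Nat.log 2 T), commRegret K n T p +
              exploreFactor K n T * (√T - √(x + N)) := r4
        -- The exploration pays √(x+N) - √x, the induction hypothesis pays √T - √(x+N).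
        nlinarith

/-- The regret of a game in which the initialization succeeds and the explorations are
representative. -/
theorem tailSum_zero_le (hS : IsPlay y d S) (hn : n + 1 ≤ K)
    (hL : 4 ≤ Real.log (2 / delta K (n + 1) T))
    (h0 : ∀ m k, 0 ≤ μ m k) (h1 : ∀ m k, μ m k ≤ 1) (hy : ∀ t m k, y t m k ∈ Set.Icc (0 : ℝ) 1)
    {t₁ : ℕ} (ht₁ : 4 ≤ t₁)
    (hgood : ∀ q < T, Concentrates rule T μ y (q + 1) (epochData rule T y t₁ q))
    (hat : AtEpoch rule T 1 S T 1 (EpochState.init n t₁)) :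
    tailSum (fun s => roundRegret μ (armsOf d S s)) T 0 ≤ t₁ * ((n + 1 : ℕ) : ℝ) +
      ∑ p ∈ Finset.Ico 1 (Nat.log 2 T), commRegret K n T p + exploreFactor K n T * √T := by
  obtain ⟨πs, hπs, hmax⟩ := exists_weight_eq_maxUtility hn μ
  have r1 := tailSum_le (ρ := fun s => roundRegret μ (armsOf d S s)) (T := T)
    (b := ((n + 1 : ℕ) : ℝ)) (by positivity) (Nat.zero_le t₁)
    (fun s _ _ => roundRegret_le hn h0 h1 _)
  have hgap : maxUtility μ - weight μ (EpochState.init (K := K) n t₁).κ ≤ commGap K n T 0 := by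
    have : 0 ≤ weight μ (EpochState.init (K := K) n t₁).κ := Finset.sum_nonneg fun m _ => h0 _ _
    have := maxUtility_le hn h1
    rw [commGap, if_pos rfl]
    linarith
  -- At the start q = x = 0: `hx1` and `hx3` are equalities, and `hx2` is the assumption that the
  -- initialization takes at least 4 rounds.
  have r2 := tailSum_epochs_le hS hn hL h0 hy h1 hπs hmax hgood T 0 0 (by omega) hat
    (isAccurate_init hL t₁ h0 h1) hgap (by norm_num) (by simpa [epochData, EpochState.init] using ht₁)
    (by ring_nf; exact le_refl _)
  have e : (epochData rule T y t₁ 0).t = t₁ := rfl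
  rw [e] at r2
  simp only [Nat.cast_zero, Real.sqrt_zero, sub_zero, zero_add] at r1 r2
  rw [max_eq_right (Real.sqrt_nonneg _)] at r2
  linarith

end Epochs

/-! ### Summation of the bounds -/

section Arith

variable {K n T : ℕ}

theorem log_two_div_delta (K M T : ℕ) :
    Real.log (2 / delta K M T) = Real.log (2 * (M : ℝ) ^ 2 * K * (T : ℝ) ^ 2) := by
  rw [delta, div_div_eq_mul_div, div_one]
  congr 1
  ring

/-- 2·1·2·25 = 100 exceeds e⁴. This requirement singles out the cases K = 1 and T ≤ 4. -/
theorem four_le_log_two_div_delta (hK : 2 ≤ K) (hT : 5 ≤ T) :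
    4 ≤ Real.log (2 / delta K (n + 1) T) := by
  have h1 : Real.exp 4 ≤ 100 := by
    have h := Real.exp_one_lt_d9
    have e : Real.exp 4 = Real.exp 1 ^ 4 := by rw [← Real.exp_nat_mul]; norm_num
    rw [e]
    have h0 := Real.exp_pos 1
    calc Real.exp 1 ^ 4 ≤ 2.7182818286 ^ 4 := by gcongr
      _ ≤ 100 := by norm_num
  have h2 : (100 : ℝ) ≤ 2 * ((n + 1 : ℕ) : ℝ) ^ 2 * K * (T : ℝ) ^ 2 := by
    have e1 : (1 : ℝ) ≤ ((n + 1 : ℕ) : ℝ) := by push_cast; linarith [(Nat.cast_nonneg n : (0:ℝ) ≤ n)]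
    have e2 : (2 : ℝ) ≤ K := by exact_mod_cast hK
    have e3 : (5 : ℝ) ≤ T := by exact_mod_cast hT
    calc (100 : ℝ) = 2 * 1 ^ 2 * 2 * 5 ^ 2 := by norm_num
      _ ≤ _ := by gcongr
  rw [log_two_div_delta, Real.le_log_iff_exp_le (by linarith)]
  linarith

/-- The exact ratio is 1/√2; a rational upper bound keeps the later sums within linear arithmetic.
-/
theorem eps_succ_le (hL : 0 ≤ Real.log (2 / delta K (n + 1) T)) (p : ℕ) :
    eps K (n + 1) T 1 (p + 1) ≤ 7072 / 10000 * eps K (n + 1) T 1 p := by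
  have h1 := eps_succ_sq hL p
  have h2 := eps_nonneg K (n + 1) T 1 p
  refine le_of_sq_le_sq ?_ (by positivity)
  nlinarith [sq_nonneg (eps K (n + 1) T 1 p)]

theorem eps_one (hL : 0 ≤ Real.log (2 / delta K (n + 1) T)) :
    eps K (n + 1) T 1 1 = √(Real.log (2 / delta K (n + 1) T)) / 2 := by
  rw [eps, pow_one, Real.sqrt_div hL]
  congr 1
  rw [show (2 : ℝ) ^ (1 + 1) = 2 ^ 2 by norm_num, Real.sqrt_sq (by norm_num)]

/-- A geometric series starting at ε_1 = √L/2 with 1/(1 - 1/√2) ≤ 7/2. The induction carries the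
remaining tail (7/2)ε_(N+1) along. -/
theorem sum_eps_le (hL : 0 ≤ Real.log (2 / delta K (n + 1) T)) (N : ℕ) :
    ∑ p ∈ Finset.Ico 1 N, eps K (n + 1) T 1 p ≤
      7 / 4 * √(Real.log (2 / delta K (n + 1) T)) := by
  have key : ∀ N, ∑ p ∈ Finset.Ico 1 (N + 1), eps K (n + 1) T 1 p +
      7 / 2 * eps K (n + 1) T 1 (N + 1) ≤ 7 / 2 * eps K (n + 1) T 1 1 := by
    intro N
    induction N with
    | zero => simp
    | succ N ih =>
      rw [Finset.sum_Ico_succ_top (by omega)]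
      have h1 := eps_succ_le hL (N + 1)
      have h2 := eps_nonneg K (n + 1) T 1 (N + 1)
      linarith
  rcases N with _ | N
  · simp only [zero_le_one, Finset.Ico_eq_empty_of_le, Finset.sum_empty]
    positivity
  · have h1 := key N
    have h2 := eps_nonneg K (n + 1) T 1 (N + 1)
    rw [eps_one hL] at h1
    linarith

/-- With r = 1/√2 the sum over p ≥ 1 of (p+2)r^(p-1) equals 1/(1-r)² + 2/(1-r) < 39/2. The linear
weight (7/2)p + 16 of ε_p dominates the tail from p on; at p = 1 it is 39/2. -/
theorem sum_mul_eps_le (hL : 0 ≤ Real.log (2 / delta K (n + 1) T)) (N : ℕ) :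
    ∑ p ∈ Finset.Ico 1 N, ((p : ℝ) + 2) * eps K (n + 1) T 1 p ≤
      39 / 4 * √(Real.log (2 / delta K (n + 1) T)) := by
  have key : ∀ N : ℕ, ∑ p ∈ Finset.Ico 1 (N + 1), ((p : ℝ) + 2) * eps K (n + 1) T 1 p +
      (7 / 2 * ((N + 1 : ℕ) : ℝ) + 16) * eps K (n + 1) T 1 (N + 1) ≤
        39 / 2 * eps K (n + 1) T 1 1 := by
    intro N
    induction N with
    | zero => simp; linarith
    | succ N ih =>
      rw [Finset.sum_Ico_succ_top (by omega)]
      have h1 := eps_succ_le hL (N + 1)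
      have h2 := eps_nonneg K (n + 1) T 1 (N + 1)
      have h3 : (0 : ℝ) ≤ N := Nat.cast_nonneg N
      push_cast at ih ⊢
      have h4 : (7 / 2 * ((N : ℝ) + 1 + 1) + 16) * eps K (n + 1) T 1 (N + 1 + 1) ≤
          (7 / 2 * ((N : ℝ) + 1 + 1) + 16) * (7072 / 10000 * eps K (n + 1) T 1 (N + 1)) := by
        gcongr
      nlinarith [mul_nonneg h3 h2]
  rcases N with _ | N
  · simp only [zero_le_one, Finset.Ico_eq_empty_of_le, Finset.sum_empty]
    positivity
  · have h1 := key N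
    have h2 := eps_nonneg K (n + 1) T 1 (N + 1)
    rw [eps_one hL] at h1
    have h3 : 0 ≤ (7 / 2 * ((N + 1 : ℕ) : ℝ) + 16) * eps K (n + 1) T 1 (N + 1) := by positivity
    linarith

/-- Rounding up costs at most a factor 3/2: for K ≥ 4 the number of bits b satisfies 4^b ≤ 4K² ≤ K³,
and K = 2, 3 are checked directly. -/
theorem armBits_le (hK : 2 ≤ K) : (armBits K : ℝ) ≤ 3 / 2 * Real.logb 2 K := by
  have h1 : 4 ^ armBits K ≤ K ^ 3 := by
    by_cases h4 : 4 ≤ K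
    · have h : 2 ^ (armBits K - 1) < K :=
        Nat.pow_pred_clog_lt_self (by norm_num) (by omega)
      have hpos : 0 < armBits K := Nat.clog_pos (by norm_num) hK
      have e : 2 ^ armBits K = 2 * 2 ^ (armBits K - 1) := by
        rw [← pow_succ']; congr 1; omega
      have : 4 ^ armBits K = (2 ^ armBits K) ^ 2 := by
        rw [← pow_mul, mul_comm, pow_mul]; norm_num
      rw [this, e]
      calc (2 * 2 ^ (armBits K - 1)) ^ 2 ≤ (2 * K) ^ 2 := by gcongr
        _ = 4 * K ^ 2 := by ring
        _ ≤ K * K ^ 2 := by gcongr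
        _ = K ^ 3 := by ring
    · interval_cases K <;> decide
  have hK0 : (0 : ℝ) < K := by exact_mod_cast (by omega : 0 < K)
  have h2 : (2 : ℝ) ^ (2 * armBits K) ≤ (K : ℝ) ^ 3 := by
    rw [pow_mul]
    norm_num
    exact_mod_cast h1
  have h3 := Real.logb_le_logb_of_le (b := 2) (by norm_num) (by positivity) h2
  rw [Real.logb_pow, Real.logb_pow, Real.logb_self_eq_one (by norm_num)] at h3
  push_cast at h3
  linarith

theorem sizeBits_le (hn : n + 1 ≤ K) : sizeBits K (n + 1) ≤ 2 * armBits K + 1 := by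
  refine Nat.clog_le_of_le_pow ?_
  have h1 : K ≤ 2 ^ armBits K := Nat.le_pow_clog (by norm_num) K
  have h2 : (n + 1) * K ≤ 2 ^ armBits K * 2 ^ armBits K := by
    gcongr
    omega
  have e : 2 ^ (2 * armBits K + 1) = 2 ^ armBits K * 2 ^ armBits K + 2 ^ armBits K * 2 ^ armBits K := by
    rw [pow_succ, pow_mul']; ring
  have h3 : 0 < 2 ^ armBits K * 2 ^ armBits K := by positivity
  omega

/-- For K ≥ 5 the count with M - 1 followers is at most M²K times `armBits`, because (M-1)(MK+5) ≤
M²K. -/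
theorem commLength_le (hn : n + 1 ≤ K) (hK : 2 ≤ K) :
    (commLength K n ((n + 1) * K) : ℝ) ≤
      3 / 2 * (((n + 1 : ℕ) : ℝ) ^ 2 * K * Real.logb 2 K) := by
  by_cases h2 : K = 2
  · subst h2
    have hl : Real.logb 2 ((2 : ℕ) : ℝ) = 1 := by
      simp [Real.logb_self_eq_one]
    rw [hl]
    have : n = 0 ∨ n = 1 := by omega
    rcases this with rfl | rfl
    · have : commLength 2 0 ((0 + 1) * 2) = 0 := by simp [commLength]
      rw [this]; norm_num
    -- For M = K = 2 the bound by M²K·`armBits` = 8 fails, but the factor 3/2, not needed for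
    -- rounding here, leaves room for 9.
    · have : commLength 2 1 ((1 + 1) * 2) = 9 := by decide
      rw [this]; norm_num
  · have key : commLength K n ((n + 1) * K) ≤ (n + 1) ^ 2 * K * armBits K := by
      by_cases h5 : 5 ≤ K
      · have hs := sizeBits_le hn
        have hl : 1 ≤ armBits K := Nat.clog_pos (by norm_num) hK
        unfold commLength
        calc n * sizeBits K (n + 1) + n * (((n + 1) * K + 2) * armBits K)
            ≤ n * (3 * armBits K) + n * (((n + 1) * K + 2) * armBits K) := by
              gcongr; omega
          _ = (n * ((n + 1) * K + 5)) * armBits K := by ring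
          _ ≤ ((n + 1) ^ 2 * K) * armBits K := by
              refine Nat.mul_le_mul_right _ ?_
              nlinarith [Nat.mul_le_mul_left (n + 1) h5]
      · have : n < 4 := by omega
        have : K = 3 ∨ K = 4 := by omega
        rcases this with rfl | rfl <;> interval_cases n <;> decide
    have h3 := armBits_le hK
    calc (commLength K n ((n + 1) * K) : ℝ) ≤ ((n + 1) ^ 2 * K * armBits K : ℕ) := by
          exact_mod_cast key
      _ = ((n + 1 : ℕ) : ℝ) ^ 2 * K * armBits K := by push_cast; ring
      _ ≤ ((n + 1 : ℕ) : ℝ) ^ 2 * K * (3 / 2 * Real.logb 2 K) := by gcongr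
      _ = _ := by ring

/-- The constant 17 dominates 45/4 for the messages of the leader plus 39/8 for those of the
followers. In the leading terms, ⌊lg T⌋ - 1 epochs with loss 2 per round give 3M²K lg K lg T, and
the bit lengths (p+2)/2 sum to the term with lg²T. -/
theorem sum_commRegret_le (hn : n + 1 ≤ K) (hK : 2 ≤ K) (hT : 4 ≤ T)
    (hL : 4 ≤ Real.log (2 / delta K (n + 1) T)) :
    ∑ p ∈ Finset.Ico 1 (Nat.log 2 T), commRegret K n T p ≤
      3 * ((n + 1 : ℕ) : ℝ) ^ 2 * K * Real.logb 2 K * Real.logb 2 T +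
        ((n + 1 : ℕ) : ℝ) * K * (Real.logb 2 T) ^ 2 +
        17 * ((n + 1 : ℕ) : ℝ) ^ 3 * K * Real.logb 2 K *
          √(Real.log (2 / delta K (n + 1) T)) := by
  have hL0 : 0 ≤ Real.log (2 / delta K (n + 1) T) := by linarith
  set s := √(Real.log (2 / delta K (n + 1) T)) with hs
  set M : ℝ := ((n + 1 : ℕ) : ℝ) with hM
  have hs2 : 2 ≤ s := by
    rw [hs]
    refine Real.le_sqrt_of_sq_le ?_
    linarith
  obtain ⟨H, hH⟩ : ∃ H, Nat.log 2 T = H + 2 := by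
    have : 2 ≤ Nat.log 2 T := Nat.le_log_of_pow_le (by norm_num) (by omega)
    exact ⟨Nat.log 2 T - 2, by omega⟩
  have hlgT : (H : ℝ) + 2 ≤ Real.logb 2 T := by
    have h1 : 2 ^ Nat.log 2 T ≤ T := Nat.pow_log_le_self 2 (by omega)
    have h2 : (2 : ℝ) ^ (H + 2) ≤ T := by rw [← hH]; exact_mod_cast h1
    have h3 := Real.logb_le_logb_of_le (b := 2) (by norm_num) (by positivity) h2
    rw [Real.logb_pow, Real.logb_self_eq_one (by norm_num)] at h3
    push_cast at h3
    linarith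
  have hlgK : 1 ≤ Real.logb 2 K := by
    have h2 : (2 : ℝ) ≤ K := by exact_mod_cast hK
    have h3 := Real.logb_le_logb_of_le (b := 2) (by norm_num) (by positivity) h2
    rwa [Real.logb_self_eq_one (by norm_num)] at h3
  have hA := commLength_le hn hK
  have hM1 : 1 ≤ M := by rw [hM]; push_cast; linarith [(Nat.cast_nonneg n : (0 : ℝ) ≤ n)]
  have hnM : (n : ℝ) = M - 1 := by rw [hM]; push_cast; ring
  have hH0 : (0 : ℝ) ≤ H := Nat.cast_nonneg H
  have hK0 : (0 : ℝ) ≤ K := Nat.cast_nonneg K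
  rw [hH]
  simp only [commRegret]
  rw [Finset.sum_add_distrib, ← Finset.mul_sum]
  -- the messages of the leader
  have e1 : ∑ p ∈ Finset.Ico 1 (H + 2), (2 + commGap K n T (p - 1)) ≤
      2 * (H + 1) + 15 / 2 * M * s := by
    rw [Finset.sum_add_distrib, Finset.sum_const, Nat.card_Ico, nsmul_eq_mul,
      Finset.sum_eq_sum_Ico_succ_bot (by omega)]
    have h1 : ∑ p ∈ Finset.Ico (1 + 1) (H + 2), commGap K n T (p - 1) ≤ 4 * M * (7 / 4 * s) := by
      calc ∑ p ∈ Finset.Ico (1 + 1) (H + 2), commGap K n T (p - 1)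
          = ∑ p ∈ Finset.Ico 1 (H + 1), commGap K n T p := by
            rw [← Finset.sum_Ico_add' (fun p => commGap K n T (p - 1)) 1 (H + 1) 1]
            rfl
        _ = ∑ p ∈ Finset.Ico 1 (H + 1), 4 * M * eps K (n + 1) T 1 p := by
            refine Finset.sum_congr rfl fun p hp => ?_
            rw [Finset.mem_Ico] at hp
            rw [commGap, if_neg (by omega)]
        _ ≤ _ := by
            rw [← Finset.mul_sum]
            have := sum_eps_le hL0 (H + 1)
            gcongr
    have h2 : commGap K n T (1 - 1) = M := by simp [commGap, hM]
    rw [h2]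
    have h3 : ((H + 2 - 1 : ℕ) : ℝ) = H + 1 := by
      rw [show H + 2 - 1 = H + 1 by omega]; push_cast; ring
    rw [h3]
    -- The initial gap M is absorbed into Ms/2 since s ≥ 2, which turns 7 into 15/2.
    nlinarith
  have e2 : (commLength K n ((n + 1) * K) : ℝ) *
      ∑ p ∈ Finset.Ico 1 (H + 2), (2 + commGap K n T (p - 1)) ≤
      3 * M ^ 2 * K * Real.logb 2 K * Real.logb 2 T +
        45 / 4 * (M ^ 3 * K * Real.logb 2 K * s) := by
    have hX : 0 ≤ M ^ 2 * K * Real.logb 2 K := by positivity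
    calc _ ≤ (3 / 2 * (M ^ 2 * K * Real.logb 2 K)) * (2 * (H + 1) + 15 / 2 * M * s) := by
          gcongr
          exact Finset.sum_nonneg fun p _ => by linarith [commGap_nonneg K n T (p - 1)]
      _ = 3 * (M ^ 2 * K * Real.logb 2 K) * (H + 1) + 45 / 4 * (M ^ 3 * K * Real.logb 2 K * s) := by
          ring
      _ ≤ 3 * (M ^ 2 * K * Real.logb 2 K) * Real.logb 2 T +
          45 / 4 * (M ^ 3 * K * Real.logb 2 K * s) := by
          gcongr; linarith
      _ = _ := by ring
  -- the messages of the followers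
  have e3 : ∑ p ∈ Finset.Ico 1 (H + 2),
      ((n * (K * meanBits 1 p) : ℕ) : ℝ) * (2 + commGap K n T p) ≤
      M * K * (Real.logb 2 T) ^ 2 + 39 / 8 * (M ^ 3 * K * Real.logb 2 K * s) := by
    have h1 : ∀ p ∈ Finset.Ico 1 (H + 2),
        ((n * (K * meanBits 1 p) : ℕ) : ℝ) * (2 + commGap K n T p) ≤
        (M - 1) * K * ((p : ℝ) + 2) + 2 * M * (M - 1) * K * (((p : ℝ) + 2) * eps K (n + 1) T 1 p) := by
      intro p hp
      rw [Finset.mem_Ico] at hp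
      rw [commGap, if_neg (by omega)]
      have hb : (meanBits 1 p : ℝ) ≤ ((p : ℝ) + 2) / 2 := by
        rw [le_div_iff₀ (by norm_num)]
        have : meanBits 1 p * 2 ≤ p + 2 := by simp only [meanBits, pow_one]; omega
        exact_mod_cast this
      have heps := eps_nonneg K (n + 1) T 1 p
      push_cast
      rw [hnM]
      have hM0 : 0 ≤ M - 1 := by linarith
      calc (M - 1) * (K * (meanBits 1 p : ℝ)) * (2 + 4 * (M - 1 + 1) * eps K (n + 1) T 1 p)
          ≤ (M - 1) * (K * (((p : ℝ) + 2) / 2)) * (2 + 4 * (M - 1 + 1) * eps K (n + 1) T 1 p) := by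
            gcongr
        _ = _ := by ring
    refine (Finset.sum_le_sum h1).trans ?_
    rw [Finset.sum_add_distrib, ← Finset.mul_sum, ← Finset.mul_sum]
    have h2 : ∑ p ∈ Finset.Ico 1 (H + 2), ((p : ℝ) + 2) ≤ (Real.logb 2 T) ^ 2 := by
      have h3 : ∀ H : ℕ, ∑ p ∈ Finset.Ico 1 (H + 2), ((p : ℝ) + 2) = ((H : ℝ) + 1) * (H + 6) / 2 := by
        intro H
        induction H with
        | zero => norm_num
        | succ H ih =>
          rw [Finset.sum_Ico_succ_top (by omega), ih]
          push_cast
          ring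
      rw [h3]
      nlinarith
    have h4 := sum_mul_eps_le hL0 (H + 2)
    have hM0 : 0 ≤ M - 1 := by linarith
    have h5 : (M - 1) * K * ∑ p ∈ Finset.Ico 1 (H + 2), ((p : ℝ) + 2) ≤
        M * K * (Real.logb 2 T) ^ 2 := by
      gcongr
      linarith
    have h6 : 2 * M * (M - 1) * K * ∑ p ∈ Finset.Ico 1 (H + 2), ((p : ℝ) + 2) * eps K (n + 1) T 1 p ≤
        39 / 8 * (M ^ 3 * K * Real.logb 2 K * s) := by
      calc _ ≤ 2 * M * (M - 1) * K * (39 / 4 * s) := by gcongr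
        _ = 39 / 8 * (M * (4 * (M - 1)) * K * 1 * s) := by ring
        -- 4(M - 1) ≤ M² and 1 ≤ lg K.
        _ ≤ 39 / 8 * (M * M ^ 2 * K * Real.logb 2 K * s) := by
            gcongr
            nlinarith [sq_nonneg (M - 2)]
        _ = _ := by ring
    linarith
  have hX : 0 ≤ M ^ 3 * K * Real.logb 2 K * s := by positivity
  linarith

theorem initLength_le (hK : 1 ≤ K) (hT : 1 ≤ T) :
    (initLength K T : ℝ) ≤ K * Real.log (Real.exp 2 * (K : ℝ) ^ 2 * T) := by
  have hK' : (1 : ℝ) ≤ K := by exact_mod_cast hK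
  have hT' : (1 : ℝ) ≤ T := by exact_mod_cast hT
  have e1 : (K : ℝ) / (1 / ((K : ℝ) * T)) = (K : ℝ) ^ 2 * T := by
    rw [div_div_eq_mul_div, div_one]; ring
  have h1 : 0 ≤ Real.log ((K : ℝ) ^ 2 * T) := Real.log_nonneg (by nlinarith)
  have e2 : Real.log (Real.exp 2 * (K : ℝ) ^ 2 * T) = 2 + Real.log ((K : ℝ) ^ 2 * T) := by
    rw [mul_assoc, Real.log_mul (Real.exp_ne_zero _) (by positivity), Real.log_exp]
  have h2 := Nat.ceil_lt_add_one (a := (K : ℝ) * Real.log ((K : ℝ) ^ 2 * T)) (by positivity)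
  rw [initLength, chairsLength, e1, e2]
  have h3 : ((2 * K - 2 : ℕ) : ℝ) = 2 * K - 2 := by
    rw [Nat.cast_sub (by omega)]; push_cast; ring
  push_cast
  rw [h3]
  linarith

/-- Supplies the offset 4 in the count of epochs: musical chairs take at least two rounds since 2 ln
2 > 1, and the ranking at least 2K - 2 ≥ 2. -/
theorem four_le_initLength (hK : 2 ≤ K) (hT : 1 ≤ T) : 4 ≤ initLength K T := by
  have hK' : (2 : ℝ) ≤ K := by exact_mod_cast hK
  have hT' : (1 : ℝ) ≤ T := by exact_mod_cast hT
  have e1 : (K : ℝ) / (1 / ((K : ℝ) * T)) = (K : ℝ) ^ 2 * T := by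
    rw [div_div_eq_mul_div, div_one]; ring
  have h1 : 1 < (K : ℝ) * Real.log ((K : ℝ) ^ 2 * T) := by
    have h2 : Real.log 2 ≤ Real.log ((K : ℝ) ^ 2 * T) :=
      Real.log_le_log (by norm_num) (by nlinarith)
    have h3 := Real.log_two_gt_d9
    nlinarith
  have h2 : 1 < ⌈(K : ℝ) * Real.log ((K : ℝ) ^ 2 * T)⌉₊ := by
    rw [Nat.lt_ceil]; exact_mod_cast h1
  rw [initLength, chairsLength, e1]
  omega

theorem exploreFactor_mul_sqrt_le :
    exploreFactor K n T * √T ≤ 8 / (√2 - 1) * (K : ℝ) ^ (1 / 2 : ℝ) *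
      ((n + 1 : ℕ) : ℝ) ^ (3 / 2 : ℝ) * √(T * Real.log (2 / delta K (n + 1) T)) := by
  set L := Real.log (2 / delta K (n + 1) T)
  set M : ℝ := ((n + 1 : ℕ) : ℝ) with hM
  have hM0 : 0 < M := by positivity
  have h2 : (1.4 : ℝ) < √2 := by
    rw [Real.lt_sqrt (by norm_num)]; norm_num
  have h2' : √2 < 1.5 := by
    rw [Real.sqrt_lt' (by norm_num)]; norm_num
  have e1 : exploreFactor K n T * √T = 16 * (√K * (M * √M) * √(T * L)) := by
    unfold exploreFactor
    have : ((((n + 1) * K : ℕ) : ℕ) : ℝ) = M * K := by rw [hM]; push_cast; ring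
    rw [this, Real.sqrt_mul' _ (by positivity), Real.sqrt_mul hM0.le, Real.sqrt_mul (by positivity)]
    ring
  have e2 : M ^ (3 / 2 : ℝ) = M * √M := by
    rw [Real.sqrt_eq_rpow, show (3 / 2 : ℝ) = 1 + 1 / 2 by norm_num, Real.rpow_add hM0,
      Real.rpow_one]
  rw [e1, e2, ← Real.sqrt_eq_rpow]
  -- Equivalent to √2 ≤ 3/2.
  have h3 : 16 ≤ 8 / (√2 - 1) := by
    rw [le_div_iff₀ (by linarith)]; linarith
  calc 16 * (√K * (M * √M) * √(T * L)) ≤ 8 / (√2 - 1) * (√K * (M * √M) * √(T * L)) := by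
        gcongr
    _ = _ := by ring

/-- The bound of the theorem. -/
def regretBound (K M T : ℕ) : ℝ :=
  2 + M * K * Real.log (Real.exp 2 * (K : ℝ) ^ 2 * T)
    + 3 * (M : ℝ) ^ 2 * K * Real.logb 2 K * Real.logb 2 T
    + M * K * (Real.logb 2 T) ^ 2
    + (4 * √2 - 2) / (3 - 2 * √2) * (M : ℝ) ^ 3 * K * Real.logb 2 K
        * √(Real.log (2 * (M : ℝ) ^ 2 * K * (T : ℝ) ^ 2))
    + 8 / (√2 - 1) * (K : ℝ) ^ (1 / 2 : ℝ) * (M : ℝ) ^ (3 / 2 : ℝ)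
        * √(T * Real.log (2 * (M : ℝ) ^ 2 * K * (T : ℝ) ^ 2))

theorem seventeen_le_const : 17 ≤ (4 * √2 - 2) / (3 - 2 * √2) := by
  have h2 : (1.41 : ℝ) < √2 := by
    rw [Real.lt_sqrt (by norm_num)]; norm_num
  have h2' : √2 < 1.42 := by
    rw [Real.sqrt_lt' (by norm_num)]; norm_num
  rw [le_div_iff₀ (by linarith)]
  linarith

theorem logb_two_natCast_nonneg (a : ℕ) : 0 ≤ Real.logb 2 (a : ℝ) := by
  rcases Nat.eq_zero_or_pos a with rfl | h
  · simp
  · exact Real.logb_nonneg (by norm_num) (by exact_mod_cast h)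

/-- The summand 2 on the left is kept in reserve for the bad event. -/
theorem le_regretBound (hn : n + 1 ≤ K) (hK : 2 ≤ K) (hT : 5 ≤ T) :
    initLength K T * ((n + 1 : ℕ) : ℝ) + ∑ p ∈ Finset.Ico 1 (Nat.log 2 T), commRegret K n T p +
      exploreFactor K n T * √T + 2 ≤ regretBound K (n + 1) T := by
  have hL := four_le_log_two_div_delta (n := n) hK hT
  have h1 := initLength_le (K := K) (T := T) (by omega) (by omega)
  have h2 := sum_commRegret_le hn hK (by omega) hL
  have h3 := exploreFactor_mul_sqrt_le (K := K) (n := n) (T := T)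
  have h4 : initLength K T * ((n + 1 : ℕ) : ℝ) ≤
      ((n + 1 : ℕ) : ℝ) * K * Real.log (Real.exp 2 * (K : ℝ) ^ 2 * T) := by
    rw [mul_comm, mul_assoc]
    gcongr
  have hlg := logb_two_natCast_nonneg K
  have h5 : 17 * ((n + 1 : ℕ) : ℝ) ^ 3 * K * Real.logb 2 K *
        √(Real.log (2 / delta K (n + 1) T)) ≤
      (4 * √2 - 2) / (3 - 2 * √2) * ((n + 1 : ℕ) : ℝ) ^ 3 * K * Real.logb 2 K *
        √(Real.log (2 / delta K (n + 1) T)) := by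
    have := seventeen_le_const
    gcongr
  rw [log_two_div_delta] at h2 h3 h5
  unfold regretBound
  linarith

/-- Already the initialization term is at least 2MK, by the factor e² in the logarithm. This settles
small T and the nonnegativity of the bound. -/
theorem regretBound_ge (M : ℕ) (hK : 1 ≤ K) (hT : 1 ≤ T) :
    2 + 2 * (M * K : ℝ) ≤ regretBound K M T := by
  have h2 : (1.41 : ℝ) < √2 := by
    rw [Real.lt_sqrt (by norm_num)]; norm_num
  have h17 := seventeen_le_const
  have hlg := logb_two_natCast_nonneg K
  have hlgT := logb_two_natCast_nonneg T
  have hK' : (1 : ℝ) ≤ K := by exact_mod_cast hK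
  have hT' : (1 : ℝ) ≤ T := by exact_mod_cast hT
  have h1 : 2 ≤ Real.log (Real.exp 2 * (K : ℝ) ^ 2 * T) := by
    rw [mul_assoc, Real.log_mul (Real.exp_ne_zero _) (by positivity), Real.log_exp]
    have := Real.log_nonneg (x := (K : ℝ) ^ 2 * T) (by nlinarith)
    linarith
  have h3 : (M * K : ℝ) * 2 ≤ M * K * Real.log (Real.exp 2 * (K : ℝ) ^ 2 * T) := by gcongr
  have h4 : 0 ≤ (4 * √2 - 2) / (3 - 2 * √2) * (M : ℝ) ^ 3 * K * Real.logb 2 K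
        * √(Real.log (2 * (M : ℝ) ^ 2 * K * (T : ℝ) ^ 2)) := by positivity
  have h5 : 0 ≤ 8 / (√2 - 1) * (K : ℝ) ^ (1 / 2 : ℝ) * (M : ℝ) ^ (3 / 2 : ℝ)
        * √(T * Real.log (2 * (M : ℝ) ^ 2 * K * (T : ℝ) ^ 2)) := by
    have : 0 < √2 - 1 := by linarith
    positivity
  have h6 : 0 ≤ 3 * (M : ℝ) ^ 2 * K * Real.logb 2 K * Real.logb 2 T := by positivity
  have h7 : 0 ≤ M * K * (Real.logb 2 T) ^ 2 := by positivity
  unfold regretBound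
  linarith

end Arith

/-! ### Measurability of the play -/

/-- A map all of whose preimages are measurable. -/
def FibMeas {X ι : Type*} [MeasurableSpace X] (Z : X → ι) : Prop := Measurable[_, ⊤] Z

section FibMeas

variable {X ι β : Type*} [MeasurableSpace X]

theorem FibMeas.measurableSet {Z : X → ι} (h : FibMeas Z) (s : Set ι) :
    MeasurableSet (Z ⁻¹' s) := h trivial

theorem FibMeas.map {Z : X → ι} (h : FibMeas Z) (f : ι → β) : FibMeas fun x => f (Z x) :=
  fun s _ => h.measurableSet (f ⁻¹' s)

theorem FibMeas.measurable {Z : X → ι} [MeasurableSpace ι] (h : FibMeas Z) : Measurable Z :=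
  fun s _ => h.measurableSet s

theorem fibMeas_of_measurable [Countable ι] [MeasurableSpace ι] [MeasurableSingletonClass ι]
    {Z : X → ι} (h : Measurable Z) : FibMeas Z := fun s _ => h s.to_countable.measurableSet

theorem fibMeas_const (i : ι) : FibMeas fun _ : X => i := fun s _ => MeasurableSet.const (i ∈ s)

/-- The fibres of `Z` form a countable measurable partition, on each of which the map is one of the
`g i`. This handles data such as lists that come without a σ-algebra. -/
theorem FibMeas.glue [Countable ι] {Z : X → ι} (hZ : FibMeas Z) [MeasurableSpace β]
    {g : ι → X → β} (hg : ∀ i, Measurable (g i)) : Measurable fun x => g (Z x) x := by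
  intro s hs
  have : (fun x => g (Z x) x) ⁻¹' s = ⋃ i, Z ⁻¹' {i} ∩ g i ⁻¹' s := by
    ext x
    simp
  rw [this]
  exact MeasurableSet.iUnion fun i => (hZ.measurableSet _).inter (hg i hs)

theorem FibMeas.glue_fibMeas [Countable ι] {Z : X → ι} (hZ : FibMeas Z)
    {g : ι → X → β} (hg : ∀ i, FibMeas (g i)) : FibMeas fun x => g (Z x) x :=
  @FibMeas.glue X ι β _ _ Z hZ ⊤ g hg

theorem FibMeas.comp {W : Type*} [MeasurableSpace W] {Z : X → ι} (hZ : FibMeas Z) {h : W → X}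
    (hh : Measurable h) : FibMeas fun w => Z (h w) :=
  fun s _ => hh (hZ.measurableSet s)

theorem FibMeas.prodMk {κ : Type*} [Countable ι] {Z : X → ι} {Z' : X → κ} (hZ : FibMeas Z)
    (hZ' : FibMeas Z') : FibMeas fun x => (Z x, Z' x) :=
  hZ.glue_fibMeas (g := fun i x => (i, Z' x)) fun i => hZ'.map (Prod.mk i)

end FibMeas

/-! ### Measurable families of programs. -/

section MeasProg

variable {K : ℕ}

/-- A measurable family of programs. -/
inductive MeasProg {α : Type} [MeasurableSpace α] :
    {X : Type} → [MeasurableSpace X] → (X → Prog K α) → Prop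
  | done {X : Type} [MeasurableSpace X] (v : X → α) (hv : Measurable v) :
      MeasProg fun x => Prog.done (v x)
  | pull {X : Type} [MeasurableSpace X] (a : X → Fin K) (ha : Measurable a)
      (next : X → ℝ × Bool → Prog K α)
      (h : MeasProg fun z : X × (ℝ × Bool) => next z.1 z.2) :
      MeasProg fun x => Prog.pull (a x) (next x)
  | pullUnif {X : Type} [MeasurableSpace X] (next : X → Fin K → ℝ × Bool → Prog K α)
      (h : MeasProg fun z : X × (Fin K × (ℝ × Bool)) => next z.1 z.2.1 z.2.2) :
      MeasProg fun x => Prog.pullUnif (next x)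
  | glue {X : Type} [MeasurableSpace X] {ι : Type} [Countable ι] (Z : X → ι) (hZ : FibMeas Z)
      (f : ι → X → Prog K α) (h : ∀ i, MeasProg (f i)) : MeasProg fun x => f (Z x) x

variable {α β : Type} [MeasurableSpace α] [MeasurableSpace β] {X : Type} [MeasurableSpace X]

theorem MeasProg.comp {p : X → Prog K α} (hp : MeasProg p) {W : Type} [MeasurableSpace W]
    {h : W → X} (hh : Measurable h) : MeasProg fun w => p (h w) := by
  induction hp generalizing W with
  | done v hv => exact MeasProg.done (fun w => v (h w)) (hv.comp hh)
  | pull a ha next _ ih =>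
    refine MeasProg.pull (fun w => a (h w)) (ha.comp hh) (fun w => next (h w)) ?_
    exact ih (h := fun z : W × (ℝ × Bool) => (h z.1, z.2)) (by fun_prop)
  | pullUnif next _ ih =>
    refine MeasProg.pullUnif (fun w => next (h w)) ?_
    exact ih (h := fun z : W × (Fin K × (ℝ × Bool)) => (h z.1, z.2)) (by fun_prop)
  | glue Z hZ f _ ih =>
    exact MeasProg.glue (fun w => Z (h w)) (hZ.comp hh) (fun i w => f i (h w)) fun i => ih i hh

theorem MeasProg.bind {p : X → Prog K α} (hp : MeasProg p) {f : X → α → Prog K β}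
    (hf : MeasProg fun z : X × α => f z.1 z.2) : MeasProg fun x => (p x).bind (f x) := by
  induction hp with
  | done v hv => exact hf.comp (h := fun x => (x, v x)) (by fun_prop)
  | @pull X _ a ha next _ ih =>
    refine MeasProg.pull a ha (fun x o => (next x o).bind (f x)) ?_
    exact ih (f := fun z => f z.1)
      (hf.comp (h := fun z : (X × (ℝ × Bool)) × α => (z.1.1, z.2)) (by fun_prop))
  | @pullUnif X _ next _ ih =>
    refine MeasProg.pullUnif (fun x i o => (next x i o).bind (f x)) ?_
    exact ih (f := fun z => f z.1)
      (hf.comp (h := fun z : (X × (Fin K × (ℝ × Bool))) × α => (z.1.1, z.2)) (by fun_prop))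
  | glue Z hZ g _ ih =>
    exact MeasProg.glue Z hZ (fun i x => (g i x).bind (f x)) fun i => ih i hf

/-- A value in a countable type can be frozen, so no joint measurability of the continuation is
required. -/
theorem MeasProg.bind_countable [Countable α] [MeasurableSingletonClass α] {p : X → Prog K α}
    (hp : MeasProg p) {f : X → α → Prog K β} (hf : ∀ a, MeasProg fun x => f x a) :
    MeasProg fun x => (p x).bind (f x) :=
  hp.bind (MeasProg.glue (fun z : X × α => z.2) (fibMeas_of_measurable measurable_snd)
    (fun a z => f z.1 a) fun a => (hf a).comp measurable_fst)

theorem MeasProg.arm [NeZero K] {p : X → Prog K α} (hp : MeasProg p) {d : X → Fin K}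
    (hd : Measurable d) : Measurable fun x => (p x).arm (d x) := by
  induction hp with
  | done v hv => exact measurable_const
  | pull a ha next _ _ => exact ha
  | pullUnif next _ _ => exact hd
  | glue Z hZ f _ ih => exact hZ.glue (g := fun i x => (f i x).arm (d x)) fun i => ih i hd

theorem MeasProg.after {p : X → Prog K α} (hp : MeasProg p) {d : X → Fin K}
    (hd : Measurable d) {o : X → ℝ × Bool} (ho : Measurable o) :
    MeasProg fun x => (p x).after (d x) (o x) := by
  induction hp with
  | done v hv => exact MeasProg.done v hv
  | pull a ha next h _ => exact h.comp (h := fun x => (x, o x)) (by fun_prop)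
  | pullUnif next h _ => exact h.comp (h := fun x => (x, d x, o x)) (by fun_prop)
  | glue Z hZ f _ ih =>
    exact MeasProg.glue Z hZ (fun i x => (f i x).after (d x) (o x)) fun i => ih i hd ho

/-- The list of observations is replaced by a tuple of fixed length, for which a product σ-algebra
is available. -/
theorem measProg_pullList_bind (as : List (Fin K)) {k : X → List (ℝ × Bool) → Prog K β}
    (h : MeasProg fun z : X × (Fin as.length → ℝ × Bool) => k z.1 (List.ofFn z.2)) :
    MeasProg fun x => (pullList as).bind (k x) := by
  induction as generalizing X with
  | nil =>
    have := h.comp (h := fun x => (x, fun _ => (0, false))) (by fun_prop)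
    simpa [pullList] using this
  | cons a as ih =>
    have e : (fun x => (pullList (a :: as)).bind (k x)) = fun x => Prog.pull a fun o =>
        (pullList as).bind fun os => k x (o :: os) := by
      funext x
      simp only [pullList, pull_bind, Prog.bind_eq, Prog.bind_assoc, Prog.pure_eq, done_bind]
    rw [e]
    refine MeasProg.pull (fun _ => a) measurable_const _ ?_
    refine ih (k := fun (z : X × (ℝ × Bool)) os => k z.1 (z.2 :: os)) ?_
    have hm : Measurable fun z : (X × (ℝ × Bool)) × (Fin as.length → ℝ × Bool) =>
        ((z.1.1, Fin.cons z.1.2 z.2) : X × (Fin (a :: as).length → ℝ × Bool)) := by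
      refine Measurable.prodMk (by fun_prop) (measurable_pi_lambda _ fun i => ?_)
      refine Fin.cases ?_ (fun j => ?_) i
      · simp only [Fin.cons_zero]; fun_prop
      · simp only [Fin.cons_succ]; fun_prop
    have := h.comp hm
    simpa using this

/-- Only finitely many patterns of collisions can occur, so the continuation may depend on them
arbitrarily. This covers all waiting, sending and receiving. -/
theorem measProg_pullList_bind_collisions (as : List (Fin K)) {k : List Bool → Prog K β}
    (h : ∀ l, MeasProg fun _ : X => k l) :
    MeasProg fun _ : X => (pullList as).bind fun os => k (os.map fun o => o.2) := by
  refine measProg_pullList_bind as ?_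
  have hZ : Measurable fun z : X × (Fin as.length → ℝ × Bool) => fun i => (z.2 i).2 := by
    fun_prop
  have := MeasProg.glue (fun z : X × (Fin as.length → ℝ × Bool) => fun i => (z.2 i).2)
    (fibMeas_of_measurable hZ) (fun b _ => k (List.ofFn b))
    fun b => (h (List.ofFn b)).comp measurable_fst
  simpa [List.map_ofFn, Function.comp_def] using this

theorem measProg_stay (a : Fin K) (m : ℕ) : MeasProg fun _ : X => stay a m :=
  measProg_pullList_bind_collisions _ (k := fun _ => done ())
    fun _ => MeasProg.done _ measurable_const

theorem measProg_send (a b : Fin K) (l : List Bool) : MeasProg fun _ : X => send a b l :=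
  measProg_pullList_bind_collisions _ (k := fun _ => done ())
    fun _ => MeasProg.done _ measurable_const

theorem measProg_receive (a : Fin K) (b : ℕ) : MeasProg fun _ : X => receive a b :=
  measProg_pullList_bind_collisions _ (k := fun l => done (decode l))
    fun _ => MeasProg.done _ measurable_const

theorem measProg_seqFin [Countable α] [MeasurableSingletonClass α] (m : ℕ)
    (f : Fin m → Prog K α) (h : ∀ i, MeasProg fun _ : X => f i) :
    MeasProg fun _ : X => seqFin m f := by
  induction m with
  | zero => exact MeasProg.done _ measurable_const
  | succ m ih =>
    exact (h 0).bind_countable fun a => (ih _ fun i => h i.succ).bind_countable fun r =>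
      MeasProg.done _ measurable_const

theorem measurable_empMean (as : List (Fin K)) {m : ℕ} (k : Fin K) {g : X → Fin m → ℝ × Bool}
    (hg : Measurable g) : Measurable fun x => empMean as (List.ofFn (g x)) k := by
  have key : Measurable (fun x => (((as.zip (List.ofFn (g x))).filter fun z => z.1 = k).map
      fun z => z.2.1).sum) ∧ Measurable fun x => ((((as.zip (List.ofFn (g x))).filter
        fun z => z.1 = k).map fun z => z.2.1).length : ℝ) := by
    induction as generalizing m with
    | nil => simp
    | cons a as ih =>
      rcases m with _ | m
      · simp
      · obtain ⟨h1, h2⟩ := ih (g := fun x i => g x i.succ) (by fun_prop)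
        simp only [List.ofFn_succ, List.zip_cons_cons]
        by_cases ha : a = k
        · have h3 : Measurable fun x => (g x 0).1 := by fun_prop
          constructor
          · have h4 := h3.add h1
            simpa [ha, Pi.add_def] using h4
          · simpa [ha] using h2.add_const 1
        · constructor
          · simpa [ha] using h1
          · simpa [ha] using h2
  exact key.1.div key.2

theorem measurable_truncate (b : ℕ) : Measurable (truncate b) := by
  unfold truncate
  fun_prop

end MeasProg

/-! ### Measurability of the programs of leader and followers. -/

section Loops

variable {K n : ℕ} (rule : ArgmaxRule K) (T c : ℕ)

/-- The decisions of the leader, given her estimates `w`: the best matching, the matchings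
associated with the edges, and whether an edge is kept. -/
def decision (p : ℕ) (w : Fin (n + 1) → Fin K → ℝ) : (Fin (n + 1) → Fin K) ×
    (Fin (n + 1) × Fin K → Fin (n + 1) → Fin K) × (Fin (n + 1) × Fin K → Bool) :=
  (bestMatching rule w, assocMatching rule w, fun e =>
    decide (∑ m, (w m (bestMatching rule w m) - w m (assocMatching rule w e m)) ≤
      4 * ((n + 1 : ℕ) : ℝ) * eps K (n + 1) T c p))

theorem measurable_bestMatching : Measurable (bestMatching (n := n) rule) :=
  rule.measurable_sel _ _

theorem measurable_assocMatching (e : Fin (n + 1) × Fin K) :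
    Measurable fun w => assocMatching (n := n) rule w e :=
  rule.measurable_sel _ _

theorem measurable_apply_apply {X : Type*} [MeasurableSpace X] {w : X → Fin (n + 1) → Fin K → ℝ}
    (hw : Measurable w) (m : Fin (n + 1)) {f : X → Fin K} (hf : Measurable f) :
    Measurable fun x => w x m (f x) :=
  (fibMeas_of_measurable hf).glue (g := fun k x => w x m k) fun k => by fun_prop

theorem fibMeas_decision (p : ℕ) : FibMeas (decision (n := n) rule T c p) := by
  refine fibMeas_of_measurable ?_
  refine (measurable_bestMatching rule).prodMk
    ((measurable_pi_lambda _ (measurable_assocMatching rule)).prodMk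
      (measurable_pi_lambda _ fun e => ?_))
  refine measurable_to_bool ?_
  have : (fun w : Fin (n + 1) → Fin K → ℝ =>
      decide (∑ m, (w m (bestMatching rule w m) - w m (assocMatching rule w e m)) ≤
        4 * ((n + 1 : ℕ) : ℝ) * eps K (n + 1) T c p)) ⁻¹' {true} =
      {w | ∑ m, (w m (bestMatching rule w m) - w m (assocMatching rule w e m)) ≤
        4 * ((n + 1 : ℕ) : ℝ) * eps K (n + 1) T c p} := by
    ext w; simp
  rw [this]
  refine measurableSet_le (Finset.measurable_sum _ fun m _ => ?_) measurable_const
  exact (measurable_apply_apply measurable_id m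
      ((measurable_pi_apply m).comp (measurable_bestMatching rule))).sub
    (measurable_apply_apply measurable_id m
      ((measurable_pi_apply m).comp (measurable_assocMatching rule e)))

theorem fibMeas_keptEdges (p : ℕ) (E : List (Fin (n + 1) × Fin K)) :
    FibMeas (keptEdges rule T c p E) := by
  have : keptEdges rule T c p E = fun w => E.filter (decision rule T c p w).2.2 := by
    funext w
    simp only [keptEdges, decision]
  rw [this]
  exact (fibMeas_decision rule T c p).map fun z => E.filter z.2.2

theorem fibMeas_candidates (p : ℕ) (E : List (Fin (n + 1) × Fin K)) :
    FibMeas (candidates rule T c p E) := by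
  have : candidates rule T c p E = fun w =>
      ((keptEdges rule T c p E w).map (decision rule T c p w).2.1).dedup := rfl
  rw [this]
  exact ((fibMeas_keptEdges rule T c p E).prodMk (fibMeas_decision rule T c p)).map
    fun z => (z.1.map z.2.2.1).dedup

variable {X : Type} [MeasurableSpace X]

/-- What the leader does in epoch `p`, as a function of the best matching, the candidate edges and
the candidate matchings. -/
def leaderEpoch (fuel p : ℕ) (κ : Fin (n + 1) → Fin K)
    (z : (Fin (n + 1) → Fin K) × List (Fin (n + 1) × Fin K) × List (Fin (n + 1) → Fin K)) :
    Prog K Unit :=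
  (seqFin n fun j => send (κ 0) (κ j.succ) (encode (sizeBits K (n + 1)) z.2.2.length)).bind
    fun _ =>
  (seqFin n fun j =>
    (send (κ 0) (κ j.succ) (z.2.2.flatMap fun π => encode (armBits K) (π j.succ).val)).bind
      fun _ =>
    (send (κ 0) (κ j.succ) (encode (armBits K) (z.1 0).val)).bind fun _ =>
    send (κ 0) (κ j.succ) (encode (armBits K) (z.1 j.succ).val)).bind fun _ =>
  leaderRest rule T c n fuel p z.2.1 z.1 z.2.2

theorem leaderLoop_eq_leaderEpoch (fuel p : ℕ) (E : List (Fin (n + 1) × Fin K))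
    (w : Fin (n + 1) → Fin K → ℝ) (κ : Fin (n + 1) → Fin K) :
    leaderLoop rule T c n (fuel + 1) p E w κ = leaderEpoch rule T c fuel p κ
      (bestMatching rule w, keptEdges rule T c p E w, candidates rule T c p E w) :=
  leaderLoop_succ rule T c fuel p E w κ

/-- The current estimates influence the epoch only through a triple from a countable type, over
which the program is glued. The next estimates are measurable in the new observations; the parameter
space `X` varies in the induction because these observations become parameters of the next epoch. -/
theorem measProg_leaderLoop (fuel p : ℕ) (E : List (Fin (n + 1) × Fin K))
    {w : X → Fin (n + 1) → Fin K → ℝ} (hw : Measurable w) (κ : Fin (n + 1) → Fin K) :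
    MeasProg fun x => leaderLoop rule T c n fuel p E (w x) κ := by
  induction fuel generalizing X p E κ with
  | zero => exact MeasProg.done _ measurable_const
  | succ fuel ih =>
    have hglue := MeasProg.glue (X := X) (fun x => (bestMatching rule (w x),
      keptEdges rule T c p E (w x), candidates rule T c p E (w x))) ?_
      (fun z _ => leaderEpoch rule T c fuel p κ z) ?_
    · simpa only [leaderLoop_eq_leaderEpoch] using hglue
    · exact (fibMeas_of_measurable ((measurable_bestMatching rule).comp hw)).prodMk
        (((fibMeas_keptEdges rule T c p E).comp hw).prodMk
          ((fibMeas_candidates rule T c p E).comp hw))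
    · rintro ⟨π₁, Enew, C⟩
      simp only [leaderEpoch]
      refine (measProg_seqFin (X := X) n _ fun j => measProg_send _ _ _).bind_countable fun _ => ?_
      refine MeasProg.bind_countable (measProg_seqFin n _ fun j => ?_) fun _ => ?_
      · exact (measProg_send _ _ _).bind_countable fun _ =>
          (measProg_send _ _ _).bind_countable fun _ => measProg_send _ _ _
      have hrest : MeasProg fun _ : X =>
          (pullList (C.flatMap fun π => List.replicate (2 ^ p ^ c) (π 0))).bind fun os =>
          (seqFin n fun _ => seqFin K fun _ => receive (π₁ 0) (meanBits c p)).bind fun x =>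
          leaderLoop rule T c n fuel (p + 1) Enew
            (Fin.cons (empMean (C.flatMap fun π => List.replicate (2 ^ p ^ c) (π 0)) os)
              fun j k => (x j k : ℝ) / 2 ^ meanBits c p) π₁ := by
        refine measProg_pullList_bind _ ?_
        refine (measProg_seqFin n _ fun _ => measProg_seqFin K _ fun _ =>
          measProg_receive _ _).bind_countable fun x => ih _ _ ?_ _
        refine measurable_pi_lambda _ fun m => measurable_pi_lambda _ fun k => ?_
        refine Fin.cases ?_ (fun j => ?_) m
        · simp only [Fin.cons_zero]
          exact measurable_empMean _ k measurable_snd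
        · simp only [Fin.cons_succ]
          exact measurable_const
      rcases C with _ | ⟨π, _ | _⟩
      · exact hrest
      · exact measProg_stay _ _
      · exact hrest

/-- The rewards enter only through the truncated estimates, which are integers. -/
theorem measProg_followerLoop [NeZero K] (R M fuel p : ℕ) (κ : Fin K) :
    MeasProg fun _ : X => followerLoop K T c R M fuel p κ := by
  induction fuel generalizing X p κ with
  | zero => exact MeasProg.done _ measurable_const
  | succ fuel ih =>
    simp only [followerLoop_succ, Prog.bind_assoc, done_bind]
    refine (measProg_stay _ _).bind_countable fun _ => ?_
    refine (measProg_receive _ _).bind_countable fun size => ?_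
    refine (measProg_stay _ _).bind_countable fun _ => ?_
    refine (measProg_stay _ _).bind_countable fun _ => ?_
    refine (measProg_seqFin _ _ fun _ => measProg_receive _ _).bind_countable fun x => ?_
    refine (measProg_receive _ _).bind_countable fun y₁ => ?_
    refine (measProg_receive _ _).bind_countable fun y => ?_
    refine (measProg_stay _ _).bind_countable fun _ => ?_
    generalize List.ofFn (fun i => Fin.ofNat K (x i)) = arms
    generalize Fin.ofNat K y₁ = κ₁
    generalize Fin.ofNat K y = κ'
    have hrest : MeasProg fun _ : X =>
        (pullList (arms.flatMap fun a => List.replicate (2 ^ p ^ c) a)).bind fun os =>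
        (stay κ' ((R - 2) * (K * meanBits c p))).bind fun _ =>
        (seqFin K fun k => send κ' κ₁ (encode (meanBits c p) (truncate (meanBits c p)
          (empMean (arms.flatMap fun a => List.replicate (2 ^ p ^ c) a) os k)))).bind fun _ =>
          (stay κ' ((M - R) * (K * meanBits c p))).bind fun _ =>
            followerLoop K T c R M fuel (p + 1) κ' := by
      refine measProg_pullList_bind _ ?_
      refine (measProg_stay _ _).bind_countable fun _ => ?_
      refine MeasProg.glue (fun z : X × (Fin _ → ℝ × Bool) => fun k => truncate (meanBits c p)
        (empMean (arms.flatMap fun a => List.replicate (2 ^ p ^ c) a) (List.ofFn z.2) k)) ?_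
        (fun i _ => (seqFin K fun k => send κ' κ₁ (encode (meanBits c p) (i k))).bind fun _ =>
          (stay κ' ((M - R) * (K * meanBits c p))).bind fun _ =>
            followerLoop K T c R M fuel (p + 1) κ') ?_
      · refine fibMeas_of_measurable (measurable_pi_lambda _ fun k => ?_)
        exact (measurable_truncate _).comp (measurable_empMean _ k measurable_snd)
      · intro i
        refine (measProg_seqFin K _ fun k => measProg_send _ _ _).bind_countable fun _ => ?_
        exact (measProg_stay _ _).bind_countable fun _ => ih _ _
    rcases arms with _ | ⟨a, _ | _⟩
    · exact hrest
    · exact measProg_stay _ _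
    · exact hrest

theorem measProg_musicalChairs_bind {β : Type} [MeasurableSpace β] (m : ℕ) (k : Option (Fin K))
    {f : Option (Fin K) → Prog K β} (hf : ∀ o, MeasProg fun _ : X => f o) :
    MeasProg fun _ : X => (musicalChairs K m k).bind f := by
  induction m generalizing X k with
  | zero => exact hf k
  | succ m ih =>
    rcases k with _ | k
    · refine MeasProg.pullUnif _ ?_
      exact MeasProg.glue (fun z : X × (Fin K × (ℝ × Bool)) => (z.2.1, z.2.2.2))
        (fibMeas_of_measurable (by fun_prop))
        (fun i _ => (musicalChairs K m (if i.2 then none else some i.1)).bind f)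
        fun i => ih _ fun o => (hf o).comp measurable_fst
    · exact MeasProg.pull (fun _ => k) measurable_const _
        (ih (X := X × (ℝ × Bool)) _ fun o => (hf o).comp measurable_fst)

theorem measProg_metcElim [NeZero K] : MeasProg fun _ : X => metcElim rule T c := by
  have e : metcElim rule T c = (initProc K (1 / ((K : ℝ) * T))).bind fun RM =>
      if RM.1 = 1 then
        leaderLoop rule T c (RM.2 - 1) T 1
          (List.finRange (RM.2 - 1 + 1) ×ˢ List.finRange K) (fun _ _ => 0)
          (fun i => Fin.ofNat K i.val)
      else followerLoop K T c RM.1 RM.2 T 1 (Fin.ofNat K (RM.1 - 1)) := rfl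
  rw [e, initProc_eq]
  refine MeasProg.bind_countable ?_ fun RM => ?_
  · refine measProg_musicalChairs_bind _ _ fun o => ?_
    have hcount : ∀ os : List (ℝ × Bool), collisionCount os =
        (os.map fun o => o.2).countP fun b => b := by
      intro os
      simp [collisionCount, List.countP_map, Function.comp_def]
    simp only [hcount]
    refine measProg_pullList_bind_collisions _ (k := fun l => (pullList _).bind fun sweep =>
      (stay _ _).bind fun _ => done (1 + l.countP _, 1 + l.countP _ +
        (sweep.map fun o => o.2).countP _)) fun l => ?_
    refine measProg_pullList_bind_collisions _ (k := fun l' => (stay _ _).bind fun _ =>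
      done (1 + l.countP _, 1 + l.countP _ + l'.countP _)) fun l' => ?_
    exact (measProg_stay _ _).bind_countable fun _ => MeasProg.done _ measurable_const
  · split_ifs
    · exact measProg_leaderLoop rule T c _ _ _ measurable_const _
    · exact measProg_followerLoop T c _ _ _ _ _

end Loops

/-! ### Measurability of the arms pulled. -/

section MeasPlay

variable {K M : ℕ}

theorem measurable_gain {X : Type*} [MeasurableSpace X] {y : X → Fin M → Fin K → ℝ}
    (hy : Measurable y) {A : X → Fin M → Fin K} (hA : Measurable A) (m : Fin M) :
    Measurable fun x => gain (y x) (A x) m :=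
  (fibMeas_of_measurable hA).glue (g := fun A x => gain (y x) A m) fun A => by
    unfold gain
    split_ifs
    · exact measurable_const
    · fun_prop

theorem measProg_progAt [NeZero K] {prog : Prog K Unit}
    (hprog : MeasProg fun _ : (ℕ → Fin M → Fin K → ℝ) × (ℕ → Fin M → Fin K) => prog)
    (t : ℕ) (m : Fin M) :
    MeasProg fun x : (ℕ → Fin M → Fin K → ℝ) × (ℕ → Fin M → Fin K) =>
      progAt prog x.1 x.2 t m := by
  induction t generalizing m with
  | zero => exact hprog
  | succ t ih =>
    have hA : Measurable fun x : (ℕ → Fin M → Fin K → ℝ) × (ℕ → Fin M → Fin K) =>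
        armsOf x.2 (progAt prog x.1 x.2) t :=
      measurable_pi_lambda _ fun n => (ih n).arm (by fun_prop)
    refine (ih m).after (by fun_prop) (Measurable.prodMk ?_ ?_)
    · exact measurable_gain (by fun_prop) hA m
    · exact ((fibMeas_of_measurable hA).map fun A => collides A m).measurable

theorem measurable_armAt [NeZero K] {prog : Prog K Unit}
    (hprog : MeasProg fun _ : (ℕ → Fin M → Fin K → ℝ) × (ℕ → Fin M → Fin K) => prog)
    (t : ℕ) : Measurable fun x : (ℕ → Fin M → Fin K → ℝ) × (ℕ → Fin M → Fin K) =>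
      armAt prog x.1 x.2 t :=
  measurable_pi_lambda _ fun m => (measProg_progAt hprog t m).arm (by fun_prop)

end MeasPlay

/-! ### Dependence of the epochs on the past -/

section Dependence

variable {K n : ℕ} [NeZero K] (rule : ArgmaxRule K) (T : ℕ)

theorem exploreMean_congr {K n : ℕ} {y y' : ℕ → Fin (n + 1) → Fin K → ℝ} {u : ℕ}
    {l : List (Fin (n + 1) → Fin K)} (h : ∀ s, u ≤ s → s < u + l.length → y s = y' s) :
    exploreMean y u l = exploreMean y' u l := by
  funext m k
  rw [exploreMean_eq, exploreMean_eq]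
  congr 1
  refine Finset.sum_congr rfl fun i hi => ?_
  simp only [slotSet, Finset.mem_filter, Finset.mem_range] at hi
  rw [h (u + i) (by omega) (by omega)]

/-- A stopping time property: the random first round of an epoch, together with all data held then,
is determined by the utilities before that round. -/
theorem epochData_congr {y y' : ℕ → Fin (n + 1) → Fin K → ℝ} (t₁ q : ℕ)
    (h : ∀ s < (epochData rule T y t₁ q).t, y s = y' s) :
    epochData rule T y' t₁ q = epochData rule T y t₁ q := by
  induction q with
  | zero => rfl
  | succ q ih =>
    set st := epochData rule T y t₁ q with hst
    have e : (epochData rule T y t₁ (q + 1)).t = st.v rule T 1 (q + 1) + n * (K * meanBits 1 (q + 1)) :=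
      rfl
    have hv : st.v rule T 1 (q + 1) = st.u rule T 1 (q + 1) +
      (slots 1 (q + 1) (st.cands rule T 1 (q + 1))).length := rfl
    have hu : st.t ≤ st.u rule T 1 (q + 1) := Nat.le_add_right _ _
    have ih' := ih fun s hs => h s (by omega)
    change (epochData rule T y' t₁ q).next rule T 1 (q + 1) y' = st.next rule T 1 (q + 1) y
    rw [ih']
    have hm : exploreMean y' (st.u rule T 1 (q + 1))
        (slots 1 (q + 1) (st.cands rule T 1 (q + 1))) = exploreMean y (st.u rule T 1 (q + 1))
        (slots 1 (q + 1) (st.cands rule T 1 (q + 1))) :=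
      (exploreMean_congr fun s _ hs => h s (by omega)).symm
    simp only [EpochState.next, nextEstimates, hm]

/-- The starting round and the explored matchings of epoch `q + 1`. -/
def epochPlan (y : ℕ → Fin (n + 1) → Fin K → ℝ) (t₁ q : ℕ) :
    ℕ × List (Fin (n + 1) → Fin K) :=
  ((epochData rule T y t₁ q).t, (epochData rule T y t₁ q).cands rule T 1 (q + 1))

/-- For a fixed plan `z`, whether it is used depends only on rounds before `z.1`, hence not on the
samples that it would collect. -/
theorem epochPlan_eq_iff {y y' : ℕ → Fin (n + 1) → Fin K → ℝ} {t₁ q : ℕ}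
    {z : ℕ × List (Fin (n + 1) → Fin K)} (h : ∀ s < z.1, y s = y' s) :
    epochPlan rule T y t₁ q = z ↔ epochPlan rule T y' t₁ q = z := by
  constructor
  · rintro rfl
    simp only [epochPlan]
    rw [epochData_congr rule T t₁ q h]
  · rintro rfl
    simp only [epochPlan]
    rw [epochData_congr rule T t₁ q fun s hs => (h s hs).symm]

theorem measurable_exploreMean {K n : ℕ} (u : ℕ) (l : List (Fin (n + 1) → Fin K))
    (m : Fin (n + 1)) (k : Fin K) :
    Measurable fun y : ℕ → Fin (n + 1) → Fin K → ℝ => exploreMean y u l m k := by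
  simp only [exploreMean_eq]
  fun_prop

theorem measurable_nextEstimates {K n : ℕ} (c u p : ℕ) (l : List (Fin (n + 1) → Fin K)) :
    Measurable fun y : ℕ → Fin (n + 1) → Fin K → ℝ => nextEstimates c y u p l := by
  refine measurable_pi_lambda _ fun m => measurable_pi_lambda _ fun k => ?_
  refine Fin.cases ?_ (fun j => ?_) m
  · exact measurable_exploreMean u l 0 k
  · have h1 : Measurable fun x : ℕ => (x : ℝ) := measurable_from_top
    exact (h1.comp ((measurable_truncate _).comp
      (measurable_exploreMean u l j.succ k))).div_const _

theorem measurable_epochData (t₁ q : ℕ) :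
    FibMeas (fun y : ℕ → Fin (n + 1) → Fin K → ℝ =>
      ((epochData rule T y t₁ q).t, (epochData rule T y t₁ q).E)) ∧
    Measurable fun y : ℕ → Fin (n + 1) → Fin K → ℝ => (epochData rule T y t₁ q).w := by
  induction q with
  | zero =>
    exact ⟨fibMeas_const (t₁, List.finRange (n + 1) ×ˢ List.finRange K),
      measurable_const (a := fun (_ : Fin (n + 1)) (_ : Fin K) => (0 : ℝ))⟩
  | succ q ih =>
    obtain ⟨h1, h2⟩ := ih
    have h3 : FibMeas fun y : ℕ → Fin (n + 1) → Fin K → ℝ =>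
        ((epochData rule T y t₁ q).t, keptEdges rule T 1 (q + 1) (epochData rule T y t₁ q).E
          (epochData rule T y t₁ q).w, candidates rule T 1 (q + 1) (epochData rule T y t₁ q).E
          (epochData rule T y t₁ q).w) :=
      h1.glue_fibMeas (g := fun z y => (z.1, keptEdges rule T 1 (q + 1) z.2
        (epochData rule T y t₁ q).w, candidates rule T 1 (q + 1) z.2
          (epochData rule T y t₁ q).w)) fun z =>
        (fibMeas_const z.1).prodMk (((fibMeas_keptEdges rule T 1 (q + 1) z.2).comp h2).prodMk
          ((fibMeas_candidates rule T 1 (q + 1) z.2).comp h2))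
    constructor
    · exact h3.map fun z => (z.1 + commLength K n z.2.2.length + (slots 1 (q + 1) z.2.2).length +
        n * (K * meanBits 1 (q + 1)), z.2.1)
    · exact h3.glue (g := fun z y => nextEstimates 1 y (z.1 + commLength K n z.2.2.length) (q + 1)
        (slots 1 (q + 1) z.2.2)) fun z => measurable_nextEstimates _ _ _ _

theorem fibMeas_epochPlan (t₁ q : ℕ) :
    FibMeas fun y : ℕ → Fin (n + 1) → Fin K → ℝ => epochPlan rule T y t₁ q := by
  obtain ⟨h1, h2⟩ := measurable_epochData (n := n) rule T t₁ q
  exact h1.glue_fibMeas (g := fun z y => (z.1, candidates rule T 1 (q + 1) z.2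
    (epochData rule T y t₁ q).w)) fun z =>
      (fibMeas_const z.1).prodMk ((fibMeas_candidates rule T 1 (q + 1) z.2).comp h2)

end Dependence

/-! ### Concentration of the empirical means -/

section Concentration

variable {Ω : Type*} [MeasurableSpace Ω] {P : Measure Ω}

/-- Replaces conditioning on a discrete variable: an estimate on each fibre sums to a global one. No
measurability of `A` is needed. -/
theorem measure_le_of_countable {ι : Type*} [Countable ι] {Z : Ω → ι} (hZ : FibMeas Z)
    {A G : Set Ω} (hG : MeasurableSet G) (b : ENNReal)
    (h : ∀ z, P (A ∩ Z ⁻¹' {z}) ≤ b * P (G ∩ Z ⁻¹' {z})) : P A ≤ b * P G := by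
  have hU : ∀ B : Set Ω, ⋃ z, B ∩ Z ⁻¹' {z} = B := by
    intro B; ext x; simp
  calc P A = P (⋃ z, A ∩ Z ⁻¹' {z}) := by rw [hU]
    _ ≤ ∑' z, P (A ∩ Z ⁻¹' {z}) := measure_iUnion_le _
    _ ≤ ∑' z, b * P (G ∩ Z ⁻¹' {z}) := ENNReal.tsum_le_tsum h
    _ = b * ∑' z, P (G ∩ Z ⁻¹' {z}) := ENNReal.tsum_mul_left
    _ = b * P (⋃ z, G ∩ Z ⁻¹' {z}) := by
        rw [measure_iUnion]
        · intro i j hij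
          refine Set.disjoint_left.2 ?_
          rintro x ⟨_, h1⟩ ⟨_, h2⟩
          exact hij (h1.symm.trans h2)
        · exact fun z => hG.inter (hZ.measurableSet _)
    _ = b * P G := by rw [hU]

variable {F : Type*} [MeasurableSpace F] [Zero F]

/-- The sequence `y`, replaced by `0` outside of `S`. -/
def maskOn (S : Finset ℕ) (y : ℕ → F) (s : ℕ) : F := open scoped Classical in
  if s ∈ S then y s else 0

/-- Masked sequences stand for the restrictions to disjoint blocks of rounds, while functions of
whole sequences can still be applied to them. -/
theorem indepFun_maskOn {Y : ℕ → Ω → F} (hm : ∀ t, Measurable (Y t)) (hind : iIndepFun Y P)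
    {S S' : Finset ℕ} (hSS : Disjoint S S') :
    IndepFun (fun ω => maskOn S fun s => Y s ω) (fun ω => maskOn S' fun s => Y s ω) P := by
  have h := hind.indepFun_finset S S' hSS hm
  have hext : ∀ S : Finset ℕ, Measurable fun (g : S → F) (s : ℕ) =>
      if hs : s ∈ S then g ⟨s, hs⟩ else 0 := by
    intro S
    refine measurable_pi_lambda _ fun s => ?_
    by_cases hs : s ∈ S
    · simp only [hs, dif_pos]; fun_prop
    · simp only [hs, dif_neg, not_false_eq_true]; fun_prop
  have h2 := h.comp (hext S) (hext S')
  convert h2 using 1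
  · funext ω s
    simp only [maskOn, Function.comp_apply]
    split_ifs <;> rfl
  · funext ω s
    simp only [maskOn, Function.comp_apply]
    split_ifs <;> rfl

variable [IsProbabilityMeasure P]

/-- Hoeffding's inequality for the deviation of an empirical mean. -/
theorem measure_mean_deviation_le {X : ℕ → Ω → ℝ} (hm : ∀ i, Measurable (X i))
    (h01 : ∀ i ω, X i ω ∈ Set.Icc (0 : ℝ) 1) (hind : iIndepFun X P) {a : ℝ}
    (ha : ∀ i, ∫ ω, X i ω ∂P = a) (I : Finset ℕ) (hI : 0 < I.card) {ε : ℝ} (hε : 0 ≤ ε) :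
    P.real {ω | ε < |(∑ i ∈ I, X i ω) / I.card - a|} ≤ 2 * Real.exp (-(2 * I.card * ε ^ 2)) := by
  have hN : (0 : ℝ) < I.card := by exact_mod_cast hI
  have key : ∀ s : ℝ, s ^ 2 = 1 → P.real {ω | I.card * ε ≤ ∑ i ∈ I, s * (X i ω - a)} ≤
      Real.exp (-(2 * I.card * ε ^ 2)) := by
    intro s hs
    -- Hoeffding's lemma: a variable with values in [0, 1] has variance proxy 1/4, and the sign s =
    -- ±1 treats both tails.
    have hsub : ∀ i ∈ I, HasSubgaussianMGF (fun ω => s * (X i ω - a)) ((1 / 4 : NNReal)) P := by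
      intro i _
      have h1 := hasSubgaussianMGF_of_mem_Icc (μ := P) (X := X i) (a := 0) (b := 1)
        (hm i).aemeasurable (Filter.Eventually.of_forall (h01 i))
      rw [ha i] at h1
      have h2 := h1.const_mul s
      convert h2 using 1
      refine NNReal.eq ?_
      change (1 / 4 : ℝ) = s ^ 2 * (‖(1 : ℝ) - 0‖ / 2) ^ 2
      rw [hs]
      norm_num
    have hind' : iIndepFun (fun i ω => s * (X i ω - a)) P :=
      hind.comp (fun _ x => s * (x - a)) fun _ => by fun_prop
    have := HasSubgaussianMGF.measure_sum_ge_le_of_iIndepFun hind' (s := I)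
      (c := fun _ => (1 / 4 : NNReal)) hsub (ε := I.card * ε) (by positivity)
    refine this.trans (le_of_eq ?_)
    congr 1
    simp only [Finset.sum_const, nsmul_eq_mul]
    push_cast
    field_simp
    ring
  have hsum : ∀ ω, ∑ i ∈ I, (X i ω - a) = I.card * ((∑ i ∈ I, X i ω) / I.card - a) := by
    intro ω
    rw [Finset.sum_sub_distrib, Finset.sum_const, nsmul_eq_mul]
    field_simp
  have hsubset : {ω | ε < |(∑ i ∈ I, X i ω) / I.card - a|} ⊆
      {ω | I.card * ε ≤ ∑ i ∈ I, (1 : ℝ) * (X i ω - a)} ∪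
        {ω | I.card * ε ≤ ∑ i ∈ I, (-1 : ℝ) * (X i ω - a)} := by
    intro ω hω
    simp only [Set.mem_ofPred_eq, lt_abs] at hω
    simp only [Set.mem_union, Set.mem_ofPred_eq, ← Finset.mul_sum, hsum]
    rcases hω with h | h
    · left; nlinarith
    · right; nlinarith
  calc P.real {ω | ε < |(∑ i ∈ I, X i ω) / I.card - a|} ≤ _ := measureReal_mono hsubset
    _ ≤ _ := measureReal_union_le _ _
    _ ≤ Real.exp (-(2 * I.card * ε ^ 2)) + Real.exp (-(2 * I.card * ε ^ 2)) :=
        add_le_add (key 1 (by norm_num)) (key (-1) (by norm_num))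
    _ = _ := by ring

variable {K n : ℕ} [NeZero K] (rule : ArgmaxRule K) {T : ℕ}

/-- The explorations of arm `k` by player `m` in epoch `q + 1` are not representative. -/
def deviationSet (rule : ArgmaxRule K) (T : ℕ) (μ : Fin (n + 1) → Fin K → ℝ) (t₁ q : ℕ)
    (m : Fin (n + 1)) (k : Fin K) : Set (ℕ → Fin (n + 1) → Fin K → ℝ) :=
  {y | (∃ π ∈ (epochPlan rule T y t₁ q).2, π m = k) ∧ eps K (n + 1) T 1 (q + 1) <
    |exploreMean y ((epochPlan rule T y t₁ q).1 +
      commLength K n (epochPlan rule T y t₁ q).2.length)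
      (slots 1 (q + 1) (epochPlan rule T y t₁ q).2) m k - μ m k|}

theorem measurableSet_deviationSet (μ : Fin (n + 1) → Fin K → ℝ) (t₁ q : ℕ)
    (m : Fin (n + 1)) (k : Fin K) : MeasurableSet (deviationSet rule T μ t₁ q m k) := by
  have h := fibMeas_epochPlan (n := n) rule T t₁ q
  refine (h.measurableSet {z | ∃ π ∈ z.2, π m = k}).inter ?_
  refine measurableSet_lt (f := fun _ : ℕ → Fin (n + 1) → Fin K → ℝ => eps K (n + 1) T 1 (q + 1))
    measurable_const (continuous_abs.measurable.comp (Measurable.sub_const ?_ _))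
  exact h.glue (g := fun z y => exploreMean y (z.1 + commLength K n z.2.length)
    (slots 1 (q + 1) z.2) m k) fun z => measurable_exploreMean _ _ _ _

theorem concentrates_of_notMem {μ : Fin (n + 1) → Fin K → ℝ} {t₁ q : ℕ}
    {y : ℕ → Fin (n + 1) → Fin K → ℝ} (h : ∀ m k, y ∉ deviationSet rule T μ t₁ q m k) :
    Concentrates rule T μ y (q + 1) (epochData rule T y t₁ q) := by
  intro m k hk
  by_contra hlt
  exact h m k ⟨hk, not_le.1 hlt⟩

/-- For a fixed plan (t, C), the event that it is used lives on rounds before t, and the empirical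
mean on rounds from `u` ≥ t on, so the two are independent. At least 2^p samples give 2exp(-2·2^p
ε_p²) = 2exp(-L) = δ. Summation over all plans removes the conditioning. -/
theorem measure_deviationSet_le (hL : 0 ≤ Real.log (2 / delta K (n + 1) T)) (hT : 1 ≤ T)
    {Y : ℕ → Ω → Fin (n + 1) → Fin K → ℝ}
    (hm : ∀ t, Measurable (Y t)) (h01 : ∀ t ω m k, Y t ω m k ∈ Set.Icc (0 : ℝ) 1)
    (hind : iIndepFun Y P) {μ : Fin (n + 1) → Fin K → ℝ}
    (hμ : ∀ t m k, ∫ ω, Y t ω m k ∂P = μ m k) (t₁ q : ℕ) (m : Fin (n + 1)) (k : Fin K) :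
    P {ω | (fun s => Y s ω) ∈ deviationSet rule T μ t₁ q m k} ≤
      ENNReal.ofReal (delta K (n + 1) T) := by
  have hYm : Measurable fun ω s => Y s ω := measurable_pi_lambda _ hm
  have hδ : 0 < delta K (n + 1) T := by
    have : 0 < K := Nat.pos_of_neZero K
    unfold delta
    positivity
  have hmain := measure_le_of_countable (P := P) ((fibMeas_epochPlan (n := n) rule T t₁ q).comp hYm)
    (A := {ω | (fun s => Y s ω) ∈ deviationSet rule T μ t₁ q m k}) MeasurableSet.univ
    (ENNReal.ofReal (delta K (n + 1) T)) ?_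
  · simpa using hmain
  rintro ⟨t, C⟩
  rw [Set.univ_inter]
  -- A plan that does not pull arm k for player m cannot cause a deviation.
  by_cases hC : ∃ π ∈ C, π m = k
  swap
  · have : {ω | (fun s => Y s ω) ∈ deviationSet rule T μ t₁ q m k} ∩
        (fun w => epochPlan rule T (fun s => Y s w) t₁ q) ⁻¹' {(t, C)} = ∅ := by
      ext ω
      simp only [Set.mem_inter_iff, Set.mem_ofPred_eq, Set.mem_preimage, Set.mem_singleton_iff,
        Set.mem_empty_iff_false, iff_false, not_and]
      intro h1 h2
      have h3 := h1.1
      rw [h2] at h3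
      exact hC h3
    rw [this]
    simp
  obtain ⟨π, hπC, hπk⟩ := hC
  set u := t + commLength K n C.length with hu
  set l := slots 1 (q + 1) C with hl
  set S := Finset.range t with hS
  set S' := Finset.Ico u (u + l.length) with hS'
  have hSS : Disjoint S S' := by
    rw [Finset.disjoint_left]
    intro s h1 h2
    rw [hS, Finset.mem_range] at h1
    rw [hS', Finset.mem_Ico] at h2
    omega
  have hindep := indepFun_maskOn hm hind hSS
  have hmul := hindep.measure_inter_preimage_eq_mul
    {y | epochPlan rule T y t₁ q = (t, C)}
    {y | eps K (n + 1) T 1 (q + 1) < |exploreMean y u l m k - μ m k|}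
    ((fibMeas_epochPlan (n := n) rule T t₁ q).measurableSet {(t, C)})
    (measurableSet_lt measurable_const
      (continuous_abs.measurable.comp ((measurable_exploreMean u l m k).sub_const _)))
  have e1 : (fun ω => maskOn S fun s => Y s ω) ⁻¹' {y | epochPlan rule T y t₁ q = (t, C)} =
      (fun ω => epochPlan rule T (fun s => Y s ω) t₁ q) ⁻¹' {(t, C)} := by
    ext ω
    refine epochPlan_eq_iff rule T fun s hs => ?_
    have : s ∈ S := Finset.mem_range.2 hs
    simp [maskOn, this]
  have e2 : (fun ω => maskOn S' fun s => Y s ω) ⁻¹'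
      {y | eps K (n + 1) T 1 (q + 1) < |exploreMean y u l m k - μ m k|} =
      {ω | eps K (n + 1) T 1 (q + 1) < |exploreMean (fun s => Y s ω) u l m k - μ m k|} := by
    ext ω
    have : exploreMean (maskOn S' fun s => Y s ω) u l = exploreMean (fun s => Y s ω) u l :=
      exploreMean_congr fun s h1 h2 => by
        have : s ∈ S' := Finset.mem_Ico.2 ⟨h1, h2⟩
        simp [maskOn, this]
    simp only [Set.mem_preimage, Set.mem_ofPred_eq, this]
  rw [e1, e2] at hmul
  have hsub : {ω | (fun s => Y s ω) ∈ deviationSet rule T μ t₁ q m k} ∩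
      (fun w => epochPlan rule T (fun s => Y s w) t₁ q) ⁻¹' {(t, C)} ⊆
      (fun ω => epochPlan rule T (fun s => Y s ω) t₁ q) ⁻¹' {(t, C)} ∩
      {ω | eps K (n + 1) T 1 (q + 1) < |exploreMean (fun s => Y s ω) u l m k - μ m k|} := by
    rintro ω ⟨h1, h2⟩
    refine ⟨h2, ?_⟩
    have h3 := h1.2
    have h2' : epochPlan rule T (fun s => Y s ω) t₁ q = (t, C) := h2
    rw [h2'] at h3
    exact h3
  refine (measure_mono hsub).trans ?_
  rw [hmul, mul_comm]
  gcongr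
  have hcard : 2 ^ (q + 1) ≤ (slotSet l m k).card := by
    have := two_pow_le_card_slotSet 1 (q + 1) hπC hπk
    rwa [pow_one] at this
  have hdev := measure_mean_deviation_le (P := P) (X := fun i ω => Y (u + i) ω m k) (a := μ m k)
    (fun i => by have := hm (u + i); fun_prop) (fun i ω => h01 _ _ _ _)
    ((hind.precomp (g := fun i => u + i) fun i j h => by simpa using h).comp
      (fun _ (x : Fin (n + 1) → Fin K → ℝ) => x m k) fun _ => by fun_prop)
    (fun i => hμ _ _ _) (slotSet l m k)
    (lt_of_lt_of_le (by positivity) hcard) (eps_nonneg K (n + 1) T 1 (q + 1))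
  rw [measureReal_def] at hdev
  simp only [exploreMean_eq]
  refine (ENNReal.le_ofReal_iff_toReal_le (measure_ne_top _ _) hδ.le).2 (hdev.trans ?_)
  rw [eps_sq hL]
  have h5 : Real.log (2 / delta K (n + 1) T) ≤
      2 * (slotSet l m k).card * (Real.log (2 / delta K (n + 1) T) / 2 ^ (1 + (q + 1))) := by
    have hc : (2 : ℝ) ^ (q + 1) ≤ (slotSet l m k).card := by exact_mod_cast hcard
    calc Real.log (2 / delta K (n + 1) T)
        = 2 * 2 ^ (q + 1) * (Real.log (2 / delta K (n + 1) T) / 2 ^ (1 + (q + 1))) := by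
          rw [add_comm 1 (q + 1), pow_succ (2 : ℝ) (q + 1)]
          field_simp
      _ ≤ _ := by gcongr
  calc 2 * Real.exp (-(2 * (slotSet l m k).card *
        (Real.log (2 / delta K (n + 1) T) / 2 ^ (1 + (q + 1)))))
      ≤ 2 * Real.exp (-Real.log (2 / delta K (n + 1) T)) := by gcongr
    _ = delta K (n + 1) T := by
        rw [Real.exp_neg, Real.exp_log (by positivity)]
        field_simp

/-- The explorations of some epoch are not representative. -/
def deviationUnion (rule : ArgmaxRule K) (T : ℕ) (μ : Fin (n + 1) → Fin K → ℝ) (t₁ : ℕ) :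
    Set (ℕ → Fin (n + 1) → Fin K → ℝ) :=
  ⋃ i : Fin T × Fin (n + 1) × Fin K, deviationSet rule T μ t₁ i.1 i.2.1 i.2.2

theorem measurableSet_deviationUnion (μ : Fin (n + 1) → Fin K → ℝ) (t₁ : ℕ) :
    MeasurableSet (deviationUnion rule T μ t₁) :=
  MeasurableSet.iUnion fun _ => measurableSet_deviationSet rule _ _ _ _ _

/-- T epochs and MK edges contribute TMKδ. -/
theorem measure_deviationUnion_le (hL : 0 ≤ Real.log (2 / delta K (n + 1) T)) (hT : 1 ≤ T)
    {Y : ℕ → Ω → Fin (n + 1) → Fin K → ℝ}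
    (hm : ∀ t, Measurable (Y t)) (h01 : ∀ t ω m k, Y t ω m k ∈ Set.Icc (0 : ℝ) 1)
    (hind : iIndepFun Y P) {μ : Fin (n + 1) → Fin K → ℝ}
    (hμ : ∀ t m k, ∫ ω, Y t ω m k ∂P = μ m k) (t₁ : ℕ) :
    P {ω | (fun s => Y s ω) ∈ deviationUnion rule T μ t₁} ≤
      ENNReal.ofReal (1 / (((n + 1 : ℕ) : ℝ) * T)) := by
  have hK : (0 : ℝ) < K := by exact_mod_cast Nat.pos_of_neZero K
  have hT' : (0 : ℝ) < T := by exact_mod_cast hT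
  have e : {ω | (fun s => Y s ω) ∈ deviationUnion rule T μ t₁} =
      ⋃ i : Fin T × Fin (n + 1) × Fin K,
        {ω | (fun s => Y s ω) ∈ deviationSet rule T μ t₁ i.1 i.2.1 i.2.2} := by
    ext ω; simp [deviationUnion]
  rw [e]
  calc P (⋃ i : Fin T × Fin (n + 1) × Fin K,
        {ω | (fun s => Y s ω) ∈ deviationSet rule T μ t₁ i.1 i.2.1 i.2.2})
      ≤ ∑ i : Fin T × Fin (n + 1) × Fin K,
        P {ω | (fun s => Y s ω) ∈ deviationSet rule T μ t₁ i.1 i.2.1 i.2.2} :=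
        measure_iUnion_fintype_le _ _
    _ ≤ ∑ _i : Fin T × Fin (n + 1) × Fin K, ENNReal.ofReal (delta K (n + 1) T) :=
        Finset.sum_le_sum fun i _ => measure_deviationSet_le rule hL hT hm h01 hind hμ _ _ _ _
    _ = ENNReal.ofReal (1 / (((n + 1 : ℕ) : ℝ) * T)) := by
        rw [Finset.sum_const, nsmul_eq_mul, ← ENNReal.ofReal_natCast,
          ← ENNReal.ofReal_mul (by positivity)]
        congr 1
        simp only [Finset.card_univ, Fintype.card_prod, Fintype.card_fin]
        unfold delta
        push_cast
        field_simp

end Concentration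

/-! ### The probability that a player finds no arm -/

section ChairsProbability

variable {K M : ℕ}

theorem occ_congr {d d' : ℕ → Fin M → Fin K} {t : ℕ} (h : ∀ s < t, d s = d' s) :
    occ d t = occ d' t := by
  induction t with
  | zero => rfl
  | succ t ih =>
    have e := ih fun s hs => h s (by omega)
    funext m
    rw [occ, occ, e, h t (by omega)]

theorem fibMeas_occ (t : ℕ) : FibMeas fun d : ℕ → Fin M → Fin K => occ d t := by
  induction t with
  | zero => exact fibMeas_const (fun _ => none)
  | succ t ih =>
    have h1 : FibMeas fun d : ℕ → Fin M → Fin K => d t :=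
      fibMeas_of_measurable (measurable_pi_apply t)
    exact (ih.prodMk h1).map fun z m =>
      match z.1 m with
      | some k => some k
      | none => if collides (fun n => (z.1 n).getD (z.2 n)) m then none else some (z.2 m)

theorem exists_free_arm (hMK : M ≤ K) (A : Fin M → Fin K) (m : Fin M) :
    ∃ a, ∀ n, n ≠ m → A n ≠ a := by
  have h1 : ((Finset.univ.erase m).image A).card < (Finset.univ : Finset (Fin K)).card := by
    refine lt_of_le_of_lt Finset.card_image_le ?_
    rw [Finset.card_erase_of_mem (Finset.mem_univ m), Finset.card_univ, Finset.card_univ,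
      Fintype.card_fin, Fintype.card_fin]
    have := m.pos
    omega
  obtain ⟨a, -, ha⟩ := Finset.exists_mem_notMem_of_card_lt_card h1
  refine ⟨a, fun n hn hna => ha ?_⟩
  exact Finset.mem_image.2 ⟨n, Finset.mem_erase.2 ⟨hn, Finset.mem_univ n⟩, hna⟩

theorem occ_succ_ne_none {d d' : ℕ → Fin M → Fin K} {t : ℕ} {m : Fin M}
    (hpast : ∀ s < t, d s = d' s) (hother : ∀ n, n ≠ m → d t n = d' t n) {a : Fin K}
    (ha : ∀ n, n ≠ m → chairs d' t n ≠ a) (hd : d t m = a) : occ d (t + 1) m ≠ none := by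
  rcases hm : occ d t m with _ | k
  · rw [occ_succ_of_none hm, if_neg]
    · simp
    · simp only [collides, decide_eq_true_eq, not_exists, not_and]
      intro n hn h
      refine ha n hn ?_
      have e1 : chairs d t m = a := by simp [chairs, hm, hd]
      rw [← e1, ← h, chairs, chairs, occ_congr hpast, hother n hn]
  · rw [occ_succ_of_some hm]
    simp

variable {Ω : Type*} [MeasurableSpace Ω] {P : Measure Ω} [IsProbabilityMeasure P]
  {D : ℕ → Ω → Fin M → Fin K}

/-- Freeze all draws up to round t except the one of player m in round t. As M ≤ K, the others leave
some arm free; her own draw is independent of the frozen ones and hits that arm with probability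
1/K. -/
theorem measure_occ_succ_none_le [NeZero K] (hMK : M ≤ K) (hm : ∀ t, Measurable (D t))
    (hunif : ∀ t m a, P {ω | D t ω m = a} = (K : ENNReal)⁻¹)
    (hind : iIndepFun (fun (i : ℕ × Fin M) ω => D i.1 ω i.2) P) (t : ℕ) (m : Fin M) :
    P {ω | occ (fun s => D s ω) (t + 1) m = none} ≤
      (1 - (K : ENNReal)⁻¹) * P {ω | occ (fun s => D s ω) t m = none} := by
  have hXm : ∀ i : ℕ × Fin M, Measurable fun ω => D i.1 ω i.2 := fun i => by
    have := hm i.1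
    fun_prop
  have hDm : Measurable fun ω s => D s ω := measurable_pi_lambda _ hm
  set I : Finset (ℕ × Fin M) :=
    (Finset.range (t + 1) ×ˢ Finset.univ).erase (t, m) with hI
  have hIJ : Disjoint I {(t, m)} := by
    rw [Finset.disjoint_singleton_right]
    exact Finset.notMem_erase _ _
  have hindep := hind.indepFun_finset I {(t, m)} hIJ hXm
  set Z : Ω → I → Fin K := fun ω i => D i.1.1 ω i.1.2 with hZdef
  have hZ : FibMeas Z := fibMeas_of_measurable (measurable_pi_lambda _ fun i => hXm i.1)
  -- The values filled in outside `I` are irrelevant: `fill` is only used for earlier rounds and for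
  -- the other players in round t.
  let fill : (I → Fin K) → ℕ → Fin M → Fin K := fun z s n =>
    if h : (s, n) ∈ I then z ⟨(s, n), h⟩ else 0
  have hfill : ∀ ω s n, (s, n) ∈ I → D s ω n = fill (Z ω) s n := by
    intro ω s n h
    simp only [fill, h, dif_pos, hZdef]
  have hpast : ∀ ω, ∀ s < t, D s ω = fill (Z ω) s := by
    intro ω s hs
    funext n
    refine hfill ω s n ?_
    simp only [hI, Finset.mem_erase, Finset.mem_product, Finset.mem_range, Finset.mem_univ,
      and_true, ne_eq, Prod.mk.injEq]
    omega
  have hother : ∀ ω n, n ≠ m → D t ω n = fill (Z ω) t n := by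
    intro ω n hn
    refine hfill ω t n ?_
    simp [hI, hn]
  refine measure_le_of_countable hZ (((fibMeas_occ t).map fun o => o m).comp hDm
    |>.measurableSet {none}) _ fun z => ?_
  obtain ⟨a, ha⟩ := exists_free_arm hMK (chairs (fill z) t) m
  by_cases hz : occ (fill z) t m = none
  · have hG : (fun w => occ (fun s => D s w) t m) ⁻¹' {none} ∩ Z ⁻¹' {z} = Z ⁻¹' {z} := by
      refine Set.inter_eq_right.2 fun ω hω => ?_
      have hω' : Z ω = z := hω
      change occ (fun s => D s ω) t m = none
      rw [occ_congr (hpast ω), hω', hz]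
    have hA : {ω | occ (fun s => D s ω) (t + 1) m = none} ∩ Z ⁻¹' {z} ⊆
        Z ⁻¹' {z} ∩ (fun ω (i : ({(t, m)} : Finset (ℕ × Fin M))) => D i.1.1 ω i.1.2) ⁻¹'
          {x | x ⟨(t, m), Finset.mem_singleton_self _⟩ ≠ a} := by
      rintro ω ⟨h1, h2⟩
      refine ⟨h2, fun h3 => ?_⟩
      have hω' : Z ω = z := h2
      rw [← hω'] at ha
      exact occ_succ_ne_none (d := fun s => D s ω) (hpast ω) (hother ω) ha h3 h1
    have hcompl : P ((fun ω (i : ({(t, m)} : Finset (ℕ × Fin M))) => D i.1.1 ω i.1.2) ⁻¹'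
        {x | x ⟨(t, m), Finset.mem_singleton_self _⟩ ≠ a}) = 1 - (K : ENNReal)⁻¹ := by
      rw [← hunif t m a, ← prob_compl_eq_one_sub]
      · rfl
      · exact hXm (t, m) (measurableSet_singleton a)
    rw [hG]
    refine (measure_mono hA).trans (le_of_eq ?_)
    rw [hindep.measure_inter_preimage_eq_mul _ _ (measurableSet_singleton z)
      (MeasurableSet.of_discrete), hcompl, mul_comm]
  -- Here player m already holds an arm, which she keeps, so the event is empty.
  · refine le_of_eq_of_le ?_ zero_le
    convert measure_empty (μ := P)
    ext ω
    simp only [Set.mem_inter_iff, Set.mem_ofPred_eq, Set.mem_preimage, Set.mem_singleton_iff,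
      Set.mem_empty_iff_false, iff_false, not_and]
    intro h1 h2
    rcases hk : occ (fun s => D s ω) t m with _ | k
    · rw [occ_congr (hpast ω), h2] at hk
      exact hz hk
    · rw [occ_succ_of_some hk] at h1
      simp at h1

theorem measure_occ_none_le [NeZero K] (hMK : M ≤ K) (hm : ∀ t, Measurable (D t))
    (hunif : ∀ t m a, P {ω | D t ω m = a} = (K : ENNReal)⁻¹)
    (hind : iIndepFun (fun (i : ℕ × Fin M) ω => D i.1 ω i.2) P) (t : ℕ) (m : Fin M) :
    P {ω | occ (fun s => D s ω) t m = none} ≤ (1 - (K : ENNReal)⁻¹) ^ t := by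
  induction t with
  | zero => simpa using prob_le_one
  | succ t ih =>
    rw [pow_succ']
    exact (measure_occ_succ_none_le hMK hm hunif hind t m).trans (by gcongr)

theorem measure_exists_occ_none_le [NeZero K] (hMK : M ≤ K) {T : ℕ} (hT : 1 ≤ T)
    (hm : ∀ t, Measurable (D t))
    (hunif : ∀ t m a, P {ω | D t ω m = a} = (K : ENNReal)⁻¹)
    (hind : iIndepFun (fun (i : ℕ × Fin M) ω => D i.1 ω i.2) P) :
    P {ω | ∃ m, occ (fun s => D s ω) (chairsLength K T) m = none} ≤
      ENNReal.ofReal (M / ((K : ℝ) ^ 2 * T)) := by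
  have hK1 : (1 : ℝ) ≤ K := by exact_mod_cast Nat.pos_of_neZero K
  have hT1 : (1 : ℝ) ≤ T := by exact_mod_cast hT
  have hK0 : (0 : ℝ) < K := by linarith
  have hinv : (K : ℝ)⁻¹ ≤ 1 := inv_le_one_of_one_le₀ hK1
  have hb : 1 - (K : ENNReal)⁻¹ = ENNReal.ofReal (1 - (K : ℝ)⁻¹) := by
    rw [ENNReal.ofReal_sub _ (by positivity), ENNReal.ofReal_one, ENNReal.ofReal_inv_of_pos hK0,
      ENNReal.ofReal_natCast]
  have hN : (K : ℝ) * Real.log (K ^ 2 * T) ≤ chairsLength K T := by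
    have h := Nat.le_ceil ((K : ℝ) * Real.log (K / (1 / ((K : ℝ) * T))))
    have e : (K : ℝ) / (1 / ((K : ℝ) * T)) = K ^ 2 * T := by field_simp
    rw [e] at h
    simpa only [chairsLength, e] using h
  have hpow : (1 - (K : ℝ)⁻¹) ^ chairsLength K T ≤ 1 / ((K : ℝ) ^ 2 * T) := by
    calc (1 - (K : ℝ)⁻¹) ^ chairsLength K T
        ≤ Real.exp (-(K : ℝ)⁻¹) ^ chairsLength K T :=
          pow_le_pow_left₀ (by linarith) (Real.one_sub_le_exp_neg _) _
      _ = Real.exp (-(chairsLength K T * (K : ℝ)⁻¹)) := by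
          rw [← Real.exp_nat_mul]
          congr 1
          ring
      _ ≤ Real.exp (-Real.log (K ^ 2 * T)) := by
          gcongr
          rw [← div_eq_mul_inv, le_div_iff₀ hK0]
          linarith
      _ = 1 / ((K : ℝ) ^ 2 * T) := by
          rw [Real.exp_neg, Real.exp_log (by positivity), one_div]
  have e : {ω | ∃ m, occ (fun s => D s ω) (chairsLength K T) m = none} =
      ⋃ m, {ω | occ (fun s => D s ω) (chairsLength K T) m = none} := by
    ext ω
    simp
  rw [e]
  calc P (⋃ m, {ω | occ (fun s => D s ω) (chairsLength K T) m = none})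
      ≤ ∑ m, P {ω | occ (fun s => D s ω) (chairsLength K T) m = none} :=
        measure_iUnion_fintype_le _ _
    _ ≤ ∑ _m : Fin M, ENNReal.ofReal (1 / ((K : ℝ) ^ 2 * T)) := by
        refine Finset.sum_le_sum fun m _ => ?_
        refine (measure_occ_none_le hMK hm hunif hind _ m).trans ?_
        rw [hb, ← ENNReal.ofReal_pow (by linarith)]
        exact ENNReal.ofReal_le_ofReal hpow
    _ = ENNReal.ofReal (M / ((K : ℝ) ^ 2 * T)) := by
        rw [Finset.sum_const, nsmul_eq_mul, Finset.card_univ, Fintype.card_fin,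
          ← ENNReal.ofReal_natCast, ← ENNReal.ofReal_mul (by positivity)]
        congr 1
        ring

end ChairsProbability

/-! ### The regret on the good event -/

section GoodEvent

variable {K M n : ℕ}

theorem maxUtility_comp_perm (μ : Fin M → Fin K → ℝ) (σ : Equiv.Perm (Fin M)) :
    maxUtility (fun m => μ (σ m)) = maxUtility μ := by
  refine Equiv.iSup_congr (Equiv.embeddingCongr σ (Equiv.refl (Fin K))) fun π => ?_
  rw [← Equiv.sum_comp σ]
  refine Finset.sum_congr rfl fun m _ => ?_
  simp

theorem roundRegret_comp_perm (μ : Fin M → Fin K → ℝ) (A : Fin M → Fin K)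
    (σ : Equiv.Perm (Fin M)) :
    roundRegret (fun m => μ (σ m)) (fun m => A (σ m)) = roundRegret μ A := by
  rw [roundRegret, maxUtility_comp_perm, roundRegret]
  congr 1
  rw [← Equiv.sum_comp σ fun m => if collides A m then 0 else μ m (A m)]
  refine Finset.sum_congr rfl fun m _ => ?_
  rw [collides_comp_perm]

/-- The player of each rank, for the arms occupied at the end of the musical chairs phase. -/
def playerOfRank (o : Fin M → Option (Fin K)) : Equiv.Perm (Fin M) :=
  open scoped Classical in
  if h : ∃ k : Fin M → Fin K, Function.Injective k ∧ ∀ m, o m = some (k m) then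
    (rankEquiv h.choose h.choose_spec.1).symm
  else 1

theorem exists_playerOfRank_eq (d : ℕ → Fin M → Fin K) (N : ℕ) (h : ∀ m, occ d N m ≠ none) :
    ∃ (k : Fin M → Fin K) (hk : Function.Injective k), (∀ m, occ d N m = some (k m)) ∧
      playerOfRank (occ d N) = (rankEquiv k hk).symm := by
  have hex : ∃ k : Fin M → Fin K, Function.Injective k ∧ ∀ m, occ d N m = some (k m) := by
    choose k hk using fun m => Option.ne_none_iff_exists'.1 (h m)
    exact ⟨k, fun i j hij => occ_injective d N (hk i) (by rw [hij]; exact hk j), hk⟩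
  refine ⟨hex.choose, hex.choose_spec.1, hex.choose_spec.2, ?_⟩
  rw [playerOfRank, dif_pos hex]

/-- The pathwise bound on the good event. Relabelling by rank changes neither the optimal utility
nor the loss of a round, so the estimate for leader 0 transfers to the original labels. -/
theorem sum_roundRegret_le [NeZero K] (hn : n + 1 ≤ K) (hK : 2 ≤ K) {T : ℕ} (hT : 5 ≤ T)
    (rule : ArgmaxRule K) {μ : Fin (n + 1) → Fin K → ℝ} (h0 : ∀ m k, 0 ≤ μ m k)
    (h1 : ∀ m k, μ m k ≤ 1) {y : ℕ → Fin (n + 1) → Fin K → ℝ}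
    (hy : ∀ t m k, y t m k ∈ Set.Icc (0 : ℝ) 1) {d : ℕ → Fin (n + 1) → Fin K}
    (hocc : ∀ m, occ d (chairsLength K T) m ≠ none)
    (hdev : (fun t m => y t (playerOfRank (occ d (chairsLength K T)) m)) ∉ deviationUnion rule T
      (fun m => μ (playerOfRank (occ d (chairsLength K T)) m)) (initLength K T)) :
    ∑ t ∈ Finset.range T, roundRegret μ (armAt (metcElim rule T 1) y d t) ≤
      regretBound K (n + 1) T - 2 := by
  obtain ⟨k, hk, hok, hσ⟩ := exists_playerOfRank_eq d _ hocc
  rw [hσ] at hdev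
  set σ := (rankEquiv k hk).symm with hσdef
  have hat := atEpoch_init hn rule T 1 y d hok hk
  have hgood : ∀ q < T, Concentrates rule T (fun m => μ (σ m)) (fun t m => y t (σ m)) (q + 1)
      (epochData rule T (fun t m => y t (σ m)) (initLength K T) q) := by
    intro q hq
    refine concentrates_of_notMem rule fun m k hmem => hdev ?_
    exact Set.mem_iUnion.2 ⟨(⟨q, hq⟩, m, k), hmem⟩
  have h := tailSum_zero_le ((isPlay_progAt (metcElim rule T 1) y d).relabel σ) hn
    (four_le_log_two_div_delta hK hT) (fun m k => h0 (σ m) k) (fun m k => h1 (σ m) k)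
    (fun t m k => hy t (σ m) k) (four_le_initLength hK (by omega)) hgood hat
  have e : ∀ t, roundRegret (fun m => μ (σ m)) (armsOf (fun t m => d t (σ m))
      (fun t m => progAt (metcElim rule T 1) y d t (σ m)) t) =
      roundRegret μ (armAt (metcElim rule T 1) y d t) := fun t =>
    roundRegret_comp_perm μ (armAt (metcElim rule T 1) y d t) σ
  simp only [e, tailSum, ← Finset.range_eq_Ico] at h
  linarith [le_regretBound hn hK hT]

end GoodEvent

/-! ### The expected regret -/

section Expectation

variable {K M : ℕ} {Ω : Type*} [MeasurableSpace Ω] {P : Measure Ω}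
  {Y : ℕ → Ω → Fin M → Fin K → ℝ} {D : ℕ → Ω → Fin M → Fin K}

theorem IsBanditModel.integral_utility (hYD : IsBanditModel P Y D) (t : ℕ) (m : Fin M)
    (k : Fin K) : ∫ ω, Y t ω m k ∂P = meanUtility P Y m k :=
  (hYD.ident_Y m k t).integral_eq

theorem IsBanditModel.measurable_armAt [NeZero K] (hYD : IsBanditModel P Y D)
    (rule : ArgmaxRule K) (T t : ℕ) :
    Measurable fun ω => armAt (metcElim rule T 1) (fun s => Y s ω) (fun s => D s ω) t :=
  (METCElim.measurable_armAt (measProg_metcElim rule T 1) t).comp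
    ((measurable_pi_lambda _ hYD.measurable_Y).prodMk (measurable_pi_lambda _ hYD.measurable_D))

variable [IsProbabilityMeasure P]

theorem IsBanditModel.integrable_utility (hYD : IsBanditModel P Y D) (t : ℕ) (m : Fin M)
    (k : Fin K) : Integrable (fun ω => Y t ω m k) P := by
  have := hYD.measurable_Y t
  refine Integrable.of_bound (by fun_prop : Measurable fun ω => Y t ω m k).aestronglyMeasurable 1
    (Filter.Eventually.of_forall fun ω => ?_)
  have := hYD.mem_Icc t ω m k
  rw [Real.norm_eq_abs, abs_of_nonneg this.1]
  exact this.2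

theorem IsBanditModel.meanUtility_mem_Icc (hYD : IsBanditModel P Y D) (m : Fin M) (k : Fin K) :
    meanUtility P Y m k ∈ Set.Icc (0 : ℝ) 1 := by
  constructor
  · exact integral_nonneg fun ω => (hYD.mem_Icc 0 ω m k).1
  · have := integral_mono (hYD.integrable_utility 0 m k) (integrable_const (1 : ℝ))
      fun ω => (hYD.mem_Icc 0 ω m k).2
    simpa [meanUtility] using this

theorem IsBanditModel.integrable_gain (hYD : IsBanditModel P Y D) (t : ℕ) (m : Fin M)
    (A : Fin M → Fin K) : Integrable (fun ω => gain (Y t ω) A m) P := by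
  unfold gain
  split_ifs
  · exact integrable_zero _ _ _
  · exact hYD.integrable_utility t m _

/-- On rectangles both sides factor into the same three probabilities. It is used with X the past
utilities, Y the current ones and Z the draws. -/
theorem indepFun_prodMk_of_indepFun {α β γ : Type*} [MeasurableSpace α] [MeasurableSpace β]
    [MeasurableSpace γ] {X : Ω → α} {Y : Ω → β} {Z : Ω → γ} (hX : Measurable X)
    (hY : Measurable Y) (hZ : Measurable Z) (hXY : IndepFun X Y P)
    (hXYZ : IndepFun (fun ω => (X ω, Y ω)) Z P) : IndepFun (fun ω => (X ω, Z ω)) Y P := by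
  have hXZ : IndepFun X Z P := hXYZ.comp measurable_fst measurable_id
  rw [indepFun_iff_map_prod_eq_prod_map_map (by fun_prop) (by fun_prop)]
  have := Measure.isProbabilityMeasure_map (μ := P) hX.aemeasurable
  have := Measure.isProbabilityMeasure_map (μ := P) hY.aemeasurable
  have := Measure.isProbabilityMeasure_map (μ := P) hZ.aemeasurable
  have := Measure.isProbabilityMeasure_map (μ := P) ((hX.prodMk hZ).prodMk hY).aemeasurable
  refine Measure.ext_prod₃' fun {s t u} hs ht hu => ?_
  rw [Measure.prod_prod, Measure.map_apply (by fun_prop) ((hs.prod ht).prod hu),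
    Measure.map_apply (by fun_prop) (hs.prod ht), Measure.map_apply hY hu]
  have e1 : (fun ω => ((X ω, Z ω), Y ω)) ⁻¹' ((s ×ˢ t) ×ˢ u) =
      (fun ω => (X ω, Y ω)) ⁻¹' (s ×ˢ u) ∩ Z ⁻¹' t := by
    ext ω
    simp only [Set.mem_preimage, Set.mem_prod, Set.mem_inter_iff]
    tauto
  have e2 : (fun ω => (X ω, Y ω)) ⁻¹' (s ×ˢ u) = X ⁻¹' s ∩ Y ⁻¹' u := rfl
  have e3 : (fun ω => (X ω, Z ω)) ⁻¹' (s ×ˢ t) = X ⁻¹' s ∩ Z ⁻¹' t := rfl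
  rw [e1, hXYZ.measure_inter_preimage_eq_mul _ _ (hs.prod hu) ht, e2, e3,
    hXY.measure_inter_preimage_eq_mul _ _ hs hu, hXZ.measure_inter_preimage_eq_mul _ _ hs ht]
  ring

theorem integrable_comp_of_finite {ι : Type*} [Finite ι] {A : Ω → ι} (hA : FibMeas A)
    (φ : ι → ℝ) : Integrable (fun ω => φ (A ω)) P := by
  obtain ⟨C, hC⟩ := (Set.finite_range fun i => ‖φ i‖).bddAbove
  exact Integrable.of_bound (hA.map φ).measurable.aestronglyMeasurable C
    (Filter.Eventually.of_forall fun ω => hC ⟨A ω, rfl⟩)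

/-- Splitting according to the finitely many values of `A` gives products of independent factors,
which is integration over `X` with `A` frozen. -/
theorem integral_glue_of_indepFun {ι E : Type*} [Fintype ι] [MeasurableSpace ι]
    [MeasurableSingletonClass ι] [MeasurableSpace E] {A : Ω → ι} {X : Ω → E}
    (hA : Measurable A) (hAX : IndepFun A X P) {f : ι → E → ℝ}
    (hf : ∀ a, Measurable (f a)) (hint : ∀ a, Integrable (fun ω => f a (X ω)) P) :
    ∫ ω, f (A ω) (X ω) ∂P = ∫ ω, ∫ ω', f (A ω) (X ω') ∂P ∂P := by
  classical
  have hA' : FibMeas A := fibMeas_of_measurable hA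
  have e : ∀ ω, f (A ω) (X ω) = ∑ a, (if A ω = a then (1 : ℝ) else 0) * f a (X ω) := by
    intro ω
    simp
  have hind : ∀ a, IndepFun (fun ω => if A ω = a then (1 : ℝ) else 0) (fun ω => f a (X ω)) P :=
    fun a => hAX.comp (φ := fun b => if b = a then (1 : ℝ) else 0)
      (measurable_of_finite _) (hf a)
  have hA1 : ∀ a, Integrable (fun ω => if A ω = a then (1 : ℝ) else 0) P := fun a =>
    integrable_comp_of_finite hA' fun b => if b = a then (1 : ℝ) else 0
  simp only [e]
  have hprod : ∀ a, Integrable (fun ω => (if A ω = a then (1 : ℝ) else 0) * f a (X ω)) P :=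
    fun a => (hind a).integrable_mul (hA1 a) (hint a)
  rw [integral_finsetSum _ fun a _ => hprod a]
  have e2 : ∀ ω, ∫ ω', f (A ω) (X ω') ∂P =
      ∑ a, (if A ω = a then (1 : ℝ) else 0) * ∫ ω', f a (X ω') ∂P := by
    intro ω
    simp
  simp only [e2]
  rw [integral_finsetSum _ fun a _ => (hA1 a).mul_const _]
  refine Finset.sum_congr rfl fun a _ => ?_
  rw [integral_mul_const]
  exact (hind a).integral_fun_mul_eq_mul_integral (hA1 a).aestronglyMeasurable
    (hint a).aestronglyMeasurable

variable [NeZero K]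

theorem progAt_congr (prog : Prog K Unit) {y y' : ℕ → Fin M → Fin K → ℝ}
    (d : ℕ → Fin M → Fin K) {t : ℕ} (h : ∀ s < t, y s = y' s) :
    progAt prog y d t = progAt prog y' d t := by
  induction t with
  | zero => rfl
  | succ t ih =>
    funext m
    simp only [progAt, ih fun s hs => h s (by omega), h t (by omega)]

theorem armAt_congr (prog : Prog K Unit) {y y' : ℕ → Fin M → Fin K → ℝ}
    (d : ℕ → Fin M → Fin K) {t : ℕ} (h : ∀ s < t, y s = y' s) :
    armAt prog y d t = armAt prog y' d t := by
  funext m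
  rw [armAt, armAt, progAt_congr prog d h]

/-- The arms of round t are a function of the utilities masked to earlier rounds and of the draws,
and this pair is independent of the current utilities. -/
theorem IsBanditModel.indepFun_armAt (hYD : IsBanditModel P Y D) (rule : ArgmaxRule K) (T t : ℕ) :
    IndepFun (fun ω => armAt (metcElim rule T 1) (fun s => Y s ω) (fun s => D s ω) t) (Y t) P := by
  have hYm : Measurable fun ω s => Y s ω := measurable_pi_lambda _ hYD.measurable_Y
  have hDm : Measurable fun ω s => D s ω := measurable_pi_lambda _ hYD.measurable_D
  have hmask : ∀ S : Finset ℕ, Measurable fun y : ℕ → Fin M → Fin K → ℝ => maskOn S y := by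
    intro S
    refine measurable_pi_lambda _ fun s => ?_
    unfold maskOn
    split_ifs
    · fun_prop
    · exact measurable_const
  have h1 : IndepFun (fun ω => maskOn (Finset.range t) fun s => Y s ω) (Y t) P := by
    have h := indepFun_maskOn (S := Finset.range t) (S' := {t}) hYD.measurable_Y hYD.indep_Y
      (by simp)
    have := h.comp measurable_id (measurable_pi_apply t)
    have e : Y t = (fun f : ℕ → Fin M → Fin K → ℝ => f t) ∘
        fun ω => maskOn {t} fun s => Y s ω := by
      funext ω
      simp [maskOn]
    rwa [← e] at this
  have h2 : IndepFun (fun ω => (maskOn (Finset.range t) fun s => Y s ω, Y t ω))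
      (fun ω s => D s ω) P :=
    hYD.indep_YD.comp (φ := fun y => (maskOn (Finset.range t) y, y t))
      ((hmask _).prodMk (measurable_pi_apply t)) measurable_id
  have h3 := indepFun_prodMk_of_indepFun ((hmask (Finset.range t)).comp hYm) (hYD.measurable_Y t)
    hDm h1 h2
  have h4 := h3.comp (METCElim.measurable_armAt (measProg_metcElim rule T 1) t) measurable_id
  convert h4 using 1
  · funext ω
    exact armAt_congr _ _ fun s hs => by simp [maskOn, hs]
  · rfl

theorem IsBanditModel.integrable_rewardAt (hYD : IsBanditModel P Y D) (rule : ArgmaxRule K)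
    (T t : ℕ) (m : Fin M) :
    Integrable (fun ω => rewardAt (metcElim rule T 1) (fun s => Y s ω) (fun s => D s ω) t m) P := by
  refine Integrable.of_bound (measurable_gain (hYD.measurable_Y t)
    (hYD.measurable_armAt rule T t) m).aestronglyMeasurable 1
    (Filter.Eventually.of_forall fun ω => ?_)
  rw [rewardAt, gain]
  split_ifs
  · simp
  · have := hYD.mem_Icc t ω m (armAt (metcElim rule T 1) (fun s => Y s ω) (fun s => D s ω) t m)
    rw [Real.norm_eq_abs, abs_of_nonneg this.1]
    exact this.2

theorem IsBanditModel.integral_rewardAt (hYD : IsBanditModel P Y D) (rule : ArgmaxRule K)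
    (T t : ℕ) (m : Fin M) :
    ∫ ω, rewardAt (metcElim rule T 1) (fun s => Y s ω) (fun s => D s ω) t m ∂P =
      ∫ ω, (if collides (armAt (metcElim rule T 1) (fun s => Y s ω) (fun s => D s ω) t) m then 0
        else meanUtility P Y m
          (armAt (metcElim rule T 1) (fun s => Y s ω) (fun s => D s ω) t m)) ∂P := by
  have h := integral_glue_of_indepFun (f := fun A x => gain x A m)
    (hYD.measurable_armAt rule T t) (hYD.indepFun_armAt rule T t)
    (fun A => measurable_gain measurable_id measurable_const m)
    (fun A => hYD.integrable_gain t m A)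
  refine h.trans (integral_congr_ae (Filter.Eventually.of_forall fun ω => ?_))
  simp only [gain]
  split_ifs
  · simp
  · exact hYD.integral_utility t m _

theorem IsBanditModel.integrable_roundRegret (hYD : IsBanditModel P Y D) (rule : ArgmaxRule K)
    (T t : ℕ) (μ : Fin M → Fin K → ℝ) :
    Integrable (fun ω => roundRegret μ
      (armAt (metcElim rule T 1) (fun s => Y s ω) (fun s => D s ω) t)) P :=
  integrable_comp_of_finite (fibMeas_of_measurable (hYD.measurable_armAt rule T t)) (roundRegret μ)

theorem IsBanditModel.regret_eq (hYD : IsBanditModel P Y D) (rule : ArgmaxRule K) (T : ℕ) :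
    regret P Y D (metcElim rule T 1) T = ∫ ω, ∑ t ∈ Finset.range T,
      roundRegret (meanUtility P Y)
        (armAt (metcElim rule T 1) (fun s => Y s ω) (fun s => D s ω) t) ∂P := by
  have hfin : ∀ t m, Integrable (fun ω =>
      if collides (armAt (metcElim rule T 1) (fun s => Y s ω) (fun s => D s ω) t) m then 0
        else meanUtility P Y m
          (armAt (metcElim rule T 1) (fun s => Y s ω) (fun s => D s ω) t m)) P := fun t m =>
    integrable_comp_of_finite (fibMeas_of_measurable (hYD.measurable_armAt rule T t))
      fun A => if collides A m then 0 else meanUtility P Y m (A m)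
  rw [regret, integral_finsetSum _ fun t _ => hYD.integrable_roundRegret rule T t _,
    integral_finsetSum _ fun t _ => integrable_finsetSum _ fun m _ =>
      hYD.integrable_rewardAt rule T t m]
  have e : ∀ t, ∫ ω, roundRegret (meanUtility P Y)
      (armAt (metcElim rule T 1) (fun s => Y s ω) (fun s => D s ω) t) ∂P =
      maxUtility (meanUtility P Y) - ∫ ω, ∑ m, rewardAt (metcElim rule T 1) (fun s => Y s ω)
        (fun s => D s ω) t m ∂P := by
    intro t
    simp only [roundRegret]
    rw [integral_sub (integrable_const _) (integrable_finsetSum _ fun m _ => hfin t m),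
      integral_finsetSum _ fun m _ => hfin t m,
      integral_finsetSum _ fun m _ => hYD.integrable_rewardAt rule T t m]
    simp [hYD.integral_rewardAt]
  simp [e]

theorem IsBanditModel.regret_le_mul (hYD : IsBanditModel P Y D) (hMK : M ≤ K)
    (rule : ArgmaxRule K) (T : ℕ) : regret P Y D (metcElim rule T 1) T ≤ T * M := by
  rw [hYD.regret_eq]
  have := integral_mono (integrable_finsetSum (Finset.range T) fun t _ =>
    hYD.integrable_roundRegret rule T t (meanUtility P Y)) (integrable_const ((T : ℝ) * M))
    fun ω => (Finset.sum_le_sum fun t _ => roundRegret_le hMK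
      (fun m k => (hYD.meanUtility_mem_Icc m k).1) (fun m k => (hYD.meanUtility_mem_Icc m k).2)
      _).trans (le_of_eq (by simp))
  simpa using this

end Expectation

/-! ### The expected regret for K ≥ 2 and T ≥ 5. -/

section Conclusion

variable {K n : ℕ} [NeZero K] {Ω : Type*} [MeasurableSpace Ω] {P : Measure Ω}
  [IsProbabilityMeasure P]
  {Y : ℕ → Ω → Fin (n + 1) → Fin K → ℝ} {D : ℕ → Ω → Fin (n + 1) → Fin K}

/-- For a fixed permutation the relabelled utilities satisfy the same assumptions. The actual
permutation is a function of the draws, hence independent of the utilities, so its fibres can be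
summed. -/
theorem IsBanditModel.measure_deviation_le (hYD : IsBanditModel P Y D) {T : ℕ}
    (hL : 0 ≤ Real.log (2 / delta K (n + 1) T)) (hT : 1 ≤ T) (rule : ArgmaxRule K) (N t₁ : ℕ) :
    P {ω | (fun t m => Y t ω (playerOfRank (occ (fun s => D s ω) N) m)) ∈
      deviationUnion rule T
        (fun m => meanUtility P Y (playerOfRank (occ (fun s => D s ω) N) m)) t₁} ≤
      ENNReal.ofReal (1 / (((n + 1 : ℕ) : ℝ) * T)) := by
  have hDm : Measurable fun ω s => D s ω := measurable_pi_lambda _ hYD.measurable_D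
  have hσ : FibMeas fun d : ℕ → Fin (n + 1) → Fin K => playerOfRank (occ d N) :=
    (fibMeas_occ N).map playerOfRank
  have hmain := measure_le_of_countable (P := P) (hσ.comp hDm)
    (A := {ω | (fun t m => Y t ω (playerOfRank (occ (fun s => D s ω) N) m)) ∈
      deviationUnion rule T
        (fun m => meanUtility P Y (playerOfRank (occ (fun s => D s ω) N) m)) t₁})
    MeasurableSet.univ (ENNReal.ofReal (1 / (((n + 1 : ℕ) : ℝ) * T))) fun σ => ?_
  · simpa using hmain
  set B : Set (ℕ → Fin (n + 1) → Fin K → ℝ) :=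
    deviationUnion rule T (fun m => meanUtility P Y (σ m)) t₁ with hB
  have hBm : MeasurableSet B := measurableSet_deviationUnion rule _ _
  have hperm : Measurable fun (y : ℕ → Fin (n + 1) → Fin K → ℝ) t m => y t (σ m) := by
    fun_prop
  have hsub : {ω | (fun t m => Y t ω (playerOfRank (occ (fun s => D s ω) N) m)) ∈
      deviationUnion rule T
        (fun m => meanUtility P Y (playerOfRank (occ (fun s => D s ω) N) m)) t₁} ∩
      (fun ω => playerOfRank (occ (fun s => D s ω) N)) ⁻¹' {σ} ⊆
      (fun ω t => Y t ω) ⁻¹' ((fun y t m => y t (σ m)) ⁻¹' B) ∩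
        (fun ω t => D t ω) ⁻¹' ((fun d => playerOfRank (occ d N)) ⁻¹' {σ}) := by
    rintro ω ⟨h1, h2⟩
    have h2' : playerOfRank (occ (fun s => D s ω) N) = σ := h2
    refine ⟨?_, h2'⟩
    simp only [Set.mem_ofPred_eq, h2'] at h1
    exact h1
  refine (measure_mono hsub).trans ?_
  rw [hYD.indep_YD.measure_inter_preimage_eq_mul _ _ (hperm hBm) (hσ.measurableSet {σ})]
  rw [Set.univ_inter]
  refine mul_le_mul' ?_ le_rfl
  exact measure_deviationUnion_le rule hL hT (Y := fun t ω m => Y t ω (σ m))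
    (fun t => by have := hYD.measurable_Y t; fun_prop) (fun t ω m k => hYD.mem_Icc t ω (σ m) k)
    (hYD.indep_Y.comp (fun _ x m => x (σ m)) fun _ => by fun_prop)
    (fun t m k => hYD.integral_utility t (σ m) k) t₁

theorem IsBanditModel.regret_le_of_five_le (hYD : IsBanditModel P Y D) (hn : n + 1 ≤ K)
    (hK : 2 ≤ K) {T : ℕ} (hT : 5 ≤ T) (rule : ArgmaxRule K) :
    regret P Y D (metcElim rule T 1) T ≤ regretBound K (n + 1) T := by
  have hL := four_le_log_two_div_delta (n := n) hK hT
  set bad₁ : Set Ω := {ω | ∃ m, occ (fun s => D s ω) (chairsLength K T) m = none} with hbad₁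
  set bad₂ : Set Ω := {ω | (fun t m => Y t ω (playerOfRank (occ (fun s => D s ω)
      (chairsLength K T)) m)) ∈ deviationUnion rule T (fun m => meanUtility P Y
        (playerOfRank (occ (fun s => D s ω) (chairsLength K T)) m)) (initLength K T)} with hbad₂
  have hP₁ : P bad₁ ≤ ENNReal.ofReal (((n + 1 : ℕ) : ℝ) / ((K : ℝ) ^ 2 * T)) :=
    measure_exists_occ_none_le hn (by omega) hYD.measurable_D hYD.unif_D hYD.indep_D
  have hP₂ : P bad₂ ≤ ENNReal.ofReal (1 / (((n + 1 : ℕ) : ℝ) * T)) :=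
    hYD.measure_deviation_le (by linarith) (by omega) rule _ _
  -- Passing to a measurable hull avoids proving that the bad event is measurable.
  set bad := toMeasurable P (bad₁ ∪ bad₂) with hbad
  have hbadm : MeasurableSet bad := measurableSet_toMeasurable _ _
  have hP : P.real bad ≤ ((n + 1 : ℕ) : ℝ) / ((K : ℝ) ^ 2 * T) +
      1 / (((n + 1 : ℕ) : ℝ) * T) := by
    rw [measureReal_def, hbad, measure_toMeasurable]
    refine ENNReal.toReal_le_of_le_ofReal (by positivity) ?_
    rw [ENNReal.ofReal_add (by positivity) (by positivity)]
    exact (measure_union_le _ _).trans (add_le_add hP₁ hP₂)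
  have h0 : ∀ m k, 0 ≤ meanUtility P Y m k := fun m k => (hYD.meanUtility_mem_Icc m k).1
  have h1 : ∀ m k, meanUtility P Y m k ≤ 1 := fun m k => (hYD.meanUtility_mem_Icc m k).2
  have hge := regretBound_ge (K := K) (T := T) (n + 1) (by omega) (by omega)
  have hR : 0 ≤ regretBound K (n + 1) T - 2 := by
    have : 0 ≤ 2 * (((n + 1 : ℕ) : ℝ) * K) := by positivity
    linarith
  have hpt : ∀ ω, ∑ t ∈ Finset.range T, roundRegret (meanUtility P Y)
      (armAt (metcElim rule T 1) (fun s => Y s ω) (fun s => D s ω) t) ≤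
      (regretBound K (n + 1) T - 2) +
        bad.indicator (fun _ => (T : ℝ) * ((n + 1 : ℕ) : ℝ)) ω := by
    intro ω
    by_cases hω : ω ∈ bad
    · rw [Set.indicator_of_mem hω]
      refine (Finset.sum_le_sum fun t _ => roundRegret_le hn h0 h1 _).trans ?_
      rw [Finset.sum_const, nsmul_eq_mul, Finset.card_range]
      linarith
    · rw [Set.indicator_of_notMem hω, add_zero]
      have hω' : ω ∉ bad₁ ∪ bad₂ := fun h => hω (subset_toMeasurable _ _ h)
      rw [Set.mem_union, not_or] at hω'
      refine sum_roundRegret_le hn hK hT rule h0 h1 (fun t m k => hYD.mem_Icc t ω m k) ?_ hω'.2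
      intro m hm
      exact hω'.1 ⟨m, hm⟩
  have hind : Integrable (bad.indicator fun _ : Ω => (T : ℝ) * ((n + 1 : ℕ) : ℝ)) P :=
    (integrable_const _).indicator hbadm
  rw [hYD.regret_eq]
  refine (integral_mono (integrable_finsetSum (Finset.range T) fun t _ =>
    hYD.integrable_roundRegret rule T t (meanUtility P Y))
    ((integrable_const _).add hind) hpt).trans ?_
  simp only [Pi.add_apply]
  rw [integral_add (integrable_const _) hind, integral_indicator_const _ hbadm]
  simp only [integral_const, probReal_univ, smul_eq_mul, one_mul]
  have hKn : ((n + 1 : ℕ) : ℝ) ≤ K := by exact_mod_cast hn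
  have hn0 : (0 : ℝ) < ((n + 1 : ℕ) : ℝ) := by positivity
  have hT0 : (0 : ℝ) < T := by
    have : 0 < T := by omega
    exact_mod_cast this
  have hK0 : (0 : ℝ) < K := hn0.trans_le hKn
  have hfin : P.real bad * ((T : ℝ) * ((n + 1 : ℕ) : ℝ)) ≤ 2 := by
    calc P.real bad * ((T : ℝ) * ((n + 1 : ℕ) : ℝ))
        ≤ (((n + 1 : ℕ) : ℝ) / ((K : ℝ) ^ 2 * T) + 1 / (((n + 1 : ℕ) : ℝ) * T)) *
          ((T : ℝ) * ((n + 1 : ℕ) : ℝ)) := by gcongr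
      -- The two failure probabilities M/(K²T) and 1/(MT), each multiplied by the worst regret TM.
      _ = (((n + 1 : ℕ) : ℝ) / K) ^ 2 + 1 := by field_simp
      _ ≤ 2 := by
          have h2 : ((n + 1 : ℕ) : ℝ) / K ≤ 1 := (div_le_one hK0).2 hKn
          have h3 := pow_le_one₀ (n := 2) (by positivity) h2
          linarith
  linarith

end Conclusion

/-! ### The remaining cases K = 1 and T ≤ 4. -/

section Single

variable {M : ℕ} {Ω : Type*} [MeasurableSpace Ω] {P : Measure Ω} [IsProbabilityMeasure P]

theorem roundRegret_of_subsingleton {K : ℕ} [Subsingleton (Fin M)] [Subsingleton (Fin K)]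
    (hMK : M ≤ K) (μ : Fin M → Fin K → ℝ) (A : Fin M → Fin K) : roundRegret μ A = 0 := by
  obtain ⟨π, hπ, h⟩ := exists_weight_eq_maxUtility hMK μ
  rw [roundRegret_of_injective (Function.injective_of_subsingleton A), ← h,
    Subsingleton.elim π A, sub_self]

theorem IsBanditModel.regret_le {K : ℕ} [NeZero K] {Y : ℕ → Ω → Fin M → Fin K → ℝ}
    {D : ℕ → Ω → Fin M → Fin K} (hYD : IsBanditModel P Y D) (hM : 1 ≤ M) (hMK : M ≤ K)
    (rule : ArgmaxRule K) {T : ℕ} (hT : 1 ≤ T) :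
    regret P Y D (metcElim rule T 1) T ≤ regretBound K M T := by
  have hge := regretBound_ge (K := K) (T := T) M (by omega) hT
  have hK1 : (1 : ℝ) ≤ K := by exact_mod_cast hM.trans hMK
  have hM1 : (1 : ℝ) ≤ M := by exact_mod_cast hM
  rcases Nat.lt_or_ge K 2 with hK | hK
  · obtain rfl : K = 1 := by omega
    obtain rfl : M = 1 := by omega
    rw [hYD.regret_eq]
    simp only [roundRegret_of_subsingleton hMK, Finset.sum_const_zero, integral_zero]
    refine le_trans ?_ hge
    positivity
  -- For T ≤ 4 the trivial bound TM ≤ 4M ≤ 2MK is enough.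
  rcases Nat.lt_or_ge T 5 with hT5 | hT5
  · refine (hYD.regret_le_mul hMK rule T).trans (le_trans ?_ hge)
    have hK2 : (2 : ℝ) ≤ K := by exact_mod_cast hK
    have hT4 : (T : ℝ) ≤ 4 := by exact_mod_cast (by omega : T ≤ 4)
    nlinarith
  · obtain ⟨n, rfl⟩ : ∃ n, M = n + 1 := ⟨M - 1, by omega⟩
    exact hYD.regret_le_of_five_le hMK hK hT5 rule

end Single

end

end METCElim

theorem theorem4 {K M : ℕ} [NeZero K] (hM : 1 ≤ M) (hMK : M ≤ K)
    {Ω : Type*} [MeasurableSpace Ω] (P : Measure Ω) [IsProbabilityMeasure P]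
    (Y : ℕ → Ω → Fin M → Fin K → ℝ) (D : ℕ → Ω → Fin M → Fin K)
    (hYD : METCElim.IsBanditModel P Y D)
    (rule : METCElim.ArgmaxRule K) (T : ℕ) (hT : 1 ≤ T) :
    METCElim.regret P Y D (METCElim.metcElim rule T 1) T ≤
      2 + M * K * Real.log (Real.exp 2 * (K : ℝ) ^ 2 * T)
        + 3 * (M : ℝ) ^ 2 * K * Real.logb 2 K * Real.logb 2 T
        + M * K * (Real.logb 2 T) ^ 2
        + (4 * √2 - 2) / (3 - 2 * √2) * (M : ℝ) ^ 3 * K * Real.logb 2 K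
            * √(Real.log (2 * (M : ℝ) ^ 2 * K * (T : ℝ) ^ 2))
        + 8 / (√2 - 1) * (K : ℝ) ^ (1 / 2 : ℝ) * (M : ℝ) ^ (3 / 2 : ℝ)
            * √(T * Real.log (2 * (M : ℝ) ^ 2 * K * (T : ℝ) ^ 2)) := by
  exact hYD.regret_le hM hMK rule hT
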